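/- All vector spaces are over $\mathbb C$. For a vector space $W$ put $\mathcal E(W)=\mathrm{Hom}(W,W((x)))$, with identity element $1_W$. A subset $S\subset\mathcal E(W)$ is called $\mathcal S$-local if for any $a(x),b(x)\in S$ there are $r\ge 0$, $f_i(x)\in\mathbb C((x))$ and $b^{(i)}(x),a^{(i)}(x)\in S$ ($1\le i\le r$) and an integer $k\ge 0$ such that $$(x_1-x_2)^k a(x_1)b(x_2)=(x_1-x_2)^k\sum_{i=1}^r f_i(x_2-x_1)\,b^{(i)}(x_2)a^{(i)}(x_1),$$ where each $f_i(x_2-x_1)$ is expanded in nonnegative powers of $x_1$. For $a(x),b(x)$ in an $\mathcal S$-local set and $n\in\mathbb Z$, the element $a(x)_nb(x)\in\mathcal E(W)$ is defined by $$\sum_{n\in\mathbb Z}(a(x)_nb(x))\,x_0^{-n-1}=\mathrm{Res}_{x_1}\,x^{-1}\delta\!\left(\frac{x_1-x_0}{x}\right)x_0^{-k}\left((x_1-x)^k a(x_1)b(x)\right),\qquad \delta(z)=\sum_{m\in\mathbb Z}z^m,$$ where $k\ge 0$ is any integer with $(x_1-x_2)^k a(x_1)b(x_2)\in\mathrm{Hom}(W,W((x_1,x_2)))$.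 (Here and below $(y\pm z)^m$ is expanded in nonnegative powers of the second variable $z$.) An $\mathcal S$-local subspace of $\mathcal E(W)$ is closed if it contains $a(x)_nb(x)$ whenever it contains $a(x),b(x)$, for all $n\in\mathbb Z$. For an $\mathcal S$-local set $S$, let $\langle S\rangle$ be the smallest closed $\mathcal S$-local subspace of $\mathcal E(W)$ containing $S$ and $1_W$. A weak quantum vertex algebra is a vector space $V$ with a vector $\mathbf 1$ and a linear map $Y(\cdot,x):V\to\mathcal E(V)$ such that $Y(\mathbf 1,x)v=v$, $Y(v,x)\mathbf 1\in V[[x]]$ and $\lim_{x\to0}Y(v,x)\mathbf 1=v$ for $v\in V$, and such that for any $u,v\in V$ there is $\sum_{i=1}^r v^{(i)}\otimes u^{(i)}\otimes f_i(x)\in V\otimes V\otimes\mathbb C((x))$ with $$x_0^{-1}\delta\!\left(\frac{x_1-x_2}{x_0}\right)Y(u,x_1)Y(v,x_2)-x_0^{-1}\delta\!\left(\frac{x_2-x_1}{-x_0}\right)\sum_{i=1}^r f_i(-x_0)Y(v^{(i)},x_2)Y(u^{(i)},x_1)=x_2^{-1}\delta\!\left(\frac{x_1-x_0}{x_2}\right)Y(Y(u,x_0)v,x_2).$$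 Theorem. Let $V$ be a vector space, $U\subset V$ a subset, $\mathbf 1\in V$ a vector, and $Y_0:U\to\mathcal E(V)$ a map; write $Y_0(u,x)=u(x)=\sum_{n\in\mathbb Z}u_nx^{-n-1}$ for $u\in U$. Assume: (1) $Y_0(u,x)\mathbf 1\in V[[x]]$ and $\lim_{x\to0}Y_0(u,x)\mathbf 1=u$ for all $u\in U$; (2) $Y_0(U)=\{Y_0(u,x)\mid u\in U\}$ is $\mathcal S$-local; (3) $V=\mathrm{span}\{u^{(1)}_{n_1}\cdots u^{(r)}_{n_r}\mathbf 1\mid r\ge0,\ u^{(i)}\in U,\ n_i\in\mathbb Z\}$; (4) there is a linear map $f:V\to\langle Y_0(U)\rangle$ with $f(\mathbf 1)=1_V$ and $f(u_nv)=u(x)_nf(v)$ for all $u\in U$, $n\in\mathbb Z$, $v\in V$. Then there is a unique linear map $Y:V\to\mathcal E(V)$ extending $Y_0$ such that $(V,Y,\mathbf 1)$ is a weak quantum vertex algebra. -/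

import Mathlib

/-!
Formal calculus and weak quantum vertex algebras over `ℂ`.

For a vector space `W`, the space `ℰ(W) = Hom(W, W((x)))` is Mathlib's `VertexOperator ℂ W`.
For `a : VertexOperator ℂ W`, `HVertexOperator.coeff a p w` is the coefficient of `x ^ p` in
`a(x) w`, and `VertexOperator.ncoeff a n = HVertexOperator.coeff a (-n - 1)` is the mode `aₙ`
of `a(x) = ∑ aₙ x ^ (-n-1)`.

A two-variable formal series in `W[[x₁, x₁⁻¹, x₂, x₂⁻¹]]` is a function `F : ℤ → ℤ → W`, where
`F p q` is the coefficient of `x₁ ^ p * x₂ ^ q`.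
-/

noncomputable section

namespace QVA

open HVertexOperator

variable {W : Type*} [AddCommGroup W] [Module ℂ W]

/-! ### Formal series in two variables -/

/-- Multiplication of a two-variable formal series by `x₁ - x₂`.  Hence `mulDiff^[k] F` is
`(x₁ - x₂) ^ k * F(x₁, x₂)` for `k : ℕ`. -/
def mulDiff (F : ℤ → ℤ → W) : ℤ → ℤ → W :=
  fun p q => F (p - 1) q - F p (q - 1)

/-- `F ∈ W((x₁, x₂))`, i.e. `F` has only finitely many negative powers of `x₁` and of `x₂`. -/
def IsLaurentTwo (F : ℤ → ℤ → W) : Prop :=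
  ∃ N : ℤ, ∀ p q : ℤ, p < N ∨ q < N → F p q = 0

/-- The formal series `a(x₁) b(x₂) w`. -/
def prodSeries (a b : VertexOperator ℂ W) (w : W) : ℤ → ℤ → W :=
  fun p q => coeff a p (coeff b q w)

/-- The formal series `ι_{x₂,x₁} ((x₂ - x₁) ^ l * f(x₂ - x₁)) b(x₂) a(x₁) w`, where
`(x₂ - x₁) ^ l * f(x₂ - x₁) = ∑ₛ fₛ (x₂ - x₁) ^ (l + s)` and, for every integer `m`,
`(x₂ - x₁) ^ m = ∑_{j ≥ 0} (-1) ^ j * (m choose j) * x₂ ^ (m - j) * x₁ ^ j` is expanded in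
nonnegative powers of `x₁`.  All the sums are finite, see `oppSeries_finite`. -/
def oppSeries (l : ℤ) (f : LaurentSeries ℂ) (b a : VertexOperator ℂ W) (w : W) : ℤ → ℤ → W :=
  fun p q => ∑ᶠ i : ℤ × ℕ,
    (f.coeff i.1 * ((-1) ^ i.2 * (Ring.choose (l + i.1) i.2 : ℤ))) •
      coeff b (q - (l + i.1) + i.2) (coeff a (p - i.2) w)

theorem exists_coeff_eq_zero (a : VertexOperator ℂ W) (w : W) :
    ∃ N : ℤ, ∀ n < N, coeff a n w = 0 :=
  ⟨_, fun n hn => VertexOperator.coeff_eq_zero_of_lt_order a n w hn⟩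

theorem oppSeries_finite (l : ℤ) (f : LaurentSeries ℂ) (b a : VertexOperator ℂ W) (w : W)
    (p q : ℤ) : (Function.support fun i : ℤ × ℕ =>
      (f.coeff i.1 * ((-1) ^ i.2 * (Ring.choose (l + i.1) i.2 : ℤ))) •
        coeff b (q - (l + i.1) + i.2) (coeff a (p - i.2) w)).Finite := by
  obtain ⟨N, hN⟩ := exists_coeff_eq_zero a w
  choose M hM using fun j : ℕ => exists_coeff_eq_zero b (coeff a (p - j) w)
  refine ((Finset.range (p - N + 1).toNat).biUnion fun j : ℕ =>
    (Finset.Icc f.order (q - l + j - M j)).image fun s => (s, j)).finite_toSet.subset ?_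
  rintro ⟨s, j⟩ h
  have h1 : N ≤ p - j := by
    by_contra hlt
    exact h (by simp only [hN _ (not_le.mp hlt), map_zero, smul_zero])
  have h2 : f.order ≤ s := by
    by_contra hlt
    exact h (by simp only [HahnSeries.coeff_eq_zero_of_lt_order (not_le.mp hlt), zero_mul,
      zero_smul])
  have h3 : M j ≤ q - (l + s) + j := by
    by_contra hlt
    exact h (by simp only [hM j _ (not_le.mp hlt), smul_zero])
  simp only [Finset.coe_biUnion, Finset.coe_image, Set.mem_iUnion, Set.mem_image,
    Finset.coe_range, Set.mem_Iio, Finset.coe_Icc, Set.mem_Icc, Prod.mk.injEq]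
  exact ⟨j, by omega, s, by omega, rfl, rfl⟩

/-! ### `𝒮`-locality -/

/-- A subset `S` of `ℰ(W)` is `𝒮`-local if for all `a(x), b(x) ∈ S` there are
`fᵢ(x) ∈ ℂ((x))` and `bᵢ(x), aᵢ(x) ∈ S` (`i = 1, …, r`) and `k ≥ 0` with
`(x₁ - x₂)^k a(x₁) b(x₂) = (x₁ - x₂)^k ∑ᵢ ι_{x₂,x₁} (fᵢ(x₂ - x₁)) bᵢ(x₂) aᵢ(x₁)`. -/
def IsSLocal (S : Set (VertexOperator ℂ W)) : Prop :=
  ∀ a ∈ S, ∀ b ∈ S, ∃ (r : ℕ) (f : Fin r → LaurentSeries ℂ) (b' a' : Fin r → VertexOperator ℂ W),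
    (∀ i, b' i ∈ S ∧ a' i ∈ S) ∧
    ∃ k : ℕ, ∀ w : W, mulDiff^[k] (prodSeries a b w) =
      mulDiff^[k] (fun p q => ∑ i, oppSeries 0 (f i) (b' i) (a' i) w p q)

/-! ### The products `a(x)ₙ b(x)` -/

/-- `(x₁ - x₂)^k a(x₁) b(x₂) ∈ Hom(W, W((x₁, x₂)))`. -/
def Compat (a b : VertexOperator ℂ W) (k : ℕ) : Prop :=
  ∀ w : W, IsLaurentTwo (mulDiff^[k] (prodSeries a b w))

/-- The coefficient of `x₀ ^ (-n-1) * x ^ t` in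
`Res_{x₁} x⁻¹ δ((x₁ - x₀)/x) x₀ ^ (-k) ((x₁ - x)^k a(x₁) b(x) w)`.  With
`F(x₁, x) = (x₁ - x)^k a(x₁) b(x) w = ∑ F_{p,q} x₁^p x^q ∈ W((x₁, x))` this residue is
`x₀ ^ (-k) F(x + x₀, x) = ∑_{p,q} ∑_{i ≥ 0} (p choose i) F_{p,q} x^(p-i+q) x₀^(i-k)`,
so only `i = k - n - 1` contributes, and nothing does if `n ≥ k`. -/
def nthCoeff (k : ℕ) (a b : VertexOperator ℂ W) (n t : ℤ) (w : W) : W :=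
  if n < k then
    ∑ᶠ p : ℤ, (Ring.choose p (k - n - 1).toNat : ℤ) •
      (mulDiff^[k] (prodSeries a b w)) p (t + (k - n - 1) - p)
  else 0

theorem mulDiff_iterate_add (k : ℕ) (F G : ℤ → ℤ → W) :
    mulDiff^[k] (F + G) = mulDiff^[k] F + mulDiff^[k] G := by
  induction k with
  | zero => rfl
  | succ k ih =>
    simp only [Function.iterate_succ_apply', ih]
    funext p q
    simp only [mulDiff, Pi.add_apply]
    abel

theorem mulDiff_iterate_smul (k : ℕ) (c : ℂ) (F : ℤ → ℤ → W) :
    mulDiff^[k] (c • F) = c • mulDiff^[k] F := by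
  induction k with
  | zero => rfl
  | succ k ih =>
    simp only [Function.iterate_succ_apply', ih]
    funext p q
    simp only [mulDiff, Pi.smul_apply, smul_sub]

theorem prodSeries_add (a b : VertexOperator ℂ W) (v w : W) :
    prodSeries a b (v + w) = prodSeries a b v + prodSeries a b w := by
  funext p q
  simp only [prodSeries, map_add, Pi.add_apply]

theorem prodSeries_smul (a b : VertexOperator ℂ W) (c : ℂ) (w : W) :
    prodSeries a b (c • w) = c • prodSeries a b w := by
  funext p q
  simp only [prodSeries, map_smul, Pi.smul_apply]

/-- The coefficients of `F(x + x₀, x)` are finite sums if `F ∈ W((x₁, x))`. -/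
theorem IsLaurentTwo.finite {F : ℤ → ℤ → W} (h : IsLaurentTwo F) (c : ℤ → ℤ) (s : ℤ) :
    (Function.support fun p : ℤ => c p • F p (s - p)).Finite := by
  obtain ⟨N, hN⟩ := h
  refine (Set.finite_Icc N (s - N)).subset fun p hp => ?_
  by_contra hcon
  refine hp ?_
  have : F p (s - p) = 0 := hN _ _ (by
    simp only [Set.mem_Icc, not_and_or, not_le] at hcon
    omega)
  simp only [this, smul_zero]

theorem nthCoeff_bddBelow {a b : VertexOperator ℂ W} {k : ℕ} (h : Compat a b k) (n : ℤ) (w : W) :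
    BddBelow (Function.support fun t => nthCoeff k a b n t w) := by
  obtain ⟨N, hN⟩ := h w
  refine ⟨2 * N - (k - n - 1), fun t ht => ?_⟩
  by_contra hlt
  refine ht ?_
  unfold nthCoeff
  split_ifs
  · refine finsum_eq_zero_of_forall_eq_zero fun p => ?_
    rw [hN _ _ (by omega), smul_zero]
  · rfl

/-- `nthCoeff` as a linear operator on `W`. -/
def nthCoeffLin {a b : VertexOperator ℂ W} {k : ℕ} (h : Compat a b k) (n t : ℤ) :
    Module.End ℂ W where
  toFun w := nthCoeff k a b n t w
  map_add' v w := by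
    unfold nthCoeff
    split_ifs
    · rw [← finsum_add_distrib ((h v).finite _ _) ((h w).finite _ _)]
      simp only [prodSeries_add, mulDiff_iterate_add, Pi.add_apply, smul_add]
    · simp
  map_smul' c w := by
    unfold nthCoeff
    split_ifs
    · rw [RingHom.id_apply, smul_finsum' c ((h w).finite _ _)]
      simp only [prodSeries_smul, mulDiff_iterate_smul, Pi.smul_apply, smul_comm c]
    · simp

open Classical in
/-- `a(x)ₙ b(x) ∈ ℰ(W)`, the coefficient of `x₀ ^ (-n-1)` in
`Y_ℰ(a(x), x₀) b(x) = Res_{x₁} x⁻¹ δ((x₁ - x₀)/x) x₀ ^ (-k) ((x₁ - x)^k a(x₁) b(x))`, where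
`k` is any nonnegative integer with `(x₁ - x₂)^k a(x₁) b(x₂) ∈ Hom(W, W((x₁, x₂)))`; the choice
of `k` does not matter, see `coeff_nthProd`.  By convention it is `0` if there is no such `k`,
which does not happen for `a(x), b(x)` in an `𝒮`-local set. -/
def nthProd (a : VertexOperator ℂ W) (n : ℤ) (b : VertexOperator ℂ W) : VertexOperator ℂ W :=
  if h : ∃ k, Compat a b k then
    VertexOperator.of_coeff (nthCoeffLin h.choose_spec n) (nthCoeff_bddBelow h.choose_spec n)
  else 0

theorem compat_succ {a b : VertexOperator ℂ W} {k : ℕ} (h : Compat a b k) :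
    Compat a b (k + 1) := by
  intro w
  obtain ⟨N, hN⟩ := h w
  refine ⟨N, fun p q hpq => ?_⟩
  rw [Function.iterate_succ_apply', mulDiff, hN _ _ (by omega), hN _ _ (by omega), sub_zero]

theorem nthCoeff_succ {a b : VertexOperator ℂ W} {k : ℕ} (h : Compat a b k) (n t : ℤ) (w : W) :
    nthCoeff (k + 1) a b n t w = nthCoeff k a b n t w := by
  unfold nthCoeff
  simp only [Function.iterate_succ_apply', mulDiff]
  set F := mulDiff^[k] (prodSeries a b w) with hF
  have hL : IsLaurentTwo F := h w
  have key : ∀ c : ℤ → ℤ, ∀ s : ℤ,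
      ∑ᶠ p : ℤ, c p • (F (p - 1) (s + 1 - p) - F p (s + 1 - p - 1)) =
        ∑ᶠ p : ℤ, (c (p + 1) - c p) • F p (s - p) := by
    intro c s
    have e1 : ∑ᶠ p : ℤ, c p • F (p - 1) (s - (p - 1)) = ∑ᶠ p : ℤ, c (p + 1) • F p (s - p) := by
      rw [← finsum_comp_equiv (Equiv.addRight (1 : ℤ))]
      simp
    have f1 : (Function.support fun p : ℤ => c p • F (p - 1) (s - (p - 1))).Finite := by
      have := (hL.finite (fun p => c (p + 1)) s).preimage
        (f := fun p : ℤ => p - 1) (sub_left_injective.injOn)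
      refine this.subset fun p hp => ?_
      simpa using hp
    simp only [sub_smul, smul_sub]
    rw [finsum_sub_distrib (hL.finite (fun p => c (p + 1)) s) (hL.finite c s), ← e1,
      ← finsum_sub_distrib f1 (hL.finite c s)]
    refine finsum_congr fun p => ?_
    rw [show s + 1 - p = s - (p - 1) by ring, show s - (p - 1) - 1 = s - p by ring]
  rcases lt_trichotomy n k with hn | hn | hn
  · rw [if_pos (by push_cast; omega), if_pos hn]
    have hi : (((k + 1 : ℕ) : ℤ) - n - 1).toNat = ((k : ℤ) - n - 1).toNat + 1 := by omega
    rw [hi]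
    have := key (fun p => Ring.choose p (((k : ℤ) - n - 1).toNat + 1)) (t + (k - n - 1))
    convert this using 1
    · refine finsum_congr fun p => ?_
      rw [show t + (((k + 1 : ℕ) : ℤ) - n - 1) - p = t + ((k : ℤ) - n - 1) + 1 - p by
        push_cast; ring]
    · refine finsum_congr fun p => ?_
      rw [Ring.choose_succ_succ]
      congr 1
      ring
  · subst hn
    rw [if_pos (by push_cast; omega), if_neg (lt_irrefl _)]
    have := key (fun _ => 1) (t - 1)
    have hi : (((k + 1 : ℕ) : ℤ) - (k : ℤ) - 1).toNat = 0 := by omega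
    rw [hi]
    simp only [sub_self, zero_smul, finsum_zero] at this
    rw [← this]
    refine finsum_congr fun p => ?_
    rw [show t + (((k + 1 : ℕ) : ℤ) - k - 1) - p = t - 1 + 1 - p by push_cast; ring,
      Ring.choose_zero_right]
  · rw [if_neg (by push_cast; omega), if_neg (by omega)]

theorem nthCoeff_of_le {a b : VertexOperator ℂ W} {k m : ℕ} (h : Compat a b k) (hkm : k ≤ m)
    (n t : ℤ) (w : W) :
    Compat a b m ∧ nthCoeff m a b n t w = nthCoeff k a b n t w := by
  induction m, hkm using Nat.le_induction with
  | base => exact ⟨h, rfl⟩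
  | succ m _ ih => exact ⟨compat_succ ih.1, (nthCoeff_succ ih.1 n t w).trans ih.2⟩

/-- `a(x)ₙ b(x)` may be computed with any admissible `k`. -/
theorem coeff_nthProd {a b : VertexOperator ℂ W} {k : ℕ} (h : Compat a b k) (n t : ℤ) (w : W) :
    coeff (nthProd a n b) t w = nthCoeff k a b n t w := by
  have hex : ∃ k, Compat a b k := ⟨k, h⟩
  have e : coeff (nthProd a n b) t w = nthCoeff hex.choose a b n t w := by
    unfold nthProd
    rw [dif_pos hex]
    rfl
  rw [e]
  rcases le_total k hex.choose with hle | hle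
  · exact (nthCoeff_of_le h hle n t w).2
  · exact (nthCoeff_of_le hex.choose_spec hle n t w).2.symm

/-! ### The closed `𝒮`-local subspace generated by a set -/

/-- The identity operator `1_W ∈ ℰ(W)`. -/
def idOp (W : Type*) [AddCommGroup W] [Module ℂ W] : VertexOperator ℂ W :=
  VertexOperator.of_coeff (fun n => if n = 0 then LinearMap.id else 0) (fun w => ⟨0, fun n hn => by
    by_contra hlt
    exact hn (by simp [show n ≠ 0 by omega])⟩)

/-- An `𝒮`-local subspace `L` of `ℰ(W)` is closed if `a(x)ₙ b(x) ∈ L` for all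
`a(x), b(x) ∈ L` and `n ∈ ℤ`. -/
def IsClosedSLocal (L : Submodule ℂ (VertexOperator ℂ W)) : Prop :=
  IsSLocal (L : Set (VertexOperator ℂ W)) ∧ ∀ a ∈ L, ∀ b ∈ L, ∀ n : ℤ, nthProd a n b ∈ L

/-- `⟨S⟩`, the smallest closed `𝒮`-local subspace of `ℰ(W)` that contains `S` and `1_W`: the
intersection of all closed `𝒮`-local subspaces that contain `S` and `1_W`. -/
def generated (S : Set (VertexOperator ℂ W)) : Submodule ℂ (VertexOperator ℂ W) :=
  sInf {L | IsClosedSLocal L ∧ S ⊆ L ∧ idOp W ∈ L}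

/-! ### Weak quantum vertex algebras -/

/-- The creation property of `a(x)` for the vector `v`:
`a(x) 1 ∈ W[[x]]` and `lim_{x → 0} a(x) 1 = v`. -/
def IsCreative (one : W) (a : VertexOperator ℂ W) (v : W) : Prop :=
  (∀ n < 0, coeff a n one = 0) ∧ coeff a 0 one = v

/-- The coefficient of `x₀ ^ (-l-1) * x₁ ^ p * x₂ ^ q` in
`x₀⁻¹ δ((x₁ - x₂)/x₀) a(x₁) b(x₂) w = ∑ₗ x₀ ^ (-l-1) (x₁ - x₂) ^ l a(x₁) b(x₂) w`, with
`(x₁ - x₂) ^ l = ∑_{j ≥ 0} (-1) ^ j * (l choose j) * x₁ ^ (l - j) * x₂ ^ j`. -/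
def jacobiFirst (a b : VertexOperator ℂ W) (w : W) (l p q : ℤ) : W :=
  ∑ᶠ j : ℕ, ((-1) ^ j * Ring.choose l j : ℤ) • coeff a (p - (l - j)) (coeff b (q - j) w)

/-- The coefficient of `x₀ ^ (-l-1) * x₁ ^ p * x₂ ^ q` in
`x₀⁻¹ δ((x₂ - x₁)/(-x₀)) f(-x₀) b(x₂) a(x₁) w`.  Since
`x₀⁻¹ δ((x₂ - x₁)/(-x₀)) = ∑ₘ (-1) ^ m x₀ ^ (-m-1) (x₂ - x₁) ^ m`, where `(x₂ - x₁) ^ m` is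
expanded in nonnegative powers of `x₁`, and `f(-x₀) = ∑ₛ (-1) ^ s fₛ x₀ ^ s`, the terms that
contribute are those with `m = l + s`, and their sum is
`(-1) ^ l ∑ₛ fₛ (x₂ - x₁) ^ (l + s) b(x₂) a(x₁) w`. -/
def jacobiSecond (f : LaurentSeries ℂ) (b a : VertexOperator ℂ W) (w : W) (l p q : ℤ) : W :=
  (Int.negOnePow l : ℤ) • oppSeries l f b a w p q

/-- The coefficient of `x₀ ^ (-l-1) * x₁ ^ p * x₂ ^ q` in
`x₂⁻¹ δ((x₁ - x₀)/x₂) Y(Y(u, x₀)v, x₂) w`, where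
`x₂⁻¹ δ((x₁ - x₀)/x₂) = ∑ₘ x₂ ^ (-m-1) (x₁ - x₀) ^ m` and
`(x₁ - x₀) ^ m = ∑_{j ≥ 0} (-1) ^ j * (m choose j) * x₁ ^ (m - j) * x₀ ^ j`; the terms that
contribute are those with `m = p + j`. -/
def jacobiThird (Y : W →ₗ[ℂ] VertexOperator ℂ W) (u v w : W) (l p q : ℤ) : W :=
  ∑ᶠ j : ℕ, ((-1) ^ j * Ring.choose (p + j) j : ℤ) •
    coeff (Y (coeff (Y u) (-l - 1 - j) v)) (q + (p + j) + 1) w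

theorem jacobiFirst_finite (a b : VertexOperator ℂ W) (w : W) (l p q : ℤ) :
    (Function.support fun j : ℕ =>
      ((-1) ^ j * Ring.choose l j : ℤ) • coeff a (p - (l - j)) (coeff b (q - j) w)).Finite := by
  obtain ⟨N, hN⟩ := exists_coeff_eq_zero b w
  refine (Set.finite_Iio (q - N + 1).toNat).subset fun j hj => ?_
  by_contra hlt
  refine hj ?_
  have : coeff b (q - j) w = 0 := hN _ (by simp only [Set.mem_Iio] at hlt; omega)
  simp only [this, map_zero, smul_zero]

theorem jacobiThird_finite (Y : W →ₗ[ℂ] VertexOperator ℂ W) (u v w : W) (l p q : ℤ) :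
    (Function.support fun j : ℕ => ((-1) ^ j * Ring.choose (p + j) j : ℤ) •
      coeff (Y (coeff (Y u) (-l - 1 - j) v)) (q + (p + j) + 1) w).Finite := by
  obtain ⟨N, hN⟩ := exists_coeff_eq_zero (Y u) v
  refine (Set.finite_Iio (-l - 1 - N + 1).toNat).subset fun j hj => ?_
  by_contra hlt
  refine hj ?_
  have : coeff (Y u) (-l - 1 - j) v = 0 := hN _ (by simp only [Set.mem_Iio] at hlt; omega)
  simp only [this, map_zero, LinearMap.zero_apply, Pi.zero_apply, smul_zero]

/-- `(V, Y, 1)` is a weak quantum vertex algebra. -/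
structure IsWeakQVA {V : Type*} [AddCommGroup V] [Module ℂ V]
    (Y : V →ₗ[ℂ] VertexOperator ℂ V) (one : V) : Prop where
  /-- `Y(1, x) v = v` for all `v`. -/
  vacuum : Y one = idOp V
  /-- `Y(v, x) 1 ∈ V[[x]]` and `lim_{x → 0} Y(v, x) 1 = v`. -/
  creation : ∀ v, IsCreative one (Y v) v
  /-- For all `u, v` there is `∑ᵢ vᵢ ⊗ uᵢ ⊗ fᵢ(x) ∈ V ⊗ V ⊗ ℂ((x))` with
  `x₀⁻¹ δ((x₁ - x₂)/x₀) Y(u, x₁) Y(v, x₂)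
    - x₀⁻¹ δ((x₂ - x₁)/(-x₀)) ∑ᵢ fᵢ(-x₀) Y(vᵢ, x₂) Y(uᵢ, x₁)
    = x₂⁻¹ δ((x₁ - x₀)/x₂) Y(Y(u, x₀)v, x₂)`. -/
  jacobi : ∀ u v : V, ∃ (r : ℕ) (v' u' : Fin r → V) (f : Fin r → LaurentSeries ℂ),
    ∀ (w : V) (l p q : ℤ),
      jacobiFirst (Y u) (Y v) w l p q
        - ∑ i, jacobiSecond (f i) (Y (v' i)) (Y (u' i)) w l p q
        = jacobiThird Y u v w l p q

end QVA

end

/-!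
The map `Y` is `f` itself.  Everything is about the space `K = f(V)` of fields, which is spanned by
the words `a₁(x)_{n₁} (a₂(x)_{n₂} (⋯ 1_V))` in elements `aᵢ` of `S = Y₀(U)`.

*The products of two fields of `K` can be reordered.*  Write `a(x₁) b(x₂) ∼ (B, A)` if, after
multiplication by a power of `x₁ - x₂`, the series `a(x₁) b(x₂)` is a combination of series
`g(x₁ - x₂) b'(x₂) a'(x₁)` with `g` a power series, `b' ∈ B`, `a' ∈ A`; this is `reorderable A B`,
and `𝒮`-locality says that it holds for `A = B = S` (`IsSLocal.mem_reorderable`).  Reordering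
`a(x₁) b(x₂) c(x₃)` and then setting `x₂ = x₃ + x₀`, or `x₁ = x₂ + x₀`, shows that the relation
passes to products `bₙ c` and `aₘ b` (`prodSeries_nthProd_right_mem`,
`prodSeries_nthProd_left_mem`).  To make the residue that defines the `n`-th product applicable to
such intermediate series, it is extended to a linear operator `diag n` on two-variable series.  Both
`diag` and multiplication by a power series `g(x₁ - x₂)` (`act g`) are linear extensions from the
subspaces where they make sense, and they are only evaluated there.

*`K` is closed under all products.*  If `a`, `b`, `c` can be reordered pairwise, `(aₘ b)ₙ c` is a
combination of the `a_p (b_q c)` (`nthProd_nthProd_mem_span`).  For a three-variable series in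
`W((x₁, x₂, x₃))` this is a substitution, and the powers of `x₁ - x₂`, `x₁ - x₃`, `x₂ - x₃` that
take the general case there are removed one at a time, because they act on the products by shifting
the indices.

*The products are the fields of the modes.*  If `b` creates `v`, then `aₙ b` creates `aₙ v`
(`isCreative_nthProd`).  So by induction along words `f(v)` creates `v`.  Hence `f(u)ₙ f(v)`, which
lies in `K`, must be `f(uₙ v)`.

*The Jacobi identity.*  Its three terms, with the coefficients of `x₀ ^ (-l-1)` taken, are sequences
with `X (l + 1) = (x₁ - x₂) X l`; the difference of the left and the right side vanishes for large
`l` by the reordering relation and has no residue in `x₁`, since the residue of the left side is the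
`l`-th product (`HasReordering.residue`).  Such a sequence is zero (`eq_zero_of_residue`).

*Uniqueness.*  In a weak quantum vertex algebra the Jacobi identity gives `Y(uₙ v) = Y(u)ₙ Y(v)`
(`IsWeakQVA.map_ncoeff`), which determines `Y` on words.
-/

noncomputable section

namespace QVA

open HVertexOperator

variable {W : Type*} [AddCommGroup W] [Module ℂ W]

/-! ### Multiplication by `x₁ - x₂` -/

/-- Multiplication by `x₁ - x₂` as a linear endomorphism of `W[[x₁, x₁⁻¹, x₂, x₂⁻¹]]`. -/
def diffEnd : Module.End ℂ (ℤ → ℤ → W) where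
  toFun := mulDiff
  map_add' F G := by simpa using mulDiff_iterate_add 1 F G
  map_smul' c F := by simpa using mulDiff_iterate_smul 1 c F

theorem diffEnd_apply (F : ℤ → ℤ → W) (p q : ℤ) :
    diffEnd F p q = F (p - 1) q - F p (q - 1) := rfl

theorem diffEnd_pow_apply (k : ℕ) (F : ℤ → ℤ → W) : (diffEnd ^ k) F = mulDiff^[k] F :=
  Module.End.pow_apply _ _ _

theorem diffEnd_pow_succ_apply (k : ℕ) (F : ℤ → ℤ → W) (p q : ℤ) :
    (diffEnd ^ (k + 1)) F p q = (diffEnd ^ k) F (p - 1) q - (diffEnd ^ k) F p (q - 1) := by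
  rw [pow_succ']
  rfl

theorem diffEnd_pow_shift (k : ℕ) (F : ℤ → ℤ → W) (c d : ℤ) :
    (diffEnd ^ k) (fun p q => F (p - c) (q - d)) = fun p q => (diffEnd ^ k) F (p - c) (q - d) := by
  induction k with
  | zero => rfl
  | succ k ih =>
    funext p q
    simp only [diffEnd_pow_succ_apply, ih]
    rw [sub_right_comm p, sub_right_comm q]

theorem diffEnd_pow_map {W' : Type*} [AddCommGroup W'] [Module ℂ W'] (L : W →ₗ[ℂ] W') (k : ℕ)
    (F : ℤ → ℤ → W) :
    (diffEnd ^ k) (fun p q => L (F p q)) = fun p q => L ((diffEnd ^ k) F p q) := by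
  induction k with
  | zero => rfl
  | succ k ih =>
    funext p q
    simp only [diffEnd_pow_succ_apply, ih, map_sub]

/-- The coefficient of `x₁ ^ p * x₂ ^ q` in `(x₁ - x₂) ^ s * F` only involves the coefficients of
`F` of total degree `p + q - s` at exponents below `p` and `q`. -/
theorem diffEnd_pow_apply_eq_zero {F : ℤ → ℤ → W} (s : ℕ) {p q : ℤ}
    (h : ∀ p' ≤ p, ∀ q' ≤ q, p' + q' = p + q - s → F p' q' = 0) : (diffEnd ^ s) F p q = 0 := by
  induction s generalizing p q with
  | zero => exact h p le_rfl q le_rfl (by simp)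
  | succ s ih =>
    rw [diffEnd_pow_succ_apply, ih, ih, sub_zero]
    · intro p' hp q' hq e
      exact h p' (by omega) q' (by omega) (by push_cast; omega)
    · intro p' hp q' hq e
      exact h p' (by omega) q' (by omega) (by push_cast; omega)

/-- Multiplication by `x₁ - x₂` is injective on series with finitely many negative powers of
`x₁`. -/
theorem eq_zero_of_diffEnd_pow_eq_zero_left {F : ℤ → ℤ → W} {N : ℤ} (hN : ∀ p < N, F p = 0)
    (k : ℕ) (h : (diffEnd ^ k) F = 0) : F = 0 := by
  have base : ∀ G : ℤ → ℤ → W, (∀ p < N, G p = 0) → diffEnd G = 0 → G = 0 := by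
    intro G hG h0
    have step : ∀ (n : ℕ) (p q : ℤ), p < N + n → G p q = 0 := by
      intro n
      induction n with
      | zero => intro p q hp; rw [hG p (by simpa using hp)]; rfl
      | succ n ih =>
        intro p q hp
        have := congrFun (congrFun h0 p) (q + 1)
        rw [diffEnd_apply, ih (p - 1) _ (by push_cast at hp; omega), add_sub_cancel_right,
          zero_sub] at this
        simpa using this
    funext p q
    exact step (p - N + 1).toNat p q (by omega)
  induction k generalizing F with
  | zero => exact h
  | succ k ih =>
    refine base F hN (ih (fun p hp => ?_) (by rw [pow_succ] at h; exact h))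
    funext q
    rw [diffEnd_apply, hN p hp, hN (p - 1) (by omega)]
    simp

/-! ### Series with a pole of finite order along the diagonal -/

variable (W) in
/-- The space `W((x₁, x₂))`. -/
def laurentTwo : Submodule ℂ (ℤ → ℤ → W) where
  carrier := {F | IsLaurentTwo F}
  zero_mem' := ⟨0, fun _ _ _ => rfl⟩
  add_mem' := by
    rintro F G ⟨N, hN⟩ ⟨M, hM⟩
    refine ⟨min N M, fun p q h => ?_⟩
    rw [Pi.add_apply, Pi.add_apply, hN p q (by omega), hM p q (by omega), add_zero]
  smul_mem' := by
    rintro c F ⟨N, hN⟩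
    refine ⟨N, fun p q h => ?_⟩
    rw [Pi.smul_apply, Pi.smul_apply, hN p q h, smul_zero]

theorem shift_mem_laurentTwo {F : ℤ → ℤ → W} (h : F ∈ laurentTwo W) (c d : ℤ) :
    (fun p q => F (p - c) (q - d)) ∈ laurentTwo W := by
  obtain ⟨N, hN⟩ := h
  exact ⟨min (N + c) (N + d), fun p q h => hN _ _ (by omega)⟩

theorem diffEnd_mem_laurentTwo {F : ℤ → ℤ → W} (h : F ∈ laurentTwo W) :
    diffEnd F ∈ laurentTwo W := by
  have h1 := shift_mem_laurentTwo h 1 0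
  have h2 := shift_mem_laurentTwo h 0 1
  simp only [sub_zero] at h1 h2
  exact sub_mem h1 h2

theorem diffEnd_pow_mem_laurentTwo {F : ℤ → ℤ → W} {k m : ℕ} (hkm : k ≤ m)
    (h : (diffEnd ^ k) F ∈ laurentTwo W) : (diffEnd ^ m) F ∈ laurentTwo W := by
  induction m, hkm using Nat.le_induction with
  | base => exact h
  | succ m _ ih =>
    rw [pow_succ']
    exact diffEnd_mem_laurentTwo ih

variable (W) in
/-- The space of the series `F(x₁, x₂)` with `(x₁ - x₂) ^ k * F(x₁, x₂) ∈ W((x₁, x₂))` for some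
`k : ℕ`. -/
def finitePole : Submodule ℂ (ℤ → ℤ → W) where
  carrier := {F | ∃ k : ℕ, (diffEnd ^ k) F ∈ laurentTwo W}
  zero_mem' := ⟨0, zero_mem (laurentTwo W)⟩
  add_mem' := by
    rintro F G ⟨k, hk⟩ ⟨m, hm⟩
    refine ⟨max k m, ?_⟩
    rw [map_add]
    exact add_mem (diffEnd_pow_mem_laurentTwo (le_max_left _ _) hk)
      (diffEnd_pow_mem_laurentTwo (le_max_right _ _) hm)
  smul_mem' := by
    rintro c F ⟨k, hk⟩
    refine ⟨k, ?_⟩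
    rw [map_smul]
    exact Submodule.smul_mem _ c hk

theorem shift_mem_finitePole {F : ℤ → ℤ → W} (h : F ∈ finitePole W) (c d : ℤ) :
    (fun p q => F (p - c) (q - d)) ∈ finitePole W := by
  obtain ⟨k, hk⟩ := h
  exact ⟨k, by rw [diffEnd_pow_shift]; exact shift_mem_laurentTwo hk c d⟩

theorem diffEnd_mem_finitePole {F : ℤ → ℤ → W} (h : F ∈ finitePole W) :
    diffEnd F ∈ finitePole W := by
  obtain ⟨k, hk⟩ := h
  refine ⟨k, ?_⟩
  rw [← Module.End.mul_apply, ← pow_succ, pow_succ']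
  exact diffEnd_mem_laurentTwo hk

/-- The coefficient of `x₀ ^ (-n-1) * x ^ t` in `x₀ ^ (-k) * G(x + x₀, x)`, where
`G(x₁, x₂) = (x₁ - x₂) ^ k * F(x₁, x₂)`. -/
def diagRes (k : ℕ) (n : ℤ) (F : ℤ → ℤ → W) (t : ℤ) : W :=
  if n < k then
    ∑ᶠ p : ℤ, (Ring.choose p (k - n - 1).toNat : ℤ) • ((diffEnd ^ k) F) p (t + (k - n - 1) - p)
  else 0

theorem nthCoeff_eq_diagRes (k : ℕ) (a b : VertexOperator ℂ W) (n t : ℤ) (w : W) :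
    nthCoeff k a b n t w = diagRes k n (prodSeries a b w) t := by
  simp only [nthCoeff, diagRes, diffEnd_pow_apply]

theorem diagRes_succ {F : ℤ → ℤ → W} {k : ℕ} (h : (diffEnd ^ k) F ∈ laurentTwo W) (n t : ℤ) :
    diagRes (k + 1) n F t = diagRes k n F t := by
  unfold diagRes
  simp only [diffEnd_pow_succ_apply]
  set G := (diffEnd ^ k) F
  have hL : IsLaurentTwo G := h
  -- Summation by parts against a sequence `c`.
  have key : ∀ c : ℤ → ℤ, ∀ s : ℤ,
      ∑ᶠ p : ℤ, c p • (G (p - 1) (s + 1 - p) - G p (s + 1 - p - 1)) =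
        ∑ᶠ p : ℤ, (c (p + 1) - c p) • G p (s - p) := by
    intro c s
    have e1 : ∑ᶠ p : ℤ, c p • G (p - 1) (s - (p - 1)) = ∑ᶠ p : ℤ, c (p + 1) • G p (s - p) := by
      rw [← finsum_comp_equiv (Equiv.addRight (1 : ℤ))]
      simp
    have f1 : (Function.support fun p : ℤ => c p • G (p - 1) (s - (p - 1))).Finite := by
      have := (hL.finite (fun p => c (p + 1)) s).preimage
        (f := fun p : ℤ => p - 1) (sub_left_injective.injOn)
      refine this.subset fun p hp => ?_
      simpa using hp
    simp only [sub_smul, smul_sub]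
    rw [finsum_sub_distrib (hL.finite (fun p => c (p + 1)) s) (hL.finite c s), ← e1,
      ← finsum_sub_distrib f1 (hL.finite c s)]
    refine finsum_congr fun p => ?_
    rw [show s + 1 - p = s - (p - 1) by ring, show s - (p - 1) - 1 = s - p by ring]
  rcases lt_trichotomy n k with hn | hn | hn
  · rw [if_pos (by push_cast; omega), if_pos hn]
    have hi : (((k + 1 : ℕ) : ℤ) - n - 1).toNat = ((k : ℤ) - n - 1).toNat + 1 := by omega
    rw [hi]
    have := key (fun p => Ring.choose p (((k : ℤ) - n - 1).toNat + 1)) (t + (k - n - 1))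
    convert this using 1
    · refine finsum_congr fun p => ?_
      rw [show t + (((k + 1 : ℕ) : ℤ) - n - 1) - p = t + ((k : ℤ) - n - 1) + 1 - p by
        push_cast; ring]
    · refine finsum_congr fun p => ?_
      rw [Ring.choose_succ_succ]
      congr 1
      ring
  · subst hn
    rw [if_pos (by push_cast; omega), if_neg (lt_irrefl _)]
    have := key (fun _ => 1) (t - 1)
    have hi : (((k + 1 : ℕ) : ℤ) - (k : ℤ) - 1).toNat = 0 := by omega
    rw [hi]
    simp only [sub_self, zero_smul, finsum_zero] at this
    rw [← this]
    refine finsum_congr fun p => ?_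
    rw [show t + (((k + 1 : ℕ) : ℤ) - k - 1) - p = t - 1 + 1 - p by push_cast; ring,
      Ring.choose_zero_right]
  · rw [if_neg (by push_cast; omega), if_neg (by omega)]

theorem diagRes_of_le {F : ℤ → ℤ → W} {k m : ℕ} (hkm : k ≤ m)
    (h : (diffEnd ^ k) F ∈ laurentTwo W) (n t : ℤ) : diagRes m n F t = diagRes k n F t := by
  induction m, hkm using Nat.le_induction with
  | base => rfl
  | succ m hm ih => rw [diagRes_succ (diffEnd_pow_mem_laurentTwo hm h), ih]

theorem diagRes_eq_diagRes {F : ℤ → ℤ → W} {k m : ℕ}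
    (hk : (diffEnd ^ k) F ∈ laurentTwo W) (hm : (diffEnd ^ m) F ∈ laurentTwo W) (n t : ℤ) :
    diagRes k n F t = diagRes m n F t := by
  rw [← diagRes_of_le (le_max_left k m) hk, diagRes_of_le (le_max_right k m) hm]

theorem diagRes_add {F G : ℤ → ℤ → W} {k : ℕ}
    (hF : (diffEnd ^ k) F ∈ laurentTwo W) (hG : (diffEnd ^ k) G ∈ laurentTwo W) (n t : ℤ) :
    diagRes k n (F + G) t = diagRes k n F t + diagRes k n G t := by
  unfold diagRes
  split_ifs
  · rw [← finsum_add_distrib (IsLaurentTwo.finite hF _ _) (IsLaurentTwo.finite hG _ _)]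
    simp only [map_add, Pi.add_apply, smul_add]
  · simp

theorem diagRes_smul {F : ℤ → ℤ → W} {k : ℕ} (hF : (diffEnd ^ k) F ∈ laurentTwo W) (c : ℂ)
    (n t : ℤ) : diagRes k n (c • F) t = c • diagRes k n F t := by
  unfold diagRes
  split_ifs
  · rw [smul_finsum' c (IsLaurentTwo.finite hF _ _)]
    simp only [map_smul, Pi.smul_apply, smul_comm c]
  · simp

/-- The `n`-th diagonal product on the series with a finite pole along `x₁ = x₂`. -/
def diagOn (n : ℤ) : finitePole W →ₗ[ℂ] (ℤ → W) where
  toFun F := diagRes F.2.choose n F.1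
  map_add' F G := by
    funext t
    set m := max F.2.choose G.2.choose
    have hF := diffEnd_pow_mem_laurentTwo (le_max_left F.2.choose G.2.choose) F.2.choose_spec
    have hG := diffEnd_pow_mem_laurentTwo (le_max_right F.2.choose G.2.choose) G.2.choose_spec
    have hFG : (diffEnd ^ m) (F + G).1 ∈ laurentTwo W := by
      rw [Submodule.coe_add, map_add]; exact add_mem hF hG
    rw [Pi.add_apply, diagRes_eq_diagRes (F + G).2.choose_spec hFG,
      diagRes_eq_diagRes F.2.choose_spec hF, diagRes_eq_diagRes G.2.choose_spec hG]
    exact diagRes_add hF hG n t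
  map_smul' c F := by
    funext t
    have hc : (diffEnd ^ F.2.choose) (c • F).1 ∈ laurentTwo W := by
      rw [Submodule.coe_smul, map_smul]; exact Submodule.smul_mem _ c F.2.choose_spec
    rw [diagRes_eq_diagRes (c • F).2.choose_spec hc]
    exact diagRes_smul F.2.choose_spec c n t

/-- The coefficient of `x₀ ^ (-n-1)` in `F(x + x₀, x)` for a series `F(x₁, x₂)` with a finite pole
along `x₁ = x₂`, as a series in `x`.  It is extended to a linear map on all series in an arbitrary
way, so that it is additive without side conditions; only its values on `finitePole W` matter. -/
def diag (n : ℤ) : (ℤ → ℤ → W) →ₗ[ℂ] (ℤ → W) :=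
  (LinearMap.exists_extend (diagOn (W := W) n)).choose

theorem diag_eq {F : ℤ → ℤ → W} {k : ℕ} (h : (diffEnd ^ k) F ∈ laurentTwo W) (n t : ℤ) :
    diag n F t = diagRes k n F t := by
  have hF : F ∈ finitePole W := ⟨k, h⟩
  have e := LinearMap.congr_fun (LinearMap.exists_extend (diagOn (W := W) n)).choose_spec ⟨F, hF⟩
  have e' : diag n F = diagOn n ⟨F, hF⟩ := e
  rw [e']
  exact diagRes_eq_diagRes hF.choose_spec h n t

theorem diag_prodSeries {a b : VertexOperator ℂ W} {k : ℕ} (h : Compat a b k) (n : ℤ) (w : W)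
    (t : ℤ) : diag n (prodSeries a b w) t = coeff (nthProd a n b) t w := by
  rw [coeff_nthProd h, nthCoeff_eq_diagRes]
  exact diag_eq (by rw [diffEnd_pow_apply]; exact h w) n t

theorem diag_eq_zero {F : ℤ → ℤ → W} {k : ℕ} (h : (diffEnd ^ k) F ∈ laurentTwo W) {n : ℤ}
    (hn : k ≤ n) : diag n F = 0 := by
  funext t
  rw [diag_eq h, diagRes, if_neg (by omega), Pi.zero_apply]

theorem diag_diffEnd {F : ℤ → ℤ → W} (h : F ∈ finitePole W) (n : ℤ) :
    diag n (diffEnd F) = diag (n + 1) F := by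
  obtain ⟨k, hk⟩ := h
  have h1 := diffEnd_pow_mem_laurentTwo k.le_succ hk
  have h2 : (diffEnd ^ k) (diffEnd F) ∈ laurentTwo W := by
    rwa [← Module.End.mul_apply, ← pow_succ]
  funext t
  rw [diag_eq h1, diag_eq h2]
  have e1 : ((k + 1 : ℕ) : ℤ) - (n + 1) - 1 = k - n - 1 := by push_cast; ring
  simp only [diagRes, Nat.succ_eq_add_one, e1, ← Module.End.mul_apply, ← pow_succ]
  by_cases hn : n < k
  · rw [if_pos hn, if_pos (by push_cast; omega)]
  · rw [if_neg hn, if_neg (by push_cast; omega)]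

theorem diag_shift_right {F : ℤ → ℤ → W} (h : F ∈ finitePole W) (n t : ℤ) :
    diag n (fun p q => F p (q - 1)) t = diag n F (t - 1) := by
  obtain ⟨k, hk⟩ := h
  have e := diffEnd_pow_shift k F 0 1
  simp only [sub_zero] at e
  have h2 : (diffEnd ^ k) (fun p q => F p (q - 1)) ∈ laurentTwo W := by
    rw [e]
    simpa using shift_mem_laurentTwo hk 0 1
  rw [diag_eq hk, diag_eq h2]
  simp only [diagRes, e]
  split_ifs
  · refine finsum_congr fun p => ?_
    rw [show t + (k - n - 1) - p - 1 = t - 1 + (k - n - 1) - p by ring]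
  · rfl

theorem diag_shift_left {F : ℤ → ℤ → W} (h : F ∈ finitePole W) (n t : ℤ) :
    diag n (fun p q => F (p - 1) q) t = diag n F (t - 1) + diag (n + 1) F t := by
  rw [← diag_shift_right h, ← diag_diffEnd h, ← Pi.add_apply, ← map_add]
  have e : (fun p q => F (p - 1) q) = (fun p q => F p (q - 1)) + diffEnd F := by
    funext p q
    simp only [Pi.add_apply, diffEnd_apply]
    abel
  rw [e]

/-- `diag n F t` only depends on `(x₁ - x₂) ^ k * F` in one total degree. -/
theorem diag_congr {F G : ℤ → ℤ → W} {k : ℕ}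
    (hF : (diffEnd ^ k) F ∈ laurentTwo W) (hG : (diffEnd ^ k) G ∈ laurentTwo W) (n t : ℤ)
    (h : ∀ p q, p + q = t + (k - n - 1) → (diffEnd ^ k) F p q = (diffEnd ^ k) G p q) :
    diag n F t = diag n G t := by
  rw [diag_eq hF, diag_eq hG]
  unfold diagRes
  split_ifs
  · refine finsum_congr fun p => ?_
    rw [h _ _ (by ring)]
  · rfl

theorem exists_diag_eq_zero {F : ℤ → ℤ → W} (h : F ∈ finitePole W) (n : ℤ) :
    ∃ M : ℤ, ∀ t < M, diag n F t = 0 := by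
  obtain ⟨k, hk⟩ := h
  obtain ⟨N, hN⟩ := id hk
  refine ⟨2 * N - (k - n - 1), fun t ht => ?_⟩
  rw [diag_eq hk]
  unfold diagRes
  split_ifs
  · refine finsum_eq_zero_of_forall_eq_zero fun p => ?_
    rw [hN _ _ (by omega), smul_zero]
  · rfl

theorem diag_map {W' : Type*} [AddCommGroup W'] [Module ℂ W'] (L : W →ₗ[ℂ] W')
    {F : ℤ → ℤ → W} (h : F ∈ finitePole W) (n t : ℤ) :
    diag n (fun p q => L (F p q)) t = L (diag n F t) := by
  obtain ⟨k, hk⟩ := h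
  have h2 : (diffEnd ^ k) (fun p q => L (F p q)) ∈ laurentTwo W' := by
    obtain ⟨N, hN⟩ := hk
    refine ⟨N, fun p q hpq => ?_⟩
    rw [diffEnd_pow_map]
    show L _ = 0
    rw [hN p q hpq, map_zero]
  rw [diag_eq hk, diag_eq h2]
  simp only [diagRes, diffEnd_pow_map]
  split_ifs
  · rw [← LinearMap.toAddMonoidHom_coe, AddMonoidHom.map_finsum _ (IsLaurentTwo.finite hk _ _)]
    refine finsum_congr fun p => ?_
    rw [map_zsmul]
  · rw [map_zero]

/-! ### Power series in `x₁ - x₂` -/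

/-- `(x₁ - x₂) ^ s * F` tends to `0` coefficientwise, so that power series in `x₁ - x₂` act on
`F`. -/
def IsNil (F : ℤ → ℤ → W) : Prop :=
  ∀ p q : ℤ, ∃ N : ℕ, ∀ s ≥ N, (diffEnd ^ s) F p q = 0

/-- `F ∈ W((x₂))((x₁))`. -/
def IsIterated (F : ℤ → ℤ → W) : Prop :=
  (∃ N : ℤ, ∀ p < N, F p = 0) ∧ ∀ p, ∃ M : ℤ, ∀ q < M, F p q = 0

/-- A common lower bound for finitely many truncation bounds. -/
theorem exists_forall_le_of_bound {P : ℤ → ℤ → Prop} (hP : ∀ i, ∃ M, ∀ q < M, P i q) (a b : ℤ) :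
    ∃ M, ∀ i, a ≤ i → i ≤ b → ∀ q < M, P i q := by
  choose M hM using hP
  obtain ⟨m, hm⟩ := ((Finset.Icc a b).image M).bddBelow
  refine ⟨m, fun i hi hi' q hq => hM i q (lt_of_lt_of_le hq (hm ?_))⟩
  simp only [Finset.coe_image, Set.mem_image, Finset.coe_Icc, Set.mem_Icc]
  exact ⟨i, ⟨hi, hi'⟩, rfl⟩

theorem IsIterated.isNil {F : ℤ → ℤ → W} (h : IsIterated F) : IsNil F := by
  obtain ⟨⟨N, hN⟩, hM⟩ := h
  intro p q
  obtain ⟨M, hM⟩ := exists_forall_le_of_bound hM N p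
  refine ⟨(p + q - N - M + 1).toNat, fun s hs => diffEnd_pow_apply_eq_zero s ?_⟩
  intro p' hp q' hq e
  rcases lt_or_ge p' N with h1 | h1
  · rw [hN p' h1]; rfl
  · exact hM p' h1 hp q' (by omega)

theorem IsNil.shift {F : ℤ → ℤ → W} (h : IsNil F) (c d : ℤ) :
    IsNil (fun p q => F (p - c) (q - d)) := by
  intro p q
  obtain ⟨N, hN⟩ := h (p - c) (q - d)
  exact ⟨N, fun s hs => by rw [diffEnd_pow_shift]; exact hN s hs⟩

theorem IsNil.pow {F : ℤ → ℤ → W} (h : IsNil F) (k : ℕ) : IsNil ((diffEnd ^ k) F) := by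
  intro p q
  obtain ⟨N, hN⟩ := h p q
  refine ⟨N, fun s hs => ?_⟩
  rw [← Module.End.mul_apply, ← pow_add]
  exact hN _ (by omega)

theorem IsNil.sub {F G : ℤ → ℤ → W} (hF : IsNil F) (hG : IsNil G) : IsNil (F - G) := by
  intro p q
  obtain ⟨N, hN⟩ := hF p q
  obtain ⟨M, hM⟩ := hG p q
  refine ⟨max N M, fun s hs => ?_⟩
  rw [map_sub, Pi.sub_apply, Pi.sub_apply, hN s (by omega), hM s (by omega), sub_zero]

/-- The series on which power series in `x₁ - x₂` act, as far as the coefficient of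
`x₁ ^ p * x₂ ^ q` is concerned. -/
def nilAt (p q : ℤ) : Submodule ℂ (ℤ → ℤ → W) where
  carrier := {F | ∃ N : ℕ, ∀ s ≥ N, (diffEnd ^ s) F p q = 0}
  zero_mem' := ⟨0, fun s _ => by rw [map_zero]; rfl⟩
  add_mem' := by
    rintro F G ⟨N, hN⟩ ⟨M, hM⟩
    refine ⟨max N M, fun s hs => ?_⟩
    rw [map_add, Pi.add_apply, Pi.add_apply, hN s (by omega), hM s (by omega), add_zero]
  smul_mem' := by
    rintro c F ⟨N, hN⟩
    refine ⟨N, fun s hs => ?_⟩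
    rw [map_smul, Pi.smul_apply, Pi.smul_apply, hN s hs, smul_zero]

theorem nilAt_finite (g : PowerSeries ℂ) {p q : ℤ} {F : ℤ → ℤ → W} {N : ℕ}
    (hN : ∀ s ≥ N, (diffEnd ^ s) F p q = 0) :
    (Function.support fun s : ℕ => PowerSeries.coeff s g • (diffEnd ^ s) F p q) ⊆
      (Finset.range N : Set ℕ) := by
  intro s hs
  by_contra hlt
  refine hs ?_
  simp only [Finset.coe_range, Set.mem_Iio, not_lt] at hlt
  simp only [hN s hlt, smul_zero]

/-- The coefficient of `x₁ ^ p * x₂ ^ q` in `g(x₁ - x₂) * F`. -/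
def actOn (g : PowerSeries ℂ) (p q : ℤ) : nilAt (W := W) p q →ₗ[ℂ] W where
  toFun F := ∑ᶠ s : ℕ, PowerSeries.coeff s g • (diffEnd ^ s) F.1 p q
  map_add' F G := by
    obtain ⟨N, hN⟩ := F.2
    obtain ⟨M, hM⟩ := G.2
    rw [← finsum_add_distrib ((Finset.finite_toSet _).subset (nilAt_finite g hN))
      ((Finset.finite_toSet _).subset (nilAt_finite g hM))]
    simp only [Submodule.coe_add, map_add, Pi.add_apply, smul_add]
  map_smul' c F := by
    obtain ⟨N, hN⟩ := F.2
    rw [RingHom.id_apply, smul_finsum' c ((Finset.finite_toSet _).subset (nilAt_finite g hN))]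
    simp only [Submodule.coe_smul, map_smul, Pi.smul_apply, smul_comm c]

/-- Multiplication of two-variable series by `g(x₁ - x₂)` for a power series `g`.  It is given by
the obvious sum whenever this sum is finite, and is extended linearly to all series. -/
def act (g : PowerSeries ℂ) : Module.End ℂ (ℤ → ℤ → W) :=
  LinearMap.pi fun p => LinearMap.pi fun q =>
    (LinearMap.exists_extend (actOn (W := W) g p q)).choose

theorem act_apply (g : PowerSeries ℂ) {F : ℤ → ℤ → W} {p q : ℤ} {N : ℕ}
    (hN : ∀ s ≥ N, (diffEnd ^ s) F p q = 0) :
    act g F p q = ∑ s ∈ Finset.range N, PowerSeries.coeff s g • (diffEnd ^ s) F p q := by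
  have e := LinearMap.congr_fun (LinearMap.exists_extend (actOn (W := W) g p q)).choose_spec
    ⟨F, N, hN⟩
  have e' : act g F p q = actOn g p q ⟨F, N, hN⟩ := e
  rw [e']
  exact finsum_eq_sum_of_support_subset _ (nilAt_finite g hN)

theorem act_apply_eq_zero (g : PowerSeries ℂ) {F : ℤ → ℤ → W} {p q : ℤ}
    (h : ∀ p' ≤ p, ∀ q' ≤ q, F p' q' = 0) : act g F p q = 0 := by
  rw [act_apply (N := 0) g fun s _ => diffEnd_pow_apply_eq_zero s fun p' hp q' hq _ =>
    h p' hp q' hq]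
  rfl

theorem act_map {W' : Type*} [AddCommGroup W'] [Module ℂ W'] (L : W →ₗ[ℂ] W')
    (g : PowerSeries ℂ) {F : ℤ → ℤ → W} (h : IsNil F) :
    act g (fun p q => L (F p q)) = fun p q => L (act g F p q) := by
  funext p q
  obtain ⟨N, hN⟩ := h p q
  rw [act_apply (N := N) g (fun s hs => by
      rw [diffEnd_pow_map]
      simp only [hN s hs, map_zero]),
    act_apply g hN, map_sum]
  simp only [diffEnd_pow_map, map_smul]

theorem act_shift (g : PowerSeries ℂ) {F : ℤ → ℤ → W} (h : IsNil F) (c d : ℤ) :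
    act g (fun p q => F (p - c) (q - d)) = fun p q => act g F (p - c) (q - d) := by
  funext p q
  obtain ⟨N, hN⟩ := h (p - c) (q - d)
  rw [act_apply (N := N) g (fun s hs => by rw [diffEnd_pow_shift]; exact hN s hs),
    act_apply g hN]
  simp only [diffEnd_pow_shift]

theorem act_diffEnd (g : PowerSeries ℂ) {F : ℤ → ℤ → W} (h : IsNil F) :
    act g (diffEnd F) = diffEnd (act g F) := by
  have h1 := act_shift g h 1 0
  have h2 := act_shift g h 0 1
  simp only [sub_zero] at h1 h2
  have e : diffEnd F = (fun p q => F (p - 1) q) - fun p q => F p (q - 1) := rfl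
  rw [e, map_sub, h1, h2]
  rfl

theorem act_diffEnd_pow (g : PowerSeries ℂ) {F : ℤ → ℤ → W} (h : IsNil F) (k : ℕ) :
    act g ((diffEnd ^ k) F) = (diffEnd ^ k) (act g F) := by
  induction k with
  | zero => rfl
  | succ k ih =>
    rw [pow_succ', Module.End.mul_apply, act_diffEnd g (h.pow k), ih, Module.End.mul_apply]

theorem diffEnd_pow_act_apply_eq_zero (g : PowerSeries ℂ) {F : ℤ → ℤ → W} (h : IsNil F)
    {p q : ℤ} {N : ℕ} (hN : ∀ s ≥ N, (diffEnd ^ s) F p q = 0) {s : ℕ} (hs : N ≤ s) :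
    (diffEnd ^ s) (act g F) p q = 0 := by
  rw [← act_diffEnd_pow g h, act_apply (N := 0) g]
  · rfl
  · intro i _
    rw [← Module.End.mul_apply, ← pow_add]
    exact hN _ (by omega)

theorem IsNil.act {F : ℤ → ℤ → W} (h : IsNil F) (g : PowerSeries ℂ) : IsNil (act g F) := by
  intro p q
  obtain ⟨N, hN⟩ := h p q
  exact ⟨N, fun s hs => diffEnd_pow_act_apply_eq_zero g h hN hs⟩

theorem act_act (g h : PowerSeries ℂ) {F : ℤ → ℤ → W} (hF : IsNil F) :
    act g (act h F) = act (g * h) F := by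
  funext p q
  obtain ⟨N, hN⟩ := hF p q
  rw [act_apply g (fun s hs => diffEnd_pow_act_apply_eq_zero h hF hN hs),
    act_apply (N := N + N) (g * h) (fun s hs => hN s (by omega))]
  have e1 : ∀ s, (diffEnd ^ s) (act h F) p q =
      ∑ t ∈ Finset.range N, PowerSeries.coeff t h • (diffEnd ^ (s + t)) F p q := by
    intro s
    rw [← act_diffEnd_pow h hF, act_apply (N := N) h]
    · simp only [← Module.End.mul_apply, ← pow_add, add_comm s]
    · intro i hi
      rw [← Module.End.mul_apply, ← pow_add]
      exact hN _ (by omega)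
  simp only [e1, PowerSeries.coeff_mul, Finset.smul_sum, smul_smul, Finset.sum_smul]
  rw [← Finset.sum_product', Finset.sum_sigma']
  refine Finset.sum_bij_ne_zero (fun x _ _ => ⟨x.1 + x.2, x⟩) ?_ ?_ ?_ ?_
  · rintro ⟨s, t⟩ h1 _
    simp only [Finset.mem_product, Finset.mem_range] at h1
    exact Finset.mem_sigma.mpr ⟨Finset.mem_range.mpr (by dsimp only; omega),
      Finset.HasAntidiagonal.mem_antidiagonal.mpr rfl⟩
  · rintro ⟨s, t⟩ _ _ ⟨s', t'⟩ _ _ e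
    simp only [Sigma.mk.injEq] at e
    exact eq_of_heq e.2
  · rintro ⟨n, s, t⟩ h1 h2
    obtain rfl : s + t = n := Finset.HasAntidiagonal.mem_antidiagonal.mp (Finset.mem_sigma.mp h1).2
    have hlt : s + t < N := by
      by_contra hcon
      exact h2 (by simp only [hN (s + t) (by omega), smul_zero])
    refine ⟨(s, t), ?_, h2, rfl⟩
    simp only [Finset.mem_product, Finset.mem_range]
    omega
  · rintro ⟨s, t⟩ _ _
    rfl

theorem diffEnd_eq_act (F : ℤ → ℤ → W) (hF : IsNil F) : diffEnd F = act PowerSeries.X F := by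
  funext p q
  obtain ⟨N, hN⟩ := hF p q
  rw [act_apply (N := N + 2) _ (fun s hs => hN s (by omega))]
  rw [Finset.sum_eq_single 1]
  · simp
  · intro b _ hb
    rw [PowerSeries.coeff_X, if_neg hb, zero_smul]
  · intro h
    exact absurd (Finset.mem_range.mpr (by omega)) h

theorem act_one {F : ℤ → ℤ → W} (hF : IsNil F) : act 1 F = F := by
  funext p q
  obtain ⟨N, hN⟩ := hF p q
  rw [act_apply (N := N + 1) _ (fun s hs => hN s (by omega)), Finset.sum_eq_single 0]
  · simp
  · intro b _ hb
    rw [PowerSeries.coeff_one, if_neg hb, zero_smul]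
  · intro h
    exact absurd (Finset.mem_range.mpr (by omega)) h

theorem smul_act (c : ℂ) (g : PowerSeries ℂ) {F : ℤ → ℤ → W} (hF : IsNil F) :
    c • act g F = act (c • g) F := by
  funext p q
  obtain ⟨N, hN⟩ := hF p q
  rw [Pi.smul_apply, Pi.smul_apply, act_apply g hN, act_apply _ hN, Finset.smul_sum]
  simp only [PowerSeries.coeff_smul, smul_smul, smul_eq_mul]

/-! ### Formal series in three variables -/

/-- An operation on two-variable series, applied to the variables `x₁, x₂` of a series in
`x₁, x₂, x₃`. -/
def lift12 (L : Module.End ℂ (ℤ → ℤ → W)) : Module.End ℂ (ℤ → ℤ → ℤ → W) where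
  toFun F := fun p q r => L (fun p' q' => F p' q' r) p q
  map_add' F G := by
    funext p q r
    exact congrFun (congrFun (L.map_add (fun p q => F p q r) (fun p q => G p q r)) p) q
  map_smul' c F := by
    funext p q r
    exact congrFun (congrFun (L.map_smul c (fun p q => F p q r)) p) q

/-- An operation on two-variable series, applied to the variables `x₁, x₃` of a series in
`x₁, x₂, x₃`. -/
def lift13 (L : Module.End ℂ (ℤ → ℤ → W)) : Module.End ℂ (ℤ → ℤ → ℤ → W) where
  toFun F := fun p q r => L (fun p' r' => F p' q r') p r
  map_add' F G := by
    funext p q r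
    exact congrFun (congrFun (L.map_add (fun p r => F p q r) (fun p r => G p q r)) p) r
  map_smul' c F := by
    funext p q r
    exact congrFun (congrFun (L.map_smul c (fun p r => F p q r)) p) r

/-- An operation on two-variable series, applied to the variables `x₂, x₃` of a series in
`x₁, x₂, x₃`. -/
def lift23 (L : Module.End ℂ (ℤ → ℤ → W)) : Module.End ℂ (ℤ → ℤ → ℤ → W) where
  toFun F := fun p => L (F p)
  map_add' F G := by
    funext p
    exact L.map_add (F p) (G p)
  map_smul' c F := by
    funext p
    exact L.map_smul c (F p)

theorem lift12_apply (L : Module.End ℂ (ℤ → ℤ → W)) (F : ℤ → ℤ → ℤ → W) (p q r : ℤ) :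
    lift12 L F p q r = L (fun p' q' => F p' q' r) p q := rfl

theorem lift13_apply (L : Module.End ℂ (ℤ → ℤ → W)) (F : ℤ → ℤ → ℤ → W) (p q r : ℤ) :
    lift13 L F p q r = L (fun p' r' => F p' q r') p r := rfl

theorem lift23_apply (L : Module.End ℂ (ℤ → ℤ → W)) (F : ℤ → ℤ → ℤ → W) (p : ℤ) :
    lift23 L F p = L (F p) := rfl

theorem lift12_pow (L : Module.End ℂ (ℤ → ℤ → W)) (k : ℕ) : lift12 L ^ k = lift12 (L ^ k) := by
  induction k with
  | zero => rfl
  | succ k ih => rw [pow_succ, ih, pow_succ]; rfl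

theorem lift13_pow (L : Module.End ℂ (ℤ → ℤ → W)) (k : ℕ) : lift13 L ^ k = lift13 (L ^ k) := by
  induction k with
  | zero => rfl
  | succ k ih => rw [pow_succ, ih, pow_succ]; rfl

theorem lift23_pow (L : Module.End ℂ (ℤ → ℤ → W)) (k : ℕ) : lift23 L ^ k = lift23 (L ^ k) := by
  induction k with
  | zero => rfl
  | succ k ih => rw [pow_succ, ih, pow_succ]; rfl

/-- Multiplication by `x₁ - x₂`. -/
def diff12 : Module.End ℂ (ℤ → ℤ → ℤ → W) := lift12 diffEnd

/-- Multiplication by `x₁ - x₃`. -/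
def diff13 : Module.End ℂ (ℤ → ℤ → ℤ → W) := lift13 diffEnd

/-- Multiplication by `x₂ - x₃`. -/
def diff23 : Module.End ℂ (ℤ → ℤ → ℤ → W) := lift23 diffEnd

theorem diff12_apply (F : ℤ → ℤ → ℤ → W) (p q r : ℤ) :
    diff12 F p q r = F (p - 1) q r - F p (q - 1) r := rfl

theorem diff13_apply (F : ℤ → ℤ → ℤ → W) (p q r : ℤ) :
    diff13 F p q r = F (p - 1) q r - F p q (r - 1) := rfl

theorem diff23_apply (F : ℤ → ℤ → ℤ → W) (p q r : ℤ) :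
    diff23 F p q r = F p (q - 1) r - F p q (r - 1) := rfl

theorem diff12_pow_apply (k : ℕ) (F : ℤ → ℤ → ℤ → W) (p q r : ℤ) :
    (diff12 ^ k) F p q r = (diffEnd ^ k) (fun p' q' => F p' q' r) p q := by
  rw [diff12, lift12_pow]; rfl

theorem diff13_pow_apply (k : ℕ) (F : ℤ → ℤ → ℤ → W) (p q r : ℤ) :
    (diff13 ^ k) F p q r = (diffEnd ^ k) (fun p' r' => F p' q r') p r := by
  rw [diff13, lift13_pow]; rfl

theorem diff23_pow_apply (k : ℕ) (F : ℤ → ℤ → ℤ → W) (p : ℤ) :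
    (diff23 ^ k) F p = (diffEnd ^ k) (F p) := by
  rw [diff23, lift23_pow]; rfl

theorem commute_diff12_diff13 : Commute (diff12 (W := W)) diff13 := by
  refine LinearMap.ext fun F => ?_
  funext p q r
  simp only [Module.End.mul_apply, diff12_apply, diff13_apply]
  abel

theorem commute_diff12_diff23 : Commute (diff12 (W := W)) diff23 := by
  refine LinearMap.ext fun F => ?_
  funext p q r
  simp only [Module.End.mul_apply, diff12_apply, diff23_apply]
  abel

theorem commute_diff13_diff23 : Commute (diff13 (W := W)) diff23 := by
  refine LinearMap.ext fun F => ?_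
  funext p q r
  simp only [Module.End.mul_apply, diff13_apply, diff23_apply]
  abel

/-- Setting `x₁ = x₂ + x₀` and taking the coefficient of `x₀ ^ (-n-1)`; the result is a series in
`x₂, x₃`. -/
def diag12 (n : ℤ) : (ℤ → ℤ → ℤ → W) →ₗ[ℂ] (ℤ → ℤ → W) where
  toFun F := fun t r => diag n (fun p q => F p q r) t
  map_add' F G := by
    funext t r
    exact congrFun ((diag n).map_add (fun p q => F p q r) (fun p q => G p q r)) t
  map_smul' c F := by
    funext t r
    exact congrFun ((diag n).map_smul c (fun p q => F p q r)) t

/-- Setting `x₂ = x₃ + x₀` and taking the coefficient of `x₀ ^ (-n-1)`; the result is a series in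
`x₁, x₃`. -/
def diag23 (n : ℤ) : (ℤ → ℤ → ℤ → W) →ₗ[ℂ] (ℤ → ℤ → W) where
  toFun F := fun p => diag n (F p)
  map_add' F G := by
    funext p
    exact (diag n).map_add (F p) (G p)
  map_smul' c F := by
    funext p
    exact (diag n).map_smul c (F p)

theorem diag12_apply (n : ℤ) (F : ℤ → ℤ → ℤ → W) (t r : ℤ) :
    diag12 n F t r = diag n (fun p q => F p q r) t := rfl

theorem diag23_apply (n : ℤ) (F : ℤ → ℤ → ℤ → W) (p : ℤ) :
    diag23 n F p = diag n (F p) := rfl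

variable (W) in
/-- The series in `x₁, x₂, x₃` all of whose coefficients with respect to `x₃` have a finite pole
along `x₁ = x₂`. -/
def finitePole12 : Submodule ℂ (ℤ → ℤ → ℤ → W) where
  carrier := {F | ∀ r, (fun p q => F p q r) ∈ finitePole W}
  zero_mem' _ := zero_mem (finitePole W)
  add_mem' hF hG r := add_mem (hF r) (hG r)
  smul_mem' c _ hF r := Submodule.smul_mem _ c (hF r)

variable (W) in
/-- The series in `x₁, x₂, x₃` all of whose coefficients with respect to `x₁` have a finite pole
along `x₂ = x₃`. -/
def finitePole23 : Submodule ℂ (ℤ → ℤ → ℤ → W) where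
  carrier := {F | ∀ p, F p ∈ finitePole W}
  zero_mem' _ := zero_mem (finitePole W)
  add_mem' hF hG r := add_mem (hF r) (hG r)
  smul_mem' c _ hF r := Submodule.smul_mem _ c (hF r)

theorem diff12_mem_finitePole23 {F : ℤ → ℤ → ℤ → W} (h : F ∈ finitePole23 W) :
    diff12 F ∈ finitePole23 W := by
  intro p
  have h2 := shift_mem_finitePole (h p) 1 0
  simp only [sub_zero] at h2
  exact sub_mem (h (p - 1)) h2

theorem diff13_mem_finitePole23 {F : ℤ → ℤ → ℤ → W} (h : F ∈ finitePole23 W) :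
    diff13 F ∈ finitePole23 W := by
  intro p
  have h2 := shift_mem_finitePole (h p) 0 1
  simp only [sub_zero] at h2
  exact sub_mem (h (p - 1)) h2

theorem diff13_mem_finitePole12 {F : ℤ → ℤ → ℤ → W} (h : F ∈ finitePole12 W) :
    diff13 F ∈ finitePole12 W := by
  intro r
  have h2 := shift_mem_finitePole (h r) 1 0
  simp only [sub_zero] at h2
  exact sub_mem h2 (h (r - 1))

theorem diff23_mem_finitePole12 {F : ℤ → ℤ → ℤ → W} (h : F ∈ finitePole12 W) :
    diff23 F ∈ finitePole12 W := by
  intro r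
  have h2 := shift_mem_finitePole (h r) 0 1
  simp only [sub_zero] at h2
  exact sub_mem h2 (h (r - 1))

theorem pow_mem_of_mem {X : Type*} [AddCommGroup X] [Module ℂ X] {E : Module.End ℂ X}
    {S : Submodule ℂ X} (hE : ∀ x ∈ S, E x ∈ S) (k : ℕ) {x : X} (hx : x ∈ S) : (E ^ k) x ∈ S := by
  induction k with
  | zero => exact hx
  | succ k ih => rw [pow_succ', Module.End.mul_apply]; exact hE _ ih

theorem diag12_diff12 {F : ℤ → ℤ → ℤ → W} (h : F ∈ finitePole12 W) (n : ℤ) :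
    diag12 n (diff12 F) = diag12 (n + 1) F := by
  funext t r
  exact congrFun (diag_diffEnd (h r) n) t

theorem diag23_diff23 {F : ℤ → ℤ → ℤ → W} (h : F ∈ finitePole23 W) (n : ℤ) :
    diag23 n (diff23 F) = diag23 (n + 1) F := by
  funext p
  exact diag_diffEnd (h p) n

theorem diag23_diff13 {F : ℤ → ℤ → ℤ → W} (h : F ∈ finitePole23 W) (n : ℤ) :
    diag23 n (diff13 F) = diffEnd (diag23 n F) := by
  funext p t
  have e : diff13 F p = F (p - 1) - fun q r => F p q (r - 1) := rfl
  rw [diag23_apply, e, map_sub, Pi.sub_apply, diag_shift_right (h p)]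
  rfl

/-- This is `x₁ - x₂ = (x₁ - x₃) - (x₂ - x₃)`. -/
theorem diag23_diff12 {F : ℤ → ℤ → ℤ → W} (h : F ∈ finitePole23 W) (n : ℤ) :
    diag23 n (diff12 F) = diffEnd (diag23 n F) - diag23 (n + 1) F := by
  funext p t
  have e : diff12 F p = F (p - 1) - fun q r => F p (q - 1) r := rfl
  rw [diag23_apply, e, map_sub, Pi.sub_apply, diag_shift_left (h p), Pi.sub_apply, Pi.sub_apply,
    diffEnd_apply]
  simp only [diag23_apply]
  abel

theorem diag12_diff23 {F : ℤ → ℤ → ℤ → W} (h : F ∈ finitePole12 W) (n : ℤ) :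
    diag12 n (diff23 F) = diffEnd (diag12 n F) := by
  funext t r
  have e : (fun p q => diff23 F p q r) =
      (fun p q => F p (q - 1) r) - fun p q => F p q (r - 1) := rfl
  rw [diag12_apply, e, map_sub, Pi.sub_apply, diag_shift_right (h r)]
  rfl

/-- This is `x₁ - x₃ = (x₂ - x₃) + (x₁ - x₂)`. -/
theorem diag12_diff13 {F : ℤ → ℤ → ℤ → W} (h : F ∈ finitePole12 W) (n : ℤ) :
    diag12 n (diff13 F) = diffEnd (diag12 n F) + diag12 (n + 1) F := by
  funext t r
  have e : (fun p q => diff13 F p q r) =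
      (fun p q => F (p - 1) q r) - fun p q => F p q (r - 1) := rfl
  rw [diag12_apply, e, map_sub, Pi.sub_apply, diag_shift_left (h r), Pi.add_apply, Pi.add_apply,
    diffEnd_apply]
  simp only [diag12_apply]
  abel

/-! ### Collapsing two variables in a power series multiple -/

/-- The divided derivative `g⁽ⁱ⁾ / i!` of a power series. -/
def divDeriv (i : ℕ) (g : PowerSeries ℂ) : PowerSeries ℂ :=
  PowerSeries.mk fun s => ((s + i).choose i : ℂ) * PowerSeries.coeff (s + i) g

theorem divDeriv_zero (g : PowerSeries ℂ) : divDeriv 0 g = g := by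
  ext s
  simp [divDeriv]

section Taylor

variable {X : Type*} [AddCommGroup X] [Module ℂ X] (E : Module.End ℂ X)
  (c : ℤ → X →ₗ[ℂ] (ℤ → ℤ → W)) (ε : ℂ) (H : X)

theorem collapse_pow
    (h1 : ∀ n s, c n ((E ^ (s + 1)) H) = diffEnd (c n ((E ^ s) H)) + ε • c (n + 1) ((E ^ s) H))
    (s : ℕ) (n : ℤ) : c n ((E ^ s) H) = ∑ ij ∈ Finset.HasAntidiagonal.antidiagonal s,
      s.choose ij.1 • (ε ^ ij.1 • (diffEnd ^ ij.2) (c (n + ij.1) H)) := by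
  induction s generalizing n with
  | zero => simp
  | succ s ih =>
    rw [Finset.sum_antidiagonal_choose_succ_nsmul
      (fun i j => ε ^ i • (diffEnd ^ j) (c (n + i) H)), h1, ih, ih, map_sum, Finset.smul_sum]
    congr 1
    · refine Finset.sum_congr rfl fun ij _ => ?_
      rw [map_nsmul, map_smul, pow_succ', Module.End.mul_apply]
    · refine Finset.sum_congr rfl fun ij hij => ?_
      have hij := Finset.HasAntidiagonal.mem_antidiagonal.mp hij
      rw [smul_comm, smul_smul, ← pow_succ', Nat.cast_add, Nat.cast_one, add_assoc,
        add_comm 1 (ij.1 : ℤ), Nat.choose_symm_of_eq_add hij.symm]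

/-- Taylor's formula.  Let `E` be multiplication by a difference of variables which a family `c` of
collapsing operations turns into `y + ε x₀`, where `y` is the difference of the remaining variables
and multiplication by `x₀` raises the index of `c`.  Then `c` turns `g(E) H` into
`g(y + ε x₀) = ∑ᵢ ε ^ i x₀ ^ i (g⁽ⁱ⁾ / i!)(y)` applied to the collapse of `H`. -/
theorem collapse_act (g : PowerSeries ℂ) (Y : X) (n : ℤ) (I : ℕ)
    (h1 : ∀ n s, c n ((E ^ (s + 1)) H) = diffEnd (c n ((E ^ s) H)) + ε • c (n + 1) ((E ^ s) H))
    (h2 : ∀ i : ℕ, I ≤ i → c (n + i) H = 0)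
    (h3 : ∀ u v, ∃ S₀ : ℕ, ∀ S ≥ S₀, c n Y u v =
      ∑ s ∈ Finset.range S, PowerSeries.coeff s g • c n ((E ^ s) H) u v)
    (h4 : ∀ n, IsNil (c n H)) :
    c n Y = ∑ i ∈ Finset.range I, ε ^ i • act (divDeriv i g) (c (n + i) H) := by
  funext u v
  choose N hN using fun i : ℕ => h4 (n + i) u v
  obtain ⟨S₀, hS⟩ := h3 u v
  set J := (Finset.range I).sup N
  have hJ : ∀ i < I, ∀ j ≥ J, (diffEnd ^ j) (c (n + i) H) u v = 0 := fun i hi j hj =>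
    hN i j ((Finset.le_sup (Finset.mem_range.mpr hi)).trans hj)
  rw [hS (max S₀ (I + J)) (le_max_left _ _)]
  simp only [collapse_pow E c ε H h1, Finset.sum_apply, Pi.smul_apply]
  have e : ∀ i ∈ Finset.range I, ε ^ i • act (divDeriv i g) (c (n + i) H) u v =
      ∑ j ∈ Finset.range J, ε ^ i • (PowerSeries.coeff j (divDeriv i g) •
        (diffEnd ^ j) (c (n + i) H) u v) := by
    intro i hi
    rw [act_apply _ (hJ i (Finset.mem_range.mp hi)), Finset.smul_sum]
  rw [Finset.sum_congr rfl e, ← Finset.sum_product']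
  simp only [Finset.smul_sum]
  rw [Finset.sum_sigma']
  have hval : ∀ i j : ℕ, PowerSeries.coeff (i + j) g •
      (i + j).choose i • (ε ^ i • (diffEnd ^ j) (c (n + i) H) u v) =
      ε ^ i • (PowerSeries.coeff j (divDeriv i g) • (diffEnd ^ j) (c (n + i) H) u v) := by
    intro i j
    rw [← Nat.cast_smul_eq_nsmul ℂ, smul_smul, smul_smul, smul_smul, divDeriv,
      PowerSeries.coeff_mk, add_comm j i]
    congr 1
    ring
  refine Finset.sum_bij_ne_zero (fun x _ _ => x.2) ?_ ?_ ?_ ?_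
  · rintro ⟨s, i, j⟩ _ h0
    dsimp only at h0 ⊢
    have hi : i < I := by
      by_contra hcon
      exact h0 (by rw [h2 i (not_lt.mp hcon), map_zero]; simp)
    refine Finset.mem_product.mpr ⟨Finset.mem_range.mpr hi, Finset.mem_range.mpr ?_⟩
    by_contra hcon
    exact h0 (by rw [hJ i hi j (not_lt.mp hcon)]; simp)
  · rintro ⟨s, i, j⟩ h1 _ ⟨s', i', j'⟩ h1' _ e
    obtain rfl : i + j = s := Finset.HasAntidiagonal.mem_antidiagonal.mp (Finset.mem_sigma.mp h1).2
    obtain rfl : i' + j' = s' :=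
      Finset.HasAntidiagonal.mem_antidiagonal.mp (Finset.mem_sigma.mp h1').2
    cases e
    rfl
  · rintro ⟨i, j⟩ hij h0
    have hij := Finset.mem_product.mp hij
    simp only [Finset.mem_range] at hij
    refine ⟨⟨i + j, (i, j)⟩, Finset.mem_sigma.mpr ⟨Finset.mem_range.mpr ?_,
      Finset.HasAntidiagonal.mem_antidiagonal.mpr rfl⟩, ?_, rfl⟩
    · dsimp only
      omega
    · rw [← hval] at h0
      exact h0
  · rintro ⟨s, i, j⟩ h1 _
    obtain rfl : i + j = s := Finset.HasAntidiagonal.mem_antidiagonal.mp (Finset.mem_sigma.mp h1).2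
    exact hval i j

end Taylor

/-- `diag` commutes with a locally finite sum if the terms have a common bound for the order of
the pole. -/
theorem exists_diag_eq_sum {Y : ℤ → ℤ → W} {H : ℕ → ℤ → ℤ → W} {k : ℕ} (g : PowerSeries ℂ)
    (hY : (diffEnd ^ k) Y ∈ laurentTwo W) (hH : ∀ s, (diffEnd ^ k) (H s) ∈ laurentTwo W)
    (h : ∀ t, ∃ S₀ : ℕ, ∀ S ≥ S₀, ∀ p q, p + q = t → (diffEnd ^ k) Y p q =
      ∑ s ∈ Finset.range S, PowerSeries.coeff s g • (diffEnd ^ k) (H s) p q) (n t : ℤ) :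
    ∃ S₀ : ℕ, ∀ S ≥ S₀, diag n Y t =
      ∑ s ∈ Finset.range S, PowerSeries.coeff s g • diag n (H s) t := by
  obtain ⟨S₀, hS⟩ := h (t + (k - n - 1))
  refine ⟨S₀, fun S hSS => ?_⟩
  have e : ∀ s, (diffEnd ^ k) (∑ s ∈ Finset.range s, PowerSeries.coeff s g • H s) =
      ∑ s ∈ Finset.range s, PowerSeries.coeff s g • (diffEnd ^ k) (H s) := by
    intro s
    rw [map_sum]
    simp only [map_smul]
  rw [diag_congr (k := k) (G := ∑ s ∈ Finset.range S, PowerSeries.coeff s g • H s) hY]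
  · rw [map_sum, Finset.sum_apply]
    simp only [map_smul, Pi.smul_apply]
  · rw [e]
    exact sum_mem fun s _ => Submodule.smul_mem _ _ (hH s)
  · intro p q hpq
    rw [hS S hSS p q hpq, e]
    simp only [Finset.sum_apply, Pi.smul_apply]

/-- `A g` is multiplication by `g(E)`, where `E` is multiplication by a homogeneous polynomial of
degree one in `x₁, x₂, x₃`. -/
structure IsDiffAction (E : Module.End ℂ (ℤ → ℤ → ℤ → W))
    (A : PowerSeries ℂ → Module.End ℂ (ℤ → ℤ → ℤ → W)) : Prop where
  pow_eq_zero : ∀ (F : ℤ → ℤ → ℤ → W) (s : ℕ) (p q r : ℤ),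
    (∀ p' ≤ p, ∀ q' ≤ q, ∀ r' ≤ r, p' + q' + r' = p + q + r - s → F p' q' r' = 0) →
      (E ^ s) F p q r = 0
  act_eq : ∀ (g : PowerSeries ℂ) (F : ℤ → ℤ → ℤ → W) (p q r : ℤ) (S : ℕ),
    (∀ s ≥ S, (E ^ s) F p q r = 0) →
      A g F p q r = ∑ s ∈ Finset.range S, PowerSeries.coeff s g • (E ^ s) F p q r

theorem isDiffAction12 : IsDiffAction (W := W) diff12 fun g => lift12 (act g) where
  pow_eq_zero F s p q r h := by
    rw [diff12_pow_apply]
    exact diffEnd_pow_apply_eq_zero s fun p' hp q' hq e => h p' hp q' hq r le_rfl (by omega)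
  act_eq g F p q r S h := by
    simp only [diff12_pow_apply] at h ⊢
    exact act_apply g h

theorem isDiffAction13 : IsDiffAction (W := W) diff13 fun g => lift13 (act g) where
  pow_eq_zero F s p q r h := by
    rw [diff13_pow_apply]
    exact diffEnd_pow_apply_eq_zero s fun p' hp r' hr e => h p' hp q le_rfl r' hr (by omega)
  act_eq g F p q r S h := by
    simp only [diff13_pow_apply] at h ⊢
    exact act_apply g h

theorem isDiffAction23 : IsDiffAction (W := W) diff23 fun g => lift23 (act g) where
  pow_eq_zero F s p q r h := by
    rw [diff23_pow_apply]
    exact diffEnd_pow_apply_eq_zero s fun q' hq r' hr e => h p le_rfl q' hq r' hr (by omega)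
  act_eq g F p q r S h := by
    simp only [diff23_pow_apply] at h ⊢
    exact act_apply g h

section IsDiffAction

variable {E : Module.End ℂ (ℤ → ℤ → ℤ → W)} {A : PowerSeries ℂ → Module.End ℂ (ℤ → ℤ → ℤ → W)}

theorem IsDiffAction.act_eq_zero (hA : IsDiffAction E A) (g : PowerSeries ℂ)
    {F : ℤ → ℤ → ℤ → W} {p q r : ℤ}
    (h : ∀ p' ≤ p, ∀ q' ≤ q, ∀ r' ≤ r, F p' q' r' = 0) : A g F p q r = 0 := by
  rw [hA.act_eq g F p q r 0 fun s _ => hA.pow_eq_zero F s p q r fun p' hp q' hq r' hr _ =>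
    h p' hp q' hq r' hr]
  rfl

/-- The truncation properties of a series such as `b(x₂) c(x₃) a(x₁) w` under which power series in
`x₁ - x₂` and `x₁ - x₃` act and `x₂` may be set to `x₃ + x₀`, the pole along `x₂ = x₃` having order
at most `k`. -/
structure RightRegular (k : ℕ) (H : ℤ → ℤ → ℤ → W) : Prop where
  first : ∃ N : ℤ, ∀ p < N, ∀ q r, H p q r = 0
  third : ∀ p, ∃ M : ℤ, ∀ r < M, ∀ q, H p q r = 0
  second : ∀ p r, ∃ M : ℤ, ∀ q < M, H p q r = 0
  pole : ∀ p, (diffEnd ^ k) (H p) ∈ laurentTwo W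

/-- The truncation properties of a series such as `c(x₃) a(x₁) b(x₂) w` under which power series in
`x₁ - x₃` and `x₂ - x₃` act and `x₁` may be set to `x₂ + x₀`, the pole along `x₁ = x₂` having order
at most `k`. -/
structure LeftRegular (k : ℕ) (H : ℤ → ℤ → ℤ → W) : Prop where
  second : ∃ N : ℤ, ∀ q < N, ∀ p r, H p q r = 0
  first : ∀ q, ∃ M : ℤ, ∀ p < M, ∀ r, H p q r = 0
  third : ∀ p q, ∃ M : ℤ, ∀ r < M, H p q r = 0
  pole : ∃ N : ℤ, ∀ p q r, p < N ∨ q < N → (diff12 ^ k) H p q r = 0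

/-! #### Setting `x₂ = x₃ + x₀` -/

theorem RightRegular.exists_bound {k : ℕ} {H : ℤ → ℤ → ℤ → W} (h : RightRegular k H) (p : ℤ) :
    ∃ M : ℤ, ∀ p' ≤ p, ∀ q r, q < M ∨ r < M → (diff23 ^ k) H p' q r = 0 := by
  obtain ⟨N, hN⟩ := h.first
  have hP : ∀ i, ∃ M : ℤ, ∀ x < M, ∀ y, (diff23 ^ k) H i x y = 0 ∧ (diff23 ^ k) H i y x = 0 := by
    intro i
    obtain ⟨M, hM⟩ := h.pole i
    refine ⟨M, fun x hx y => ?_⟩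
    rw [diff23_pow_apply]
    exact ⟨hM x y (Or.inl hx), hM y x (Or.inr hx)⟩
  obtain ⟨M, hM⟩ := exists_forall_le_of_bound hP N p
  refine ⟨M, fun p' hp q r hqr => ?_⟩
  rcases lt_or_ge p' N with h1 | h1
  · have e : H p' = 0 := by funext q r; exact hN p' h1 q r
    rw [diff23_pow_apply, e, map_zero]
    rfl
  · rcases hqr with h2 | h2
    · exact (hM p' h1 hp q h2 r).1
    · exact (hM p' h1 hp r h2 q).2

theorem RightRegular.pole_act {k : ℕ} {H : ℤ → ℤ → ℤ → W} (h : RightRegular k H)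
    (hA : IsDiffAction E A) (g : PowerSeries ℂ)
    (hc : A g ((diff23 ^ k) H) = (diff23 ^ k) (A g H)) (p : ℤ) :
    (diffEnd ^ k) (A g H p) ∈ laurentTwo W := by
  obtain ⟨M, hM⟩ := h.exists_bound p
  refine ⟨M, fun q r hqr => ?_⟩
  rw [← diff23_pow_apply, ← hc]
  exact hA.act_eq_zero g fun p' hp q' hq r' hr => hM p' hp q' r' (by omega)

theorem RightRegular.regular_act {k : ℕ} {H : ℤ → ℤ → ℤ → W} (h : RightRegular k H)
    (hA : IsDiffAction E A) (g : PowerSeries ℂ)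
    (hc : A g ((diff23 ^ k) H) = (diff23 ^ k) (A g H)) : RightRegular k (A g H) := by
  obtain ⟨N, hN⟩ := h.first
  have third : ∀ p, ∃ M : ℤ, ∀ p' ≤ p, ∀ r < M, ∀ q, H p' q r = 0 := by
    intro p
    obtain ⟨M, hM⟩ := exists_forall_le_of_bound h.third N p
    refine ⟨M, fun p' hp r hr q => ?_⟩
    rcases lt_or_ge p' N with h1 | h1
    · exact hN p' h1 q r
    · exact hM p' h1 hp r hr q
  refine ⟨⟨N, fun p hp q r => ?_⟩, fun p => ?_, fun p r => ?_, h.pole_act hA g hc⟩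
  · exact hA.act_eq_zero g fun p' hp' q' _ r' _ => hN p' (by omega) q' r'
  · obtain ⟨M, hM⟩ := third p
    exact ⟨M, fun r hr q => hA.act_eq_zero g fun p' hp' q' _ r' hr' => hM p' hp' r' (by omega) q'⟩
  · obtain ⟨M, hM⟩ := third p
    have h2 : ∀ p, ∃ L : ℤ, ∀ q < L, ∀ r', M ≤ r' → r' ≤ r → H p q r' = 0 := by
      intro p
      obtain ⟨L, hL⟩ := exists_forall_le_of_bound (h.second p) M r
      exact ⟨L, fun q hq r' h1 h2 => hL r' h1 h2 q hq⟩
    obtain ⟨L, hL⟩ := exists_forall_le_of_bound h2 N p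
    refine ⟨L, fun q hq => hA.act_eq_zero g fun p' hp' q' hq' r' hr' => ?_⟩
    rcases lt_or_ge p' N with h1 | h1
    · exact hN p' h1 q' r'
    rcases lt_or_ge r' M with h3 | h3
    · exact hM p' hp' r' h3 q'
    · exact hL p' h1 hp' q' (by omega) r' h3 hr'

theorem RightRegular.exists_diag_act_eq_sum {k : ℕ} {H : ℤ → ℤ → ℤ → W} (h : RightRegular k H)
    (hA : IsDiffAction E A) (hE : Commute E diff23) (g : PowerSeries ℂ)
    (hc : A g ((diff23 ^ k) H) = (diff23 ^ k) (A g H)) (n p t : ℤ) :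
    ∃ S₀ : ℕ, ∀ S ≥ S₀, diag23 n (A g H) p t =
      ∑ s ∈ Finset.range S, PowerSeries.coeff s g • diag23 n ((E ^ s) H) p t := by
  have hcomm : ∀ s, (diffEnd ^ k) ((E ^ s) H p) = (E ^ s) ((diff23 ^ k) H) p := by
    intro s
    rw [← diff23_pow_apply, ← Module.End.mul_apply, ← Module.End.mul_apply,
      (hE.pow_pow s k).eq]
  obtain ⟨N, hN⟩ := h.first
  obtain ⟨M, hM⟩ := h.exists_bound p
  have hN' : ∀ p' < N, ∀ q r, (diff23 ^ k) H p' q r = 0 := by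
    intro p' hp' q r
    have e : H p' = 0 := by funext q r; exact hN p' hp' q r
    rw [diff23_pow_apply, e, map_zero]
    rfl
  refine exists_diag_eq_sum (k := k) g (h.pole_act hA g hc p) (fun s => ⟨M, fun q r hqr => ?_⟩)
    (fun t => ⟨(p + t - N - 2 * M + 1).toNat, fun S hS q r hqr => ?_⟩) n t
  · rw [hcomm]
    exact hA.pow_eq_zero _ s p q r fun p' hp' q' hq' r' hr' _ => hM p' hp' q' r' (by omega)
  · simp only [hcomm]
    rw [← diff23_pow_apply, ← hc]
    refine hA.act_eq g _ p q r S fun s hs => hA.pow_eq_zero _ s p q r ?_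
    intro p' hp' q' hq' r' hr' e
    rcases lt_or_ge p' N with h1 | h1
    · exact hN' p' h1 q' r'
    · exact hM p' hp' q' r' (by omega)

theorem RightRegular.mem_finitePole23 {k : ℕ} {H : ℤ → ℤ → ℤ → W} (h : RightRegular k H) :
    H ∈ finitePole23 W := fun p => ⟨k, h.pole p⟩

theorem RightRegular.isIterated_diag23 {k : ℕ} {H : ℤ → ℤ → ℤ → W} (h : RightRegular k H)
    (n : ℤ) : IsIterated (diag23 n H) := by
  obtain ⟨N, hN⟩ := h.first
  refine ⟨⟨N, fun p hp => ?_⟩, fun p => exists_diag_eq_zero (h.mem_finitePole23 p) n⟩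
  have e : H p = 0 := by funext q r; exact hN p hp q r
  rw [diag23_apply, e, map_zero]

theorem RightRegular.diag23_eq_zero {k : ℕ} {H : ℤ → ℤ → ℤ → W} (h : RightRegular k H)
    {n : ℤ} (hn : k ≤ n) : diag23 n H = 0 := by
  funext p
  exact diag_eq_zero (h.pole p) hn

/-- Taylor's formula for setting `x₂ = x₃ + x₀` in `g(E) H`.  The sum over the powers of `x₀` is
finite because the pole of `H` along `x₂ = x₃` has bounded order. -/
theorem RightRegular.diag23_act {k : ℕ} {H : ℤ → ℤ → ℤ → W} (h : RightRegular k H)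
    (hA : IsDiffAction E A) (hE : Commute E diff23)
    (hE' : ∀ F ∈ finitePole23 W, E F ∈ finitePole23 W) (ε : ℂ)
    (hstep : ∀ F ∈ finitePole23 W, ∀ n,
      diag23 n (E F) = diffEnd (diag23 n F) + ε • diag23 (n + 1) F)
    (g : PowerSeries ℂ) (hc : A g ((diff23 ^ k) H) = (diff23 ^ k) (A g H))
    (n : ℤ) (I : ℕ) (hI : k ≤ n + I) : diag23 n (A g H) =
      ∑ i ∈ Finset.range I, ε ^ i • act (divDeriv i g) (diag23 (n + i) H) := by
  refine collapse_act E diag23 ε H g (A g H) n I (fun n s => ?_) (fun i hi => ?_)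
    (fun p t => h.exists_diag_act_eq_sum hA hE g hc n p t)
    (fun n => (h.isIterated_diag23 n).isNil)
  · rw [pow_succ', Module.End.mul_apply, hstep _ (pow_mem_of_mem hE' s h.mem_finitePole23)]
  · exact h.diag23_eq_zero (by omega)

/-! #### Setting `x₁ = x₂ + x₀` -/

theorem LeftRegular.pole_act {k : ℕ} {H : ℤ → ℤ → ℤ → W} (h : LeftRegular k H)
    (hA : IsDiffAction E A) (g : PowerSeries ℂ)
    (hc : A g ((diff12 ^ k) H) = (diff12 ^ k) (A g H)) :
    ∃ N : ℤ, ∀ p q r, p < N ∨ q < N → (diff12 ^ k) (A g H) p q r = 0 := by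
  obtain ⟨N, hN⟩ := h.pole
  refine ⟨N, fun p q r hpq => ?_⟩
  rw [← hc]
  exact hA.act_eq_zero g fun p' hp q' hq r' hr => hN p' q' r' (by omega)

theorem LeftRegular.exists_third_bound {k : ℕ} {H : ℤ → ℤ → ℤ → W} (h : LeftRegular k H)
    (p q : ℤ) : ∃ L : ℤ, ∀ p' ≤ p, ∀ q' ≤ q, ∀ r < L, H p' q' r = 0 := by
  obtain ⟨N, hN⟩ := h.second
  obtain ⟨M, hM⟩ := exists_forall_le_of_bound h.first N q
  have h2 : ∀ p, ∃ L : ℤ, ∀ r < L, ∀ q', N ≤ q' → q' ≤ q → H p q' r = 0 := by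
    intro p
    obtain ⟨L, hL⟩ := exists_forall_le_of_bound (h.third p) N q
    exact ⟨L, fun r hr q' h1 h2 => hL q' h1 h2 r hr⟩
  obtain ⟨L, hL⟩ := exists_forall_le_of_bound h2 M p
  refine ⟨L, fun p' hp' q' hq' r hr => ?_⟩
  rcases lt_or_ge q' N with h1 | h1
  · exact hN q' h1 p' r
  rcases lt_or_ge p' M with h3 | h3
  · exact hM q' h1 hq' p' h3 r
  · exact hL p' h3 hp' r hr q' h1 hq'

theorem LeftRegular.regular_act {k : ℕ} {H : ℤ → ℤ → ℤ → W} (h : LeftRegular k H)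
    (hA : IsDiffAction E A) (g : PowerSeries ℂ)
    (hc : A g ((diff12 ^ k) H) = (diff12 ^ k) (A g H)) : LeftRegular k (A g H) := by
  obtain ⟨N, hN⟩ := h.second
  refine ⟨⟨N, fun q hq p r => ?_⟩, fun q => ?_, fun p q => ?_, h.pole_act hA g hc⟩
  · exact hA.act_eq_zero g fun p' _ q' hq' r' _ => hN q' (by omega) p' r'
  · obtain ⟨M, hM⟩ := exists_forall_le_of_bound h.first N q
    refine ⟨M, fun p hp r => hA.act_eq_zero g fun p' hp' q' hq' r' _ => ?_⟩
    rcases lt_or_ge q' N with h1 | h1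
    · exact hN q' h1 p' r'
    · exact hM q' h1 hq' p' (by omega) r'
  · obtain ⟨L, hL⟩ := h.exists_third_bound p q
    exact ⟨L, fun r hr => hA.act_eq_zero g fun p' hp' q' hq' r' hr' =>
      hL p' hp' q' hq' r' (by omega)⟩

theorem LeftRegular.exists_pow_bound {k : ℕ} {H : ℤ → ℤ → ℤ → W} (h : LeftRegular k H)
    (p q : ℤ) : ∃ L : ℤ, ∀ p' ≤ p, ∀ q' ≤ q, ∀ r < L, (diff12 ^ k) H p' q' r = 0 := by
  obtain ⟨L, hL⟩ := h.exists_third_bound p q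
  refine ⟨L, fun p' hp' q' hq' r hr => ?_⟩
  rw [diff12_pow_apply]
  exact diffEnd_pow_apply_eq_zero k fun p₁ h1 q₁ h2 _ => hL p₁ (by omega) q₁ (by omega) r hr

theorem LeftRegular.exists_diag_act_eq_sum {k : ℕ} {H : ℤ → ℤ → ℤ → W} (h : LeftRegular k H)
    (hA : IsDiffAction E A) (hE : Commute E diff12) (g : PowerSeries ℂ)
    (hc : A g ((diff12 ^ k) H) = (diff12 ^ k) (A g H)) (n t r : ℤ) :
    ∃ S₀ : ℕ, ∀ S ≥ S₀, diag12 n (A g H) t r =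
      ∑ s ∈ Finset.range S, PowerSeries.coeff s g • diag12 n ((E ^ s) H) t r := by
  have hcomm : ∀ s p q, (diffEnd ^ k) (fun p q => (E ^ s) H p q r) p q =
      (E ^ s) ((diff12 ^ k) H) p q r := by
    intro s p q
    rw [← diff12_pow_apply, ← Module.End.mul_apply, ← Module.End.mul_apply,
      (hE.pow_pow s k).eq]
  obtain ⟨N, hN⟩ := h.pole
  obtain ⟨N', hN'⟩ := h.pole_act hA g hc
  refine exists_diag_eq_sum (k := k) (Y := fun p q => A g H p q r)
    (H := fun s p q => (E ^ s) H p q r) g ⟨N', fun p q hpq => ?_⟩ (fun s => ⟨N, fun p q hpq => ?_⟩)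
    (fun t => ?_) n t
  · rw [← diff12_pow_apply]
    exact hN' p q r hpq
  · rw [hcomm]
    exact hA.pow_eq_zero _ s p q r fun p' hp' q' hq' r' hr' _ => hN p' q' r' (by omega)
  · obtain ⟨L, hL⟩ := h.exists_pow_bound (t - N) (t - N)
    refine ⟨(t + r - 2 * N - L + 1).toNat, fun S hS p q hpq => ?_⟩
    simp only [hcomm]
    rw [← diff12_pow_apply, ← hc]
    refine hA.act_eq g _ p q r S fun s hs => hA.pow_eq_zero _ s p q r ?_
    intro p' hp' q' hq' r' hr' e
    by_cases h1 : p' < N ∨ q' < N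
    · exact hN p' q' r' h1
    · exact hL p' (by omega) q' (by omega) r' (by omega)

theorem LeftRegular.mem_finitePole12 {k : ℕ} {H : ℤ → ℤ → ℤ → W} (h : LeftRegular k H) :
    H ∈ finitePole12 W := by
  obtain ⟨N, hN⟩ := h.pole
  refine fun r => ⟨k, N, fun p q hpq => ?_⟩
  rw [← diff12_pow_apply]
  exact hN p q r hpq

theorem LeftRegular.diag12_eq_zero {k : ℕ} {H : ℤ → ℤ → ℤ → W} (h : LeftRegular k H)
    {n : ℤ} (hn : k ≤ n) : diag12 n H = 0 := by
  obtain ⟨N, hN⟩ := h.pole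
  funext t r
  have hr : (diffEnd ^ k) (fun p q => H p q r) ∈ laurentTwo W :=
    ⟨N, fun p q hpq => by rw [← diff12_pow_apply]; exact hN p q r hpq⟩
  rw [diag12_apply, diag_eq_zero hr hn]
  rfl

theorem LeftRegular.isIterated_diag12 {k : ℕ} {H : ℤ → ℤ → ℤ → W} (h : LeftRegular k H)
    (n : ℤ) : IsIterated (diag12 n H) := by
  obtain ⟨N, hN⟩ := h.pole
  have hr : ∀ r, (diffEnd ^ k) (fun p q => H p q r) ∈ laurentTwo W := fun r =>
    ⟨N, fun p q hpq => by rw [← diff12_pow_apply]; exact hN p q r hpq⟩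
  refine ⟨⟨2 * N - (k - n - 1), fun t ht => ?_⟩, fun t => ?_⟩
  · funext r
    rw [diag12_apply, diag_eq (hr r)]
    unfold diagRes
    split_ifs
    · refine finsum_eq_zero_of_forall_eq_zero fun p => ?_
      rw [← diff12_pow_apply, hN _ _ _ (by omega), smul_zero]
    · rfl
  · obtain ⟨L, hL⟩ := h.exists_pow_bound (t + (k - n - 1) - N) (t + (k - n - 1) - N)
    refine ⟨L, fun r hlt => ?_⟩
    rw [diag12_apply, diag_eq (hr r)]
    unfold diagRes
    split_ifs
    · refine finsum_eq_zero_of_forall_eq_zero fun p => ?_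
      rw [← diff12_pow_apply]
      by_cases h1 : p < N ∨ t + (k - n - 1) - p < N
      · rw [hN _ _ _ h1, smul_zero]
      · rw [hL _ (by omega) _ (by omega) r hlt, smul_zero]
    · rfl

/-- Taylor's formula for setting `x₁ = x₂ + x₀` in `g(E) H`.  The sum over the powers of `x₀` is
finite because the pole of `H` along `x₁ = x₂` has bounded order. -/
theorem LeftRegular.diag12_act {k : ℕ} {H : ℤ → ℤ → ℤ → W} (h : LeftRegular k H)
    (hA : IsDiffAction E A) (hE : Commute E diff12)
    (hE' : ∀ F ∈ finitePole12 W, E F ∈ finitePole12 W) (ε : ℂ)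
    (hstep : ∀ F ∈ finitePole12 W, ∀ n,
      diag12 n (E F) = diffEnd (diag12 n F) + ε • diag12 (n + 1) F)
    (g : PowerSeries ℂ) (hc : A g ((diff12 ^ k) H) = (diff12 ^ k) (A g H))
    (n : ℤ) (I : ℕ) (hI : k ≤ n + I) : diag12 n (A g H) =
      ∑ i ∈ Finset.range I, ε ^ i • act (divDeriv i g) (diag12 (n + i) H) := by
  refine collapse_act E diag12 ε H g (A g H) n I (fun n s => ?_) (fun i hi => ?_)
    (fun t r => h.exists_diag_act_eq_sum hA hE g hc n t r)
    (fun n => (h.isIterated_diag12 n).isNil)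
  · rw [pow_succ', Module.End.mul_apply, hstep _ (pow_mem_of_mem hE' s h.mem_finitePole12)]
  · exact h.diag12_eq_zero (by omega)

end IsDiffAction

/-! ### Power series in one difference and multiplication by another difference -/

theorem IsNil.map {W' : Type*} [AddCommGroup W'] [Module ℂ W'] (L : W →ₗ[ℂ] W') {F : ℤ → ℤ → W}
    (h : IsNil F) : IsNil (fun p q => L (F p q)) := by
  intro p q
  obtain ⟨N, hN⟩ := h p q
  refine ⟨N, fun s hs => ?_⟩
  rw [diffEnd_pow_map]
  show L _ = 0
  rw [hN s hs, map_zero]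

/-- Power series in `x₁ - x₂` act on `F`. -/
def IsNil12 (F : ℤ → ℤ → ℤ → W) : Prop := ∀ r, IsNil (fun p q => F p q r)

/-- Power series in `x₁ - x₃` act on `F`. -/
def IsNil13 (F : ℤ → ℤ → ℤ → W) : Prop := ∀ q, IsNil (fun p r => F p q r)

/-- Power series in `x₂ - x₃` act on `F`. -/
def IsNil23 (F : ℤ → ℤ → ℤ → W) : Prop := ∀ p, IsNil (F p)

theorem act_shift_left (g : PowerSeries ℂ) {F : ℤ → ℤ → W} (h : IsNil F) (p q : ℤ) :
    act g (fun p q => F (p - 1) q) p q = act g F (p - 1) q := by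
  have h1 := act_shift g h 1 0
  simp only [sub_zero] at h1
  rw [h1]

theorem act_shift_right (g : PowerSeries ℂ) {F : ℤ → ℤ → W} (h : IsNil F) (p q : ℤ) :
    act g (fun p q => F p (q - 1)) p q = act g F p (q - 1) := by
  have h1 := act_shift g h 0 1
  simp only [sub_zero] at h1
  rw [h1]

theorem IsNil.shift_left {F : ℤ → ℤ → W} (h : IsNil F) : IsNil (fun p q => F (p - 1) q) := by
  simpa using h.shift 1 0

theorem IsNil.shift_right {F : ℤ → ℤ → W} (h : IsNil F) : IsNil (fun p q => F p (q - 1)) := by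
  simpa using h.shift 0 1

theorem map_pow_of_map {X : Type*} [AddCommGroup X] [Module ℂ X] {P : X → Prop}
    {E A : Module.End ℂ X} (hP : ∀ x, P x → P (E x)) (h : ∀ x, P x → A (E x) = E (A x)) {x : X}
    (hx : P x) (k : ℕ) : A ((E ^ k) x) = (E ^ k) (A x) := by
  have hPk : ∀ k, P ((E ^ k) x) := by
    intro k
    induction k with
    | zero => exact hx
    | succ k ih => rw [pow_succ', Module.End.mul_apply]; exact hP _ ih
  induction k with
  | zero => rfl
  | succ k ih =>
    rw [pow_succ', Module.End.mul_apply, h _ (hPk k), ih, Module.End.mul_apply]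

theorem lift12_act_diff13_pow (g : PowerSeries ℂ) {F : ℤ → ℤ → ℤ → W} (h : IsNil12 F) (k : ℕ) :
    lift12 (act g) ((diff13 ^ k) F) = (diff13 ^ k) (lift12 (act g) F) := by
  refine map_pow_of_map (P := IsNil12) (fun F h r => (h r).shift_left.sub (h (r - 1)))
    (fun F h => ?_) h k
  funext p q r
  have e : (fun p q => diff13 F p q r) =
      (fun p q => F (p - 1) q r) - fun p q => F p q (r - 1) := rfl
  rw [lift12_apply, e, map_sub, Pi.sub_apply, Pi.sub_apply, act_shift_left g (h r)]
  rfl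

theorem lift12_act_diff23_pow (g : PowerSeries ℂ) {F : ℤ → ℤ → ℤ → W} (h : IsNil12 F) (k : ℕ) :
    lift12 (act g) ((diff23 ^ k) F) = (diff23 ^ k) (lift12 (act g) F) := by
  refine map_pow_of_map (P := IsNil12) (fun F h r => (h r).shift_right.sub (h (r - 1)))
    (fun F h => ?_) h k
  funext p q r
  have e : (fun p q => diff23 F p q r) =
      (fun p q => F p (q - 1) r) - fun p q => F p q (r - 1) := rfl
  rw [lift12_apply, e, map_sub, Pi.sub_apply, Pi.sub_apply, act_shift_right g (h r)]
  rfl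

theorem lift13_act_diff12_pow (g : PowerSeries ℂ) {F : ℤ → ℤ → ℤ → W} (h : IsNil13 F) (k : ℕ) :
    lift13 (act g) ((diff12 ^ k) F) = (diff12 ^ k) (lift13 (act g) F) := by
  refine map_pow_of_map (P := IsNil13) (fun F h q => (h q).shift_left.sub (h (q - 1)))
    (fun F h => ?_) h k
  funext p q r
  have e : (fun p r => diff12 F p q r) =
      (fun p r => F (p - 1) q r) - fun p r => F p (q - 1) r := rfl
  rw [lift13_apply, e, map_sub, Pi.sub_apply, Pi.sub_apply, act_shift_left g (h q)]
  rfl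

theorem lift13_act_diff23_pow (g : PowerSeries ℂ) {F : ℤ → ℤ → ℤ → W} (h : IsNil13 F) (k : ℕ) :
    lift13 (act g) ((diff23 ^ k) F) = (diff23 ^ k) (lift13 (act g) F) := by
  refine map_pow_of_map (P := IsNil13) (fun F h q => (h (q - 1)).sub (h q).shift_right)
    (fun F h => ?_) h k
  funext p q r
  have e : (fun p r => diff23 F p q r) =
      (fun p r => F p (q - 1) r) - fun p r => F p q (r - 1) := rfl
  rw [lift13_apply, e, map_sub, Pi.sub_apply, Pi.sub_apply, act_shift_right g (h q)]
  rfl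

theorem lift23_act_diff12_pow (g : PowerSeries ℂ) {F : ℤ → ℤ → ℤ → W} (h : IsNil23 F) (k : ℕ) :
    lift23 (act g) ((diff12 ^ k) F) = (diff12 ^ k) (lift23 (act g) F) := by
  refine map_pow_of_map (P := IsNil23) (fun F h p => (h (p - 1)).sub (h p).shift_left)
    (fun F h => ?_) h k
  funext p q r
  have e : diff12 F p = F (p - 1) - fun q r => F p (q - 1) r := rfl
  rw [lift23_apply, e, map_sub, Pi.sub_apply, Pi.sub_apply, act_shift_left g (h p)]
  rfl

theorem lift23_act_diff13_pow (g : PowerSeries ℂ) {F : ℤ → ℤ → ℤ → W} (h : IsNil23 F) (k : ℕ) :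
    lift23 (act g) ((diff13 ^ k) F) = (diff13 ^ k) (lift23 (act g) F) := by
  refine map_pow_of_map (P := IsNil23) (fun F h p => (h (p - 1)).sub (h p).shift_right)
    (fun F h => ?_) h k
  funext p q r
  have e : diff13 F p = F (p - 1) - fun q r => F p q (r - 1) := rfl
  rw [lift23_apply, e, map_sub, Pi.sub_apply, Pi.sub_apply, act_shift_right g (h p)]
  rfl

theorem RightRegular.isNil12 {k : ℕ} {H : ℤ → ℤ → ℤ → W} (h : RightRegular k H) : IsNil12 H := by
  obtain ⟨N, hN⟩ := h.first
  exact fun r => IsIterated.isNil ⟨⟨N, fun p hp => funext fun q => hN p hp q r⟩,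
    fun p => h.second p r⟩

theorem RightRegular.isNil13 {k : ℕ} {H : ℤ → ℤ → ℤ → W} (h : RightRegular k H) : IsNil13 H := by
  obtain ⟨N, hN⟩ := h.first
  refine fun q => IsIterated.isNil ⟨⟨N, fun p hp => funext fun r => hN p hp q r⟩, fun p => ?_⟩
  obtain ⟨M, hM⟩ := h.third p
  exact ⟨M, fun r hr => hM r hr q⟩

theorem LeftRegular.isNil13 {k : ℕ} {H : ℤ → ℤ → ℤ → W} (h : LeftRegular k H) : IsNil13 H := by
  intro q
  obtain ⟨M, hM⟩ := h.first q
  exact IsIterated.isNil ⟨⟨M, fun p hp => funext fun r => hM p hp r⟩, fun p => h.third p q⟩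

theorem LeftRegular.isNil23 {k : ℕ} {H : ℤ → ℤ → ℤ → W} (h : LeftRegular k H) : IsNil23 H := by
  obtain ⟨N, hN⟩ := h.second
  exact fun p => IsIterated.isNil ⟨⟨N, fun q hq => funext fun r => hN q hq p r⟩,
    fun q => h.third p q⟩

/-! ### Reordering products of two fields -/

/-- The formal series `b(x₂) a(x₁) w`. -/
def oppProd (b a : VertexOperator ℂ W) (w : W) : ℤ → ℤ → W :=
  fun p q => coeff b q (coeff a p w)

theorem isIterated_oppProd (b a : VertexOperator ℂ W) (w : W) : IsIterated (oppProd b a w) := by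
  obtain ⟨N, hN⟩ := exists_coeff_eq_zero a w
  refine ⟨⟨N, fun p hp => ?_⟩, fun p => exists_coeff_eq_zero b (coeff a p w)⟩
  funext q
  rw [oppProd, hN p hp, map_zero]
  rfl

/-- The span of the operator series `g(x₁ - x₂) b(x₂) a(x₁)` with `b ∈ B`, `a ∈ A` and `g` a power
series. -/
def oppSpan (A B : Set (VertexOperator ℂ W)) : Submodule ℂ (W → ℤ → ℤ → W) :=
  Submodule.span ℂ {Φ | ∃ g : PowerSeries ℂ, ∃ b ∈ B, ∃ a ∈ A, Φ = fun w => act g (oppProd b a w)}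

theorem act_oppProd_mem_oppSpan {A B : Set (VertexOperator ℂ W)} (g : PowerSeries ℂ)
    {a b : VertexOperator ℂ W} (hb : b ∈ B) (ha : a ∈ A) :
    (fun w => act g (oppProd b a w)) ∈ oppSpan A B :=
  Submodule.subset_span ⟨g, b, hb, a, ha, rfl⟩

theorem oppSpan_mono {A A' B B' : Set (VertexOperator ℂ W)} (hA : A ⊆ A') (hB : B ⊆ B') :
    oppSpan A B ≤ oppSpan A' B' := by
  refine Submodule.span_mono ?_
  rintro _ ⟨g, b, hb, a, ha, rfl⟩
  exact ⟨g, b, hB hb, a, hA ha, rfl⟩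

theorem diffEnd_mem_oppSpan {A B : Set (VertexOperator ℂ W)} {Φ : W → ℤ → ℤ → W}
    (h : Φ ∈ oppSpan A B) : (fun w => diffEnd (Φ w)) ∈ oppSpan A B := by
  have key : oppSpan A B ≤ (oppSpan A B).comap (diffEnd.compLeft W) := by
    refine Submodule.span_le.mpr ?_
    rintro _ ⟨g, b, hb, a, ha, rfl⟩
    have e : (diffEnd.compLeft W) (fun w => act g (oppProd b a w)) =
        fun w => act (PowerSeries.X * g) (oppProd b a w) := by
      funext w
      have hn := (isIterated_oppProd b a w).isNil
      rw [← act_act _ _ hn, ← diffEnd_eq_act _ (hn.act g)]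
      rfl
    show _ ∈ oppSpan A B
    rw [e]
    exact act_oppProd_mem_oppSpan _ hb ha
  exact key h

section Saturation

variable {I X : Type*} [AddCommGroup X] [Module ℂ X] {E : Module.End ℂ X}
  {G : Submodule ℂ (I → X)}

theorem pow_family_mem (hG : ∀ F ∈ G, (fun i => E (F i)) ∈ G) {k m : ℕ} (hkm : k ≤ m)
    {F : I → X} (h : (fun i => (E ^ k) (F i)) ∈ G) : (fun i => (E ^ m) (F i)) ∈ G := by
  induction m, hkm using Nat.le_induction with
  | base => exact h
  | succ m _ ih =>
    simp only [pow_succ', Module.End.mul_apply]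
    exact hG _ ih

theorem family_mem_congr {F F' : I → X} (h : ∀ i, F i = F' i) (hF : F' ∈ G) : F ∈ G := by
  rwa [funext h]

/-- For a space `G` of families that is stable under the operator `E`, the space of the families
that some power of `E` maps into `G`. -/
def saturation (hG : ∀ F ∈ G, (fun i => E (F i)) ∈ G) : Submodule ℂ (I → X) where
  carrier := {F | ∃ k : ℕ, (fun i => (E ^ k) (F i)) ∈ G}
  zero_mem' := ⟨0, zero_mem G⟩
  add_mem' := by
    rintro Φ Ψ ⟨k, hk⟩ ⟨m, hm⟩
    refine ⟨max k m, ?_⟩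
    simp only [Pi.add_apply, map_add]
    exact add_mem (pow_family_mem hG (le_max_left _ _) hk)
      (pow_family_mem hG (le_max_right _ _) hm)
  smul_mem' := by
    rintro c Φ ⟨k, hk⟩
    refine ⟨k, ?_⟩
    simp only [Pi.smul_apply, map_smul]
    exact Submodule.smul_mem _ c hk

end Saturation

/-- The operator series `Φ(x₁, x₂)` such that `(x₁ - x₂) ^ k * Φ(x₁, x₂)` is a finite sum of series
`g(x₁ - x₂) b(x₂) a(x₁)` with `b ∈ B`, `a ∈ A` and `g` a power series, for some `k : ℕ`.  Since the
poles of `fᵢ(x₂ - x₁)` can be absorbed into `(x₁ - x₂) ^ k`, the condition of `𝒮`-locality on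
`a(x), b(x)` is that `a(x₁) b(x₂)` belongs to this space. -/
def reorderable (A B : Set (VertexOperator ℂ W)) : Submodule ℂ (W → ℤ → ℤ → W) :=
  saturation (E := diffEnd) (G := oppSpan A B) fun _ h => diffEnd_mem_oppSpan h

theorem mem_reorderable {A B : Set (VertexOperator ℂ W)} {Φ : W → ℤ → ℤ → W} :
    Φ ∈ reorderable A B ↔ ∃ k : ℕ, (fun w => (diffEnd ^ k) (Φ w)) ∈ oppSpan A B := Iff.rfl

theorem oppSpan_le_reorderable (A B : Set (VertexOperator ℂ W)) :
    oppSpan A B ≤ reorderable A B := fun _ h => ⟨0, h⟩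

theorem reorderable_mono {A A' B B' : Set (VertexOperator ℂ W)} (hA : A ⊆ A') (hB : B ⊆ B') :
    reorderable A B ≤ reorderable A' B' := fun _ ⟨k, hk⟩ => ⟨k, oppSpan_mono hA hB hk⟩

theorem diffEnd_mem_reorderable {A B : Set (VertexOperator ℂ W)} {Φ : W → ℤ → ℤ → W}
    (h : Φ ∈ reorderable A B) : (fun w => diffEnd (Φ w)) ∈ reorderable A B := by
  obtain ⟨k, hk⟩ := h
  refine ⟨k, ?_⟩
  simp only [← Module.End.mul_apply, ← pow_succ]
  simp only [pow_succ', Module.End.mul_apply]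
  exact diffEnd_mem_oppSpan hk

theorem mem_reorderable_of_diffEnd {A B : Set (VertexOperator ℂ W)} {Φ : W → ℤ → ℤ → W}
    (h : (fun w => diffEnd (Φ w)) ∈ reorderable A B) : Φ ∈ reorderable A B := by
  obtain ⟨k, hk⟩ := h
  refine ⟨k + 1, ?_⟩
  simpa only [pow_succ, Module.End.mul_apply] using hk

/-- Descending induction along `φ n ↦ (x₁ - x₂) φ n ± φ (n + 1)`. -/
theorem mem_reorderable_of_step {A B : Set (VertexOperator ℂ W)} {φ : ℤ → W → ℤ → ℤ → W} (ε : ℂ)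
    (k : ℕ) (hφ : ∀ n : ℤ, k ≤ n → φ n = 0)
    (h : ∀ n, (fun w => diffEnd (φ n w) + ε • φ (n + 1) w) ∈ reorderable A B) (n : ℤ) :
    φ n ∈ reorderable A B := by
  have key : ∀ (m : ℕ) (n : ℤ), k ≤ n + m → φ n ∈ reorderable A B := by
    intro m
    induction m with
    | zero => intro n hn; rw [hφ n (by simpa using hn)]; exact zero_mem _
    | succ m ih =>
      intro n hn
      refine mem_reorderable_of_diffEnd ?_
      have := sub_mem (h n) (Submodule.smul_mem _ ε (ih (n + 1) (by push_cast at hn; omega)))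
      have e : (fun w => diffEnd (φ n w)) =
          (fun w => diffEnd (φ n w) + ε • φ (n + 1) w) - ε • φ (n + 1) := by
        funext w
        simp only [Pi.sub_apply, Pi.smul_apply, add_sub_cancel_right]
      rw [e]
      exact this
  exact key (k - n).toNat n (by omega)

theorem oppSpan_bound {A B : Set (VertexOperator ℂ W)} {Φ : W → ℤ → ℤ → W}
    (h : Φ ∈ oppSpan A B) (w : W) : ∃ N : ℤ, ∀ p < N, ∀ q, Φ w p q = 0 := by
  induction h using Submodule.span_induction with
  | mem Φ hΦ =>
    obtain ⟨g, b, _, a, _, rfl⟩ := hΦ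
    obtain ⟨⟨N, hN⟩, _⟩ := isIterated_oppProd b a w
    exact ⟨N, fun p hp q => act_apply_eq_zero g fun p' hp' q' _ => by rw [hN p' (by omega)]; rfl⟩
  | zero => exact ⟨0, fun _ _ _ => rfl⟩
  | add Φ Ψ _ _ h1 h2 =>
    obtain ⟨N, hN⟩ := h1
    obtain ⟨M, hM⟩ := h2
    refine ⟨min N M, fun p hp q => ?_⟩
    simp only [Pi.add_apply, hN p (by omega) q, hM p (by omega) q, add_zero]
  | smul c Φ _ h1 =>
    obtain ⟨N, hN⟩ := h1
    exact ⟨N, fun p hp q => by simp only [Pi.smul_apply, hN p hp q, smul_zero]⟩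

theorem exists_compat {A B : Set (VertexOperator ℂ W)} {a b : VertexOperator ℂ W}
    (h : prodSeries a b ∈ reorderable A B) : ∃ k, Compat a b k := by
  obtain ⟨k, hk⟩ := h
  refine ⟨k, fun w => ?_⟩
  rw [← diffEnd_pow_apply]
  obtain ⟨N, hN⟩ := oppSpan_bound hk w
  obtain ⟨M, hM⟩ := exists_coeff_eq_zero b w
  refine ⟨min N M, fun p q hpq => ?_⟩
  by_cases hp : p < N
  · exact hN p hp q
  · refine diffEnd_pow_apply_eq_zero k fun p' _ q' hq' _ => ?_
    rw [prodSeries, hM q' (by omega), map_zero]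

theorem compat_iff (a b : VertexOperator ℂ W) (k : ℕ) :
    Compat a b k ↔ ∀ w, (diffEnd ^ k) (prodSeries a b w) ∈ laurentTwo W := by
  simp only [diffEnd_pow_apply]
  rfl

/-! ### Reordering products of three fields -/

/-- The formal series `a(x₁) b(x₂) c(x₃) w`. -/
def prodSeries₃ (a b c : VertexOperator ℂ W) (w : W) : ℤ → ℤ → ℤ → W :=
  fun p q r => coeff a p (coeff b q (coeff c r w))

/-- Moving `a(x₁)` to the right in `a(x₁) b(x₂) c(x₃)`. -/
theorem reorder_first {A B C : Set (VertexOperator ℂ W)} {a b c : VertexOperator ℂ W}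
    (hab : prodSeries a b ∈ reorderable A B) (hc : ∀ a' ∈ A, prodSeries a' c ∈ reorderable A C)
    (G : Submodule ℂ (W → ℤ → ℤ → ℤ → W)) (hG : ∀ F ∈ G, (fun w => diff13 (F w)) ∈ G)
    (hgen : ∀ g h : PowerSeries ℂ, ∀ b' ∈ B, ∀ c' ∈ C, ∀ a' ∈ A,
      (fun w => lift12 (act g) (lift13 (act h)
        fun p q r => coeff b' q (coeff c' r (coeff a' p w)))) ∈ G) :
    ∃ j k : ℕ, (fun w => (diff13 ^ k) ((diff12 ^ j) (prodSeries₃ a b c w))) ∈ G := by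
  obtain ⟨j, hj⟩ := hab
  refine ⟨j, ?_⟩
  let insertThird : (W → ℤ → ℤ → W) →ₗ[ℂ] (W → ℤ → ℤ → ℤ → W) :=
    { toFun := fun Φ w p q r => Φ (coeff c r w) p q
      map_add' := fun _ _ => rfl
      map_smul' := fun _ _ => rfl }
  have key : oppSpan A B ≤ (saturation hG).comap insertThird := by
    refine Submodule.span_le.mpr ?_
    rintro _ ⟨g, b', hb', a', ha', rfl⟩
    obtain ⟨k, hk⟩ := hc a' ha'
    let insertSecond : (W → ℤ → ℤ → W) →ₗ[ℂ] (W → ℤ → ℤ → ℤ → W) :=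
      { toFun := fun Ψ w p q r => coeff b' q (Ψ w p r)
        map_add' := fun _ _ => by funext w p q r; exact map_add _ _ _
        map_smul' := fun _ _ => by funext w p q r; exact map_smul _ _ _ }
    have key2 : oppSpan A C ≤ G.comap ((lift12 (act g)).compLeft W ∘ₗ insertSecond) := by
      refine Submodule.span_le.mpr ?_
      rintro _ ⟨h, c', hc', a'', ha'', rfl⟩
      refine Submodule.mem_comap.mpr
        (family_mem_congr (fun w => ?_) (hgen g h b' hb' c' hc' a'' ha''))
      refine congrArg (lift12 (act g)) ?_
      funext p q r
      exact (congrFun (congrFun (act_map (coeff b' q) h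
        (isIterated_oppProd c' a'' w).isNil) p) r).symm
    refine ⟨k, ?_⟩
    refine family_mem_congr (fun w => ?_) (Submodule.mem_comap.mp (key2 hk))
    have hn : IsNil12 fun p q r => coeff b' q (coeff a' p (coeff c r w)) :=
      fun r => (isIterated_oppProd b' a' (coeff c r w)).isNil
    refine (lift12_act_diff13_pow g hn k).symm.trans (congrArg (lift12 (act g)) ?_)
    funext p q r
    rw [diff13_pow_apply]
    exact congrFun (congrFun (diffEnd_pow_map (coeff b' q) k (prodSeries a' c w)) p) r
  obtain ⟨k, hk⟩ := key hj
  refine ⟨k, ?_⟩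
  refine family_mem_congr (fun w => congrArg (diff13 ^ k) ?_) hk
  funext p q r
  rw [diff12_pow_apply]
  rfl

/-- Moving `c(x₃)` to the left in `a(x₁) b(x₂) c(x₃)`. -/
theorem reorder_third {A B C : Set (VertexOperator ℂ W)} {a b c : VertexOperator ℂ W}
    (hbc : prodSeries b c ∈ reorderable B C) (ha : ∀ c' ∈ C, prodSeries a c' ∈ reorderable A C)
    (G : Submodule ℂ (W → ℤ → ℤ → ℤ → W)) (hG : ∀ F ∈ G, (fun w => diff13 (F w)) ∈ G)
    (hgen : ∀ g h : PowerSeries ℂ, ∀ b' ∈ B, ∀ c' ∈ C, ∀ a' ∈ A,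
      (fun w => lift23 (act g) (lift13 (act h)
        fun p q r => coeff c' r (coeff a' p (coeff b' q w)))) ∈ G) :
    ∃ j k : ℕ, (fun w => (diff13 ^ k) ((diff23 ^ j) (prodSeries₃ a b c w))) ∈ G := by
  obtain ⟨j, hj⟩ := hbc
  refine ⟨j, ?_⟩
  let insertFirst : (W → ℤ → ℤ → W) →ₗ[ℂ] (W → ℤ → ℤ → ℤ → W) :=
    { toFun := fun Φ w p q r => coeff a p (Φ w q r)
      map_add' := fun _ _ => by funext w p q r; exact map_add _ _ _
      map_smul' := fun _ _ => by funext w p q r; exact map_smul _ _ _ }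
  have key : oppSpan B C ≤ (saturation hG).comap insertFirst := by
    refine Submodule.span_le.mpr ?_
    rintro _ ⟨g, c', hc', b', hb', rfl⟩
    obtain ⟨k, hk⟩ := ha c' hc'
    let insertSecond : (W → ℤ → ℤ → W) →ₗ[ℂ] (W → ℤ → ℤ → ℤ → W) :=
      { toFun := fun Ψ w p q r => Ψ (coeff b' q w) p r
        map_add' := fun _ _ => rfl
        map_smul' := fun _ _ => rfl }
    have key2 : oppSpan A C ≤ G.comap ((lift23 (act g)).compLeft W ∘ₗ insertSecond) := by
      refine Submodule.span_le.mpr ?_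
      rintro _ ⟨h, c'', hc'', a'', ha'', rfl⟩
      exact hgen g h b' hb' c'' hc'' a'' ha''
    refine ⟨k, ?_⟩
    refine family_mem_congr (fun w => ?_) (Submodule.mem_comap.mp (key2 hk))
    have hn : IsNil23 fun p q r => coeff a p (coeff c' r (coeff b' q w)) :=
      fun p => (isIterated_oppProd c' b' w).isNil.map (coeff a p)
    have e : (fun p q r => coeff a p (act g (oppProd c' b' w) q r)) =
        lift23 (act g) fun p q r => coeff a p (coeff c' r (coeff b' q w)) := by
      funext p
      exact (act_map (coeff a p) g (isIterated_oppProd c' b' w).isNil).symm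
    refine (congrArg (diff13 ^ k) e).trans
      ((lift23_act_diff13_pow g hn k).symm.trans (congrArg (lift23 (act g)) ?_))
    funext p q r
    rw [diff13_pow_apply]
    rfl
  obtain ⟨k, hk⟩ := key hj
  refine ⟨k, ?_⟩
  refine family_mem_congr (fun w => congrArg (diff13 ^ k) ?_) hk
  funext p
  rw [diff23_pow_apply]
  exact diffEnd_pow_map (coeff a p) j (prodSeries b c w)

/-! ### `𝒮`-locality of products -/

theorem rightRegular_of_compat (a : VertexOperator ℂ W) {b c : VertexOperator ℂ W} {k : ℕ}
    (h : Compat b c k) (w : W) :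
    RightRegular k fun p q r => coeff b q (coeff c r (coeff a p w)) where
  first := by
    obtain ⟨N, hN⟩ := exists_coeff_eq_zero a w
    exact ⟨N, fun p hp q r => by rw [hN p hp, map_zero, map_zero]⟩
  third p := by
    obtain ⟨M, hM⟩ := exists_coeff_eq_zero c (coeff a p w)
    exact ⟨M, fun r hr q => by rw [hM r hr, map_zero]⟩
  second p r := exists_coeff_eq_zero b _
  pole p := (compat_iff b c k).mp h (coeff a p w)

theorem leftRegular_of_compat {a b : VertexOperator ℂ W} (c : VertexOperator ℂ W) {k : ℕ}
    (h : Compat a b k) (w : W) :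
    LeftRegular k fun p q r => coeff c r (coeff a p (coeff b q w)) where
  second := by
    obtain ⟨N, hN⟩ := exists_coeff_eq_zero b w
    exact ⟨N, fun q hq p r => by rw [hN q hq, map_zero, map_zero]⟩
  first q := by
    obtain ⟨M, hM⟩ := exists_coeff_eq_zero a (coeff b q w)
    exact ⟨M, fun p hp r => by rw [hM p hp, map_zero]⟩
  third p q := exists_coeff_eq_zero c _
  pole := by
    obtain ⟨N, hN⟩ := (compat_iff a b k).mp h w
    refine ⟨N, fun p q r hpq => ?_⟩
    rw [diff12_pow_apply]
    refine (congrFun (congrFun (diffEnd_pow_map (coeff c r) k (prodSeries a b w)) p) q).trans ?_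
    show coeff c r _ = 0
    rw [hN p q hpq, map_zero]

/-- The families of three-variable series which, after setting `x₂ = x₃ + x₀`, can be reordered
with `A` on the right and `K` on the left. -/
def reorderable23 (A K : Set (VertexOperator ℂ W)) : Submodule ℂ (W → ℤ → ℤ → ℤ → W) where
  carrier := {F | (∀ w, F w ∈ finitePole23 W) ∧
    ∀ n, (fun w => diag23 n (F w)) ∈ reorderable A K}
  zero_mem' := ⟨fun _ => zero_mem _, fun n => by
    simp only [Pi.zero_apply, map_zero]
    exact zero_mem (reorderable A K)⟩
  add_mem' := fun hF hG => ⟨fun w => add_mem (hF.1 w) (hG.1 w), fun n => by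
    simp only [Pi.add_apply, map_add]
    exact add_mem (hF.2 n) (hG.2 n)⟩
  smul_mem' := fun x _ hF => ⟨fun w => Submodule.smul_mem _ x (hF.1 w), fun n => by
    simp only [Pi.smul_apply, map_smul]
    exact Submodule.smul_mem _ x (hF.2 n)⟩

theorem diff13_mem_reorderable23 {A K : Set (VertexOperator ℂ W)} {F : W → ℤ → ℤ → ℤ → W}
    (h : F ∈ reorderable23 A K) : (fun w => diff13 (F w)) ∈ reorderable23 A K := by
  refine ⟨fun w => diff13_mem_finitePole23 (h.1 w), fun n => ?_⟩
  simp only [diag23_diff13 (h.1 _)]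
  exact diffEnd_mem_reorderable (h.2 n)

theorem mem_reorderable23_of_diff13_pow {A K : Set (VertexOperator ℂ W)}
    {F : W → ℤ → ℤ → ℤ → W} (hF : ∀ w, F w ∈ finitePole23 W) (k : ℕ)
    (h : (fun w => (diff13 ^ k) (F w)) ∈ reorderable23 A K) : F ∈ reorderable23 A K := by
  induction k generalizing F with
  | zero => exact h
  | succ k ih =>
    have h1 := ih (F := fun w => diff13 (F w)) (fun w => diff13_mem_finitePole23 (hF w))
      (by simpa only [pow_succ, Module.End.mul_apply] using h)
    refine ⟨hF, fun n => mem_reorderable_of_diffEnd ?_⟩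
    have := h1.2 n
    simpa only [diag23_diff13 (hF _)] using this

theorem mem_reorderable23_of_diff12_pow {A K : Set (VertexOperator ℂ W)}
    {F : W → ℤ → ℤ → ℤ → W} {m : ℕ} (hF : ∀ w p, (diffEnd ^ m) (F w p) ∈ laurentTwo W) (k : ℕ)
    (h : (fun w => (diff12 ^ k) (F w)) ∈ reorderable23 A K) : F ∈ reorderable23 A K := by
  induction k generalizing F with
  | zero => exact h
  | succ k ih =>
    have hP : ∀ w, F w ∈ finitePole23 W := fun w p => ⟨m, hF w p⟩
    have h1 := ih (F := fun w => diff12 (F w)) (fun w p => by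
      have e : diff12 (F w) p = F w (p - 1) - fun q r => F w p (q - 1) r := rfl
      have e2 := diffEnd_pow_shift m (F w p) 1 0
      have h3 := shift_mem_laurentTwo (hF w p) 1 0
      simp only [sub_zero] at e2 h3
      rw [e, map_sub, e2]
      exact sub_mem (hF w (p - 1)) h3)
      (by simpa only [pow_succ, Module.End.mul_apply] using h)
    refine ⟨hP, mem_reorderable_of_step (-1) m (fun n hn => ?_) fun n => ?_⟩
    · funext w p
      exact diag_eq_zero (hF w p) hn
    · have := h1.2 n
      simpa only [diag23_diff12 (hP _), sub_eq_add_neg, neg_one_smul] using this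

/-- The `𝒮`-locality relation passes from `a, b` and `a', c` to `a, bₙc`. -/
theorem prodSeries_nthProd_right_mem {A B C K : Set (VertexOperator ℂ W)}
    {a b c : VertexOperator ℂ W} (hab : prodSeries a b ∈ reorderable A B)
    (hc : ∀ a' ∈ A, prodSeries a' c ∈ reorderable A C)
    (hBC : ∀ b' ∈ B, ∀ c' ∈ C, ∃ k, Compat b' c' k)
    (hK : ∀ b' ∈ B, ∀ c' ∈ C, ∀ n, nthProd b' n c' ∈ K) {m : ℕ} (hbc : Compat b c m) (n : ℤ) :
    prodSeries a (nthProd b n c) ∈ reorderable A K := by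
  obtain ⟨j, k, hjk⟩ := reorder_first hab hc (reorderable23 A K)
    (fun F hF => diff13_mem_reorderable23 hF) (by
      intro g h b' hb' c' hc' a' ha'
      obtain ⟨k, hk⟩ := hBC b' hb' c' hc'
      have reg := fun w => rightRegular_of_compat a' hk w
      have hcomm1 := fun w => lift13_act_diff23_pow h (reg w).isNil13 k
      have reg2 := fun w => (reg w).regular_act isDiffAction13 h (hcomm1 w)
      have hcomm2 := fun w => lift12_act_diff23_pow g (reg2 w).isNil12 k
      refine ⟨fun w p => ⟨k, (reg2 w).pole_act isDiffAction12 g (hcomm2 w) p⟩, fun n => ?_⟩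
      have e1 : ∀ w n, diag23 n (lift13 (act h)
          fun p q r => coeff b' q (coeff c' r (coeff a' p w))) =
            act h (oppProd (nthProd b' n c') a' w) := by
        intro w n
        have e0 := (reg w).diag23_act isDiffAction13 commute_diff13_diff23
          (fun F hF => diff13_mem_finitePole23 hF) 0
          (fun F hF n => by rw [zero_smul, add_zero, diag23_diff13 hF]) h (hcomm1 w) n
          ((k - n).toNat + 1) (by push_cast; omega)
        rw [e0, Finset.sum_eq_single 0]
        · rw [pow_zero, one_smul, divDeriv_zero, Nat.cast_zero, add_zero]
          congr 1
          funext p t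
          exact diag_prodSeries hk n (coeff a' p w) t
        · intro i _ hi
          rw [zero_pow hi, zero_smul]
        · intro hcon
          exact absurd (Finset.mem_range.mpr (Nat.succ_pos _)) hcon
      have e2 : ∀ w, diag23 n (lift12 (act g) (lift13 (act h)
          fun p q r => coeff b' q (coeff c' r (coeff a' p w)))) =
          ∑ i ∈ Finset.range (k - n).toNat, (-1 : ℂ) ^ i •
            act (divDeriv i g * h) (oppProd (nthProd b' (n + i) c') a' w) := by
        intro w
        rw [(reg2 w).diag23_act isDiffAction12 commute_diff12_diff23
          (fun F hF => diff12_mem_finitePole23 hF) (-1)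
          (fun F hF n => by rw [neg_one_smul, ← sub_eq_add_neg, diag23_diff12 hF]) g (hcomm2 w) n
          (k - n).toNat (by omega)]
        refine Finset.sum_congr rfl fun i _ => ?_
        rw [e1, act_act _ _ (isIterated_oppProd _ _ w).isNil]
      simp only [e2]
      refine oppSpan_le_reorderable _ _ ?_
      have e3 : (fun w => ∑ i ∈ Finset.range (k - n).toNat, (-1 : ℂ) ^ i •
          act (divDeriv i g * h) (oppProd (nthProd b' (n + i) c') a' w)) =
          ∑ i ∈ Finset.range (k - n).toNat, (-1 : ℂ) ^ i •
            fun w => act (divDeriv i g * h) (oppProd (nthProd b' (n + i) c') a' w) := by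
        funext w
        simp only [Finset.sum_apply, Pi.smul_apply]
      rw [e3]
      exact sum_mem fun i _ => Submodule.smul_mem _ _
        (act_oppProd_mem_oppSpan _ (hK b' hb' c' hc' _) ha'))
  have pole : ∀ w p, (diffEnd ^ m) (prodSeries₃ a b c w p) ∈ laurentTwo W := by
    intro w p
    have e := diffEnd_pow_map (coeff a p) m (prodSeries b c w)
    obtain ⟨N, hN⟩ := (compat_iff b c m).mp hbc w
    refine ⟨N, fun q r hqr => ?_⟩
    refine (congrFun (congrFun e q) r).trans ?_
    show coeff a p _ = 0
    rw [hN q r hqr, map_zero]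
  have pole' : ∀ w, (diff12 ^ j) (prodSeries₃ a b c w) ∈ finitePole23 W := fun w =>
    pow_mem_of_mem (fun F hF => diff12_mem_finitePole23 hF) j fun p => ⟨m, pole w p⟩
  have hF := mem_reorderable23_of_diff12_pow pole j
    (mem_reorderable23_of_diff13_pow pole' k hjk)
  convert hF.2 n using 1
  funext w p t
  refine Eq.trans ?_
    (diag_map (coeff a p) ⟨m, (compat_iff b c m).mp hbc w⟩ n t).symm
  rw [diag_prodSeries hbc]
  rfl

/-- The families of three-variable series which, after setting `x₁ = x₂ + x₀`, can be reordered
with `K` on the right and `C` on the left. -/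
def reorderable12 (K C : Set (VertexOperator ℂ W)) : Submodule ℂ (W → ℤ → ℤ → ℤ → W) where
  carrier := {F | (∀ w, F w ∈ finitePole12 W) ∧
    ∀ n, (fun w => diag12 n (F w)) ∈ reorderable K C}
  zero_mem' := ⟨fun _ => zero_mem _, fun n => by
    simp only [Pi.zero_apply, map_zero]
    exact zero_mem (reorderable K C)⟩
  add_mem' := fun hF hG => ⟨fun w => add_mem (hF.1 w) (hG.1 w), fun n => by
    simp only [Pi.add_apply, map_add]
    exact add_mem (hF.2 n) (hG.2 n)⟩
  smul_mem' := fun x _ hF => ⟨fun w => Submodule.smul_mem _ x (hF.1 w), fun n => by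
    simp only [Pi.smul_apply, map_smul]
    exact Submodule.smul_mem _ x (hF.2 n)⟩

theorem diff13_mem_reorderable12 {K C : Set (VertexOperator ℂ W)} {F : W → ℤ → ℤ → ℤ → W}
    (h : F ∈ reorderable12 K C) : (fun w => diff13 (F w)) ∈ reorderable12 K C := by
  refine ⟨fun w => diff13_mem_finitePole12 (h.1 w), fun n => ?_⟩
  simp only [diag12_diff13 (h.1 _)]
  exact add_mem (diffEnd_mem_reorderable (h.2 n)) (h.2 (n + 1))

/-- The factor `x₂ - x₃` is not affected by setting `x₁ = x₂ + x₀`, so it can be cancelled. -/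
theorem mem_reorderable12_of_diff23_pow {K C : Set (VertexOperator ℂ W)}
    {F : W → ℤ → ℤ → ℤ → W} (hF : ∀ w, F w ∈ finitePole12 W) (k : ℕ)
    (h : (fun w => (diff23 ^ k) (F w)) ∈ reorderable12 K C) : F ∈ reorderable12 K C := by
  induction k generalizing F with
  | zero => exact h
  | succ k ih =>
    have h1 := ih (F := fun w => diff23 (F w)) (fun w => diff23_mem_finitePole12 (hF w))
      (by simpa only [pow_succ, Module.End.mul_apply] using h)
    refine ⟨hF, fun n => mem_reorderable_of_diffEnd ?_⟩
    have := h1.2 n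
    simpa only [diag12_diff23 (hF _)] using this

/-- As `x₁ - x₃` becomes `(x₂ - x₃) + x₀`, it can be cancelled by descending induction on the
index of the collapse, which vanishes for large indices. -/
theorem mem_reorderable12_of_diff13_pow {K C : Set (VertexOperator ℂ W)}
    {F : W → ℤ → ℤ → ℤ → W} {m : ℕ}
    (hF : ∀ w r, (diffEnd ^ m) (fun p q => F w p q r) ∈ laurentTwo W) (k : ℕ)
    (h : (fun w => (diff13 ^ k) (F w)) ∈ reorderable12 K C) : F ∈ reorderable12 K C := by
  induction k generalizing F with
  | zero => exact h
  | succ k ih =>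
    have hP : ∀ w, F w ∈ finitePole12 W := fun w r => ⟨m, hF w r⟩
    have h1 := ih (F := fun w => diff13 (F w)) (fun w r => by
      have e : (fun p q => diff13 (F w) p q r) =
        (fun p q => F w (p - 1) q r) - fun p q => F w p q (r - 1) := rfl
      have e2 := diffEnd_pow_shift m (fun p q => F w p q r) 1 0
      have h3 := shift_mem_laurentTwo (hF w r) 1 0
      simp only [sub_zero] at e2 h3
      rw [e, map_sub, e2]
      exact sub_mem h3 (hF w (r - 1)))
      (by simpa only [pow_succ, Module.End.mul_apply] using h)
    refine ⟨hP, mem_reorderable_of_step 1 m (fun n hn => ?_) fun n => ?_⟩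
    · funext w t r
      exact congrFun (diag_eq_zero (hF w r) hn) t
    · have := h1.2 n
      simpa only [diag12_diff13 (hP _), one_smul] using this

/-- The `𝒮`-locality relation passes from `b, c` and `a, c'` to `aₙb, c`. -/
theorem prodSeries_nthProd_left_mem {A B C K : Set (VertexOperator ℂ W)}
    {a b c : VertexOperator ℂ W} (hbc : prodSeries b c ∈ reorderable B C)
    (ha : ∀ c' ∈ C, prodSeries a c' ∈ reorderable A C)
    (hAB : ∀ a' ∈ A, ∀ b' ∈ B, ∃ k, Compat a' b' k)
    (hK : ∀ a' ∈ A, ∀ b' ∈ B, ∀ n, nthProd a' n b' ∈ K) {m : ℕ} (hab : Compat a b m) (n : ℤ) :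
    prodSeries (nthProd a n b) c ∈ reorderable K C := by
  obtain ⟨j, k, hjk⟩ := reorder_third hbc ha (reorderable12 K C)
    (fun F hF => diff13_mem_reorderable12 hF) (by
      intro g h b' hb' c' hc' a' ha'
      obtain ⟨k, hk⟩ := hAB a' ha' b' hb'
      have reg := fun w => leftRegular_of_compat c' hk w
      have hcomm1 := fun w => lift13_act_diff12_pow h (reg w).isNil13 k
      have reg2 := fun w => (reg w).regular_act isDiffAction13 h (hcomm1 w)
      have hcomm2 := fun w => lift23_act_diff12_pow g (reg2 w).isNil23 k
      refine ⟨fun w r => ?_, fun n => ?_⟩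
      · obtain ⟨N, hN⟩ := (reg2 w).pole_act isDiffAction23 g (hcomm2 w)
        exact ⟨k, N, fun p q hpq => by rw [← diff12_pow_apply]; exact hN p q r hpq⟩
      have e0 : ∀ w n, diag12 n (fun p q r => coeff c' r (coeff a' p (coeff b' q w))) =
          oppProd c' (nthProd a' n b') w := by
        intro w n
        funext t r
        refine (diag_map (coeff c' r) ⟨k, (compat_iff a' b' k).mp hk w⟩ n t).trans ?_
        rw [diag_prodSeries hk]
        rfl
      have e1 : ∀ w n, diag12 n (lift13 (act h)
          fun p q r => coeff c' r (coeff a' p (coeff b' q w))) =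
          ∑ i ∈ Finset.range (k - n).toNat,
            act (divDeriv i h) (oppProd c' (nthProd a' (n + i) b') w) := by
        intro w n
        rw [(reg w).diag12_act isDiffAction13 commute_diff12_diff13.symm
          (fun F hF => diff13_mem_finitePole12 hF) 1
          (fun F hF n => by rw [one_smul, diag12_diff13 hF]) h (hcomm1 w) n
          (k - n).toNat (by omega)]
        refine Finset.sum_congr rfl fun i _ => ?_
        rw [e0, one_pow, one_smul]
      have e2 : ∀ w, diag12 n (lift23 (act g) (lift13 (act h)
          fun p q r => coeff c' r (coeff a' p (coeff b' q w)))) =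
          ∑ i ∈ Finset.range (k - n).toNat,
            act (g * divDeriv i h) (oppProd c' (nthProd a' (n + i) b') w) := by
        intro w
        rw [(reg2 w).diag12_act isDiffAction23 commute_diff12_diff23.symm
          (fun F hF => diff23_mem_finitePole12 hF) 0
          (fun F hF n => by rw [zero_smul, add_zero, diag12_diff23 hF]) g (hcomm2 w) n
          ((k - n).toNat + 1) (by push_cast; omega), Finset.sum_eq_single 0]
        · rw [pow_zero, one_smul, divDeriv_zero, Nat.cast_zero, add_zero, e1, map_sum]
          refine Finset.sum_congr rfl fun i _ => ?_
          rw [act_act _ _ (isIterated_oppProd _ _ w).isNil]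
        · intro i _ hi
          rw [zero_pow hi, zero_smul]
        · intro hcon
          exact absurd (Finset.mem_range.mpr (Nat.succ_pos _)) hcon
      simp only [e2]
      refine oppSpan_le_reorderable _ _ ?_
      have e3 : (fun w => ∑ i ∈ Finset.range (k - n).toNat,
          act (g * divDeriv i h) (oppProd c' (nthProd a' (n + i) b') w)) =
          ∑ i ∈ Finset.range (k - n).toNat,
            fun w => act (g * divDeriv i h) (oppProd c' (nthProd a' (n + i) b') w) := by
        funext w
        simp only [Finset.sum_apply]
      rw [e3]
      exact sum_mem fun i _ => act_oppProd_mem_oppSpan _ hc' (hK a' ha' b' hb' _))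
  have pole : ∀ w r, (diffEnd ^ m) (fun p q => prodSeries₃ a b c w p q r) ∈ laurentTwo W :=
    fun w r => (compat_iff a b m).mp hab (coeff c r w)
  have pole' : ∀ w r, (diffEnd ^ m) (fun p q => (diff23 ^ j) (prodSeries₃ a b c w) p q r) ∈
      laurentTwo W := by
    intro w r
    have key : ∀ j, (diff12 ^ m) ((diff23 ^ j) (prodSeries₃ a b c w)) =
        (diff23 ^ j) ((diff12 ^ m) (prodSeries₃ a b c w)) := fun j => by
      rw [← Module.End.mul_apply, ← Module.End.mul_apply,
        (commute_diff12_diff23.pow_pow m j).eq]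
    have hL : ∀ j r, (fun p q => (diff23 ^ j) ((diff12 ^ m) (prodSeries₃ a b c w)) p q r) ∈
        laurentTwo W := by
      intro j
      induction j with
      | zero =>
        intro r
        have e : (fun p q => (diff12 ^ m) (prodSeries₃ a b c w) p q r) =
            (diffEnd ^ m) (fun p q => prodSeries₃ a b c w p q r) := by
          funext p q
          rw [diff12_pow_apply]
        show (fun p q => (diff12 ^ m) (prodSeries₃ a b c w) p q r) ∈ laurentTwo W
        rw [e]
        exact pole w r
      | succ j ih =>
        intro r
        simp only [pow_succ', Module.End.mul_apply, diff23_apply]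
        have h3 := shift_mem_laurentTwo (ih r) 0 1
        simp only [sub_zero] at h3
        exact sub_mem h3 (ih (r - 1))
    have e : (diffEnd ^ m) (fun p q => (diff23 ^ j) (prodSeries₃ a b c w) p q r) =
        fun p q => (diff23 ^ j) ((diff12 ^ m) (prodSeries₃ a b c w)) p q r := by
      funext p q
      rw [← key, diff12_pow_apply]
    rw [e]
    exact hL j r
  have hF := mem_reorderable12_of_diff23_pow (fun w r => ⟨m, pole w r⟩) j
    (mem_reorderable12_of_diff13_pow pole' k hjk)
  convert hF.2 n using 1
  funext w t r
  exact (diag_prodSeries hab n (coeff c r w) t).symm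

/-! ### Iterated products -/

/-- `G ∈ W((x₁, x₂, x₃))`. -/
def IsLaurentThree (G : ℤ → ℤ → ℤ → W) : Prop :=
  ∃ N : ℤ, ∀ p q r : ℤ, p < N ∨ q < N ∨ r < N → G p q r = 0

theorem diag_neg_of_mem_laurentTwo {F : ℤ → ℤ → W} (h : F ∈ laurentTwo W) (i : ℕ) (t : ℤ) :
    diag (-i - 1) F t = ∑ᶠ p : ℤ, (Ring.choose p i : ℤ) • F p (t + i - p) := by
  rw [diag_eq (k := 0) h, diagRes, if_pos (by push_cast; omega)]
  refine finsum_congr fun p => ?_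
  have e : (((0 : ℕ) : ℤ) - (-i - 1) - 1) = i := by push_cast; ring
  rw [e, Int.toNat_natCast, pow_zero]
  rfl

theorem diag_of_mem_laurentTwo {F : ℤ → ℤ → W} (h : F ∈ laurentTwo W) {n : ℤ} (hn : 0 ≤ n) :
    diag n F = 0 := diag_eq_zero (k := 0) h (by simpa using hn)

theorem IsLaurentThree.slice12 {G : ℤ → ℤ → ℤ → W} (h : IsLaurentThree G) (r : ℤ) :
    (fun p q => G p q r) ∈ laurentTwo W := by
  obtain ⟨N, hN⟩ := h
  exact ⟨N, fun p q hpq => hN p q r (by tauto)⟩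

theorem IsLaurentThree.slice23 {G : ℤ → ℤ → ℤ → W} (h : IsLaurentThree G) (p : ℤ) :
    G p ∈ laurentTwo W := by
  obtain ⟨N, hN⟩ := h
  exact ⟨N, fun q r hqr => hN p q r (by tauto)⟩

theorem IsLaurentThree.diag12_mem {G : ℤ → ℤ → ℤ → W} (h : IsLaurentThree G) (i : ℕ) :
    diag12 (-i - 1) G ∈ laurentTwo W := by
  obtain ⟨N, hN⟩ := id h
  refine ⟨min (2 * N - i) N, fun t r htr => ?_⟩
  rw [diag12_apply, diag_neg_of_mem_laurentTwo (h.slice12 r)]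
  refine finsum_eq_zero_of_forall_eq_zero fun p => ?_
  rw [hN _ _ _ (by omega), smul_zero]

theorem IsLaurentThree.diag23_mem {G : ℤ → ℤ → ℤ → W} (h : IsLaurentThree G) (i : ℕ) :
    diag23 (-i - 1) G ∈ laurentTwo W := by
  obtain ⟨N, hN⟩ := id h
  refine ⟨min (2 * N - i) N, fun p t hpt => ?_⟩
  rw [diag23_apply, diag_neg_of_mem_laurentTwo (h.slice23 p)]
  refine finsum_eq_zero_of_forall_eq_zero fun q => ?_
  rw [hN _ _ _ (by omega), smul_zero]

theorem choose_mul_choose_sub_add (p q : ℤ) (i j : ℕ) :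
    Ring.choose (p + q - i) j * Ring.choose p i = ∑ xy ∈ Finset.HasAntidiagonal.antidiagonal j,
      ((i + xy.1).choose i : ℤ) * (Ring.choose p (i + xy.1) * Ring.choose q xy.2) := by
  have e : p + q - i = (p - i) + q := by ring
  rw [e, Ring.add_choose_eq j (Commute.all _ _), Finset.sum_mul]
  refine Finset.sum_congr rfl fun xy _ => ?_
  have := Ring.choose_smul_choose p (Nat.le_add_right i xy.1)
  rw [nsmul_eq_mul, Nat.add_sub_cancel_left] at this
  linear_combination (-Ring.choose q xy.2) * this

/-- The coefficients of `G(x + x₂ + x₀, x + x₂, x)` in terms of those of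
`G(x + y₁, x + y₂, x)`. -/
theorem IsLaurentThree.diag_diag12 {G : ℤ → ℤ → ℤ → W} (h : IsLaurentThree G) (i j : ℕ) (t : ℤ) :
    diag (-j - 1) (diag12 (-i - 1) G) t =
      ∑ xy ∈ Finset.HasAntidiagonal.antidiagonal j, ((i + xy.1).choose i : ℤ) •
        diag (-(i + xy.1 : ℕ) - 1) (diag23 (-xy.2 - 1) G) t := by
  obtain ⟨N, hN⟩ := id h
  set d : ℤ := t + i + j with hd
  set B := Finset.Icc N (d - 2 * N) with hB
  have supp : ∀ (c : ℤ → ℤ) (p : ℤ), (Function.support fun q : ℤ => c q • G p q (d - p - q)) ⊆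
      (B : Set ℤ) := by
    intro c p q hq
    by_contra hcon
    refine hq ?_
    rw [hB, Finset.coe_Icc, Set.mem_Icc] at hcon
    show _ • _ = _
    by_cases hp : p < N
    · rw [hN p _ _ (by omega), smul_zero]
    · rw [hN p _ _ (by omega), smul_zero]
  have zero : ∀ p ∉ B, ∀ q, G p q (d - p - q) = 0 := by
    intro p hp q
    rw [hB, Finset.mem_Icc] at hp
    by_cases hq : q < N
    · exact hN _ _ _ (by omega)
    · exact hN _ _ _ (by omega)
  have lhs : diag (-j - 1) (diag12 (-i - 1) G) t = ∑ p ∈ B, ∑ q ∈ B,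
      (Ring.choose (p + q - i) j * Ring.choose p i : ℤ) • G p q (d - p - q) := by
    rw [diag_neg_of_mem_laurentTwo (h.diag12_mem i)]
    have e1 : ∀ u : ℤ, (Ring.choose u j : ℤ) • diag12 (-i - 1) G u (t + j - u) =
        ∑ p ∈ B, (Ring.choose u j * Ring.choose p i : ℤ) • G p (u + i - p) (t + j - u) := by
      intro u
      rw [diag12_apply, diag_neg_of_mem_laurentTwo (h.slice12 _)]
      rw [finsum_eq_sum_of_support_subset (s := B), Finset.smul_sum]
      · simp only [mul_smul]
      · intro p hp
        by_contra hcon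
        refine hp ?_
        have := zero p hcon (u + i - p)
        rw [show d - p - (u + i - p) = t + j - u by rw [hd]; ring] at this
        show _ • _ = _
        rw [this, smul_zero]
    simp only [e1]
    have e2 : ∀ p, ∑ᶠ u : ℤ, (Ring.choose u j * Ring.choose p i : ℤ) •
        G p (u + i - p) (t + j - u) = ∑ᶠ q : ℤ, (Ring.choose (p + q - i) j * Ring.choose p i : ℤ) •
          G p q (d - p - q) := by
      intro p
      rw [← finsum_comp_equiv (Equiv.addRight (p - i : ℤ))]
      refine finsum_congr fun q => ?_
      rw [Equiv.coe_addRight]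
      dsimp only
      rw [show q + (p - i : ℤ) = p + q - i by ring,
        show p + q - i + i - p = q by ring, show t + j - (p + q - i) = d - p - q by rw [hd]; ring]
    have e3 : ∀ p ∈ B, (Function.support fun u : ℤ => (Ring.choose u j * Ring.choose p i : ℤ) •
        G p (u + i - p) (t + j - u)).Finite := by
      intro p _
      refine ((B.finite_toSet).preimage (f := fun u : ℤ => u + i - p) (fun x _ y _ hxy => by
        simpa using hxy)).subset fun u hu => ?_
      refine supp (fun _ => Ring.choose u j * Ring.choose p i) p (a := u + i - p) ?_
      rw [Function.mem_support, show d - p - (u + i - p) = t + j - u by rw [hd]; ring]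
      exact hu
    rw [finsum_sum_comm _ _ e3]
    refine Finset.sum_congr rfl fun p _ => ?_
    rw [e2, finsum_eq_sum_of_support_subset _ (supp _ p)]
  have rhs : ∀ α β : ℕ, α + β = i + j → diag (-α - 1) (diag23 (-β - 1) G) t =
      ∑ p ∈ B, ∑ q ∈ B, (Ring.choose p α * Ring.choose q β : ℤ) • G p q (d - p - q) := by
    intro α β hαβ
    rw [diag_neg_of_mem_laurentTwo (h.diag23_mem β)]
    have e1 : ∀ p : ℤ, (Ring.choose p α : ℤ) • diag23 (-β - 1) G p (t + α - p) =
        ∑ q ∈ B, (Ring.choose p α * Ring.choose q β : ℤ) • G p q (d - p - q) := by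
      intro p
      have e : t + α - p + β = d - p := by omega
      rw [diag23_apply, diag_neg_of_mem_laurentTwo (h.slice23 _), e,
        finsum_eq_sum_of_support_subset _ (supp _ p), Finset.smul_sum]
      simp only [mul_smul]
    simp only [e1]
    refine finsum_eq_sum_of_support_subset _ fun p hp => ?_
    by_contra hcon
    refine hp (Finset.sum_eq_zero fun q _ => ?_)
    rw [zero p hcon, smul_zero]
  rw [lhs]
  have e : ∀ xy ∈ Finset.HasAntidiagonal.antidiagonal j, ((i + xy.1).choose i : ℤ) •
      diag (-(i + xy.1 : ℕ) - 1) (diag23 (-xy.2 - 1) G) t = ∑ p ∈ B, ∑ q ∈ B,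
        (((i + xy.1).choose i : ℤ) * (Ring.choose p (i + xy.1) * Ring.choose q xy.2)) •
          G p q (d - p - q) := by
    intro xy hxy
    have hxy := Finset.HasAntidiagonal.mem_antidiagonal.mp hxy
    rw [rhs _ _ (by omega), Finset.smul_sum]
    simp only [Finset.smul_sum, mul_smul]
  rw [Finset.sum_congr rfl e]
  symm
  rw [Finset.sum_comm]
  refine Finset.sum_congr rfl fun p _ => ?_
  rw [Finset.sum_comm]
  refine Finset.sum_congr rfl fun q _ => ?_
  rw [choose_mul_choose_sub_add, Finset.sum_smul]

/-- The span of the operator series obtained from `F(x₁, x₂, x₃)` by setting first `x₂ = x₃ + y₂`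
and then `x₁ = x₃ + y₁`, and taking coefficients with respect to `y₁` and `y₂`.  For
`F = a(x₁) b(x₂) c(x₃)` these are the products `aₚ(b_q c)`. -/
def iterSpan (F : W → ℤ → ℤ → ℤ → W) : Submodule ℂ (W → ℤ → W) :=
  Submodule.span ℂ (Set.range fun (pq : ℤ × ℤ) w => diag pq.1 (diag23 pq.2 (F w)))

theorem diag_diag23_mem_iterSpan (F : W → ℤ → ℤ → ℤ → W) (p q : ℤ) :
    (fun w => diag p (diag23 q (F w))) ∈ iterSpan F :=
  Submodule.subset_span ⟨(p, q), rfl⟩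

/-- The finiteness conditions under which both iterated collapses of a family of series in
`x₁, x₂, x₃` are meaningful. -/
structure IsCollapsible (F : W → ℤ → ℤ → ℤ → W) : Prop where
  pole12 : ∃ k : ℕ, ∀ w r, (diffEnd ^ k) (fun p q => F w p q r) ∈ laurentTwo W
  pole23 : ∃ k : ℕ, ∀ w p, (diffEnd ^ k) (F w p) ∈ laurentTwo W
  diag12_mem : ∀ m w, diag12 m (F w) ∈ finitePole W
  diag23_mem : ∀ m w, diag23 m (F w) ∈ finitePole W

section IsCollapsible

variable {F : W → ℤ → ℤ → ℤ → W}

theorem IsCollapsible.mem12 (h : IsCollapsible F) (w : W) : F w ∈ finitePole12 W := by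
  obtain ⟨k, hk⟩ := h.pole12
  exact fun r => ⟨k, hk w r⟩

theorem IsCollapsible.mem23 (h : IsCollapsible F) (w : W) : F w ∈ finitePole23 W := by
  obtain ⟨k, hk⟩ := h.pole23
  exact fun p => ⟨k, hk w p⟩

theorem diffEnd_pow_shift_left_mem {k : ℕ} {F : ℤ → ℤ → W} (h : (diffEnd ^ k) F ∈ laurentTwo W) :
    (diffEnd ^ k) (fun p q => F (p - 1) q) ∈ laurentTwo W := by
  have e := diffEnd_pow_shift k F 1 0
  have h3 := shift_mem_laurentTwo h 1 0
  simp only [sub_zero] at e h3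
  rwa [e]

theorem diffEnd_pow_shift_right_mem {k : ℕ} {F : ℤ → ℤ → W} (h : (diffEnd ^ k) F ∈ laurentTwo W) :
    (diffEnd ^ k) (fun p q => F p (q - 1)) ∈ laurentTwo W := by
  have e := diffEnd_pow_shift k F 0 1
  have h3 := shift_mem_laurentTwo h 0 1
  simp only [sub_zero] at e h3
  rwa [e]

theorem IsCollapsible.mul_diff12 (h : IsCollapsible F) : IsCollapsible fun w => diff12 (F w) where
  pole12 := by
    obtain ⟨k, hk⟩ := h.pole12
    refine ⟨k, fun w r => ?_⟩
    have e : (fun p q => diff12 (F w) p q r) =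
      (fun p q => F w (p - 1) q r) - fun p q => F w p (q - 1) r := rfl
    rw [e, map_sub]
    exact sub_mem (diffEnd_pow_shift_left_mem (hk w r)) (diffEnd_pow_shift_right_mem (hk w r))
  pole23 := by
    obtain ⟨k, hk⟩ := h.pole23
    refine ⟨k, fun w p => ?_⟩
    have e : diff12 (F w) p = F w (p - 1) - fun q r => F w p (q - 1) r := rfl
    rw [e, map_sub]
    exact sub_mem (hk w (p - 1)) (diffEnd_pow_shift_left_mem (hk w p))
  diag12_mem m w := by
    rw [diag12_diff12 (h.mem12 w)]
    exact h.diag12_mem _ w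
  diag23_mem m w := by
    rw [diag23_diff12 (h.mem23 w)]
    exact sub_mem (diffEnd_mem_finitePole (h.diag23_mem _ w)) (h.diag23_mem _ w)

theorem IsCollapsible.mul_diff13 (h : IsCollapsible F) : IsCollapsible fun w => diff13 (F w) where
  pole12 := by
    obtain ⟨k, hk⟩ := h.pole12
    refine ⟨k, fun w r => ?_⟩
    have e : (fun p q => diff13 (F w) p q r) =
      (fun p q => F w (p - 1) q r) - fun p q => F w p q (r - 1) := rfl
    rw [e, map_sub]
    exact sub_mem (diffEnd_pow_shift_left_mem (hk w r)) (hk w (r - 1))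
  pole23 := by
    obtain ⟨k, hk⟩ := h.pole23
    refine ⟨k, fun w p => ?_⟩
    have e : diff13 (F w) p = F w (p - 1) - fun q r => F w p q (r - 1) := rfl
    rw [e, map_sub]
    exact sub_mem (hk w (p - 1)) (diffEnd_pow_shift_right_mem (hk w p))
  diag12_mem m w := by
    rw [diag12_diff13 (h.mem12 w)]
    exact add_mem (diffEnd_mem_finitePole (h.diag12_mem _ w)) (h.diag12_mem _ w)
  diag23_mem m w := by
    rw [diag23_diff13 (h.mem23 w)]
    exact diffEnd_mem_finitePole (h.diag23_mem _ w)

theorem IsCollapsible.mul_diff23 (h : IsCollapsible F) : IsCollapsible fun w => diff23 (F w) where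
  pole12 := by
    obtain ⟨k, hk⟩ := h.pole12
    refine ⟨k, fun w r => ?_⟩
    have e : (fun p q => diff23 (F w) p q r) =
      (fun p q => F w p (q - 1) r) - fun p q => F w p q (r - 1) := rfl
    rw [e, map_sub]
    exact sub_mem (diffEnd_pow_shift_right_mem (hk w r)) (hk w (r - 1))
  pole23 := by
    obtain ⟨k, hk⟩ := h.pole23
    refine ⟨k, fun w p => ?_⟩
    have e : diff23 (F w) p = (fun q r => F w p (q - 1) r) - fun q r => F w p q (r - 1) := rfl
    rw [e, map_sub]
    exact sub_mem (diffEnd_pow_shift_left_mem (hk w p)) (diffEnd_pow_shift_right_mem (hk w p))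
  diag12_mem m w := by
    rw [diag12_diff23 (h.mem12 w)]
    exact diffEnd_mem_finitePole (h.diag12_mem _ w)
  diag23_mem m w := by
    rw [diag23_diff23 (h.mem23 w)]
    exact h.diag23_mem _ w

/-- Every series obtained from `F` by setting first `x₁ = x₂ + x₀` and then `x₂ = x₃ + y` is a
combination of those obtained in the other order.  For `F = a(x₁) b(x₂) c(x₃)` this says that
`(aₘb)ₙc` is a combination of products `aₚ(b_q c)`. -/
def HasIterateFormula (F : W → ℤ → ℤ → ℤ → W) : Prop :=
  ∀ m n : ℤ, (fun w => diag n (diag12 m (F w))) ∈ iterSpan F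

/-- The factor `x₁ - x₂` shifts the index of the inner product on the left side, and gives
elements of the same span on the right side. -/
theorem IsCollapsible.of_diff12 (h : IsCollapsible F)
    (hF : HasIterateFormula fun w => diff12 (F w)) : HasIterateFormula F := by
  have hle : iterSpan (fun w => diff12 (F w)) ≤ iterSpan F := by
    refine Submodule.span_le.mpr ?_
    rintro _ ⟨⟨p, q⟩, rfl⟩
    simp only [diag23_diff12 (h.mem23 _), map_sub, diag_diffEnd (h.diag23_mem _ _)]
    exact sub_mem (diag_diag23_mem_iterSpan F _ _) (diag_diag23_mem_iterSpan F _ _)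
  intro m n
  have := hle (hF (m - 1) n)
  simpa only [diag12_diff12 (h.mem12 _), sub_add_cancel] using this

/-- The factor `x₂ - x₃` shifts the index of the outer product on the left side, and gives
elements of the same span on the right side. -/
theorem IsCollapsible.of_diff23 (h : IsCollapsible F)
    (hF : HasIterateFormula fun w => diff23 (F w)) : HasIterateFormula F := by
  have hle : iterSpan (fun w => diff23 (F w)) ≤ iterSpan F := by
    refine Submodule.span_le.mpr ?_
    rintro _ ⟨⟨p, q⟩, rfl⟩
    simp only [diag23_diff23 (h.mem23 _)]
    exact diag_diag23_mem_iterSpan F _ _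
  intro m n
  have := hle (hF m (n - 1))
  simpa only [diag12_diff23 (h.mem12 _), diag_diffEnd (h.diag12_mem _ _), sub_add_cancel]
    using this

/-- On the left side `x₁ - x₃` becomes the sum of the shifts of the two indices, and the inner
product vanishes for large indices. -/
theorem IsCollapsible.of_diff13 (h : IsCollapsible F)
    (hF : HasIterateFormula fun w => diff13 (F w)) : HasIterateFormula F := by
  have hle : iterSpan (fun w => diff13 (F w)) ≤ iterSpan F := by
    refine Submodule.span_le.mpr ?_
    rintro _ ⟨⟨p, q⟩, rfl⟩
    simp only [diag23_diff13 (h.mem23 _), diag_diffEnd (h.diag23_mem _ _)]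
    exact diag_diag23_mem_iterSpan F _ _
  obtain ⟨k, hk⟩ := h.pole12
  -- Descending induction on the index of the inner product.
  have key : ∀ (d : ℕ) (m n : ℤ), k ≤ m + d →
      (fun w => diag n (diag12 m (F w))) ∈ iterSpan F := by
    intro d
    induction d with
    | zero =>
      intro m n hm
      have e : (fun w => diag n (diag12 m (F w))) = 0 := by
        funext w
        have e0 : diag12 m (F w) = 0 := by
          funext t r
          exact congrFun (diag_eq_zero (hk w r) (by simpa using hm)) t
        rw [e0, map_zero]
        rfl
      rw [e]
      exact zero_mem _
    | succ d ih =>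
      intro m n hm
      have h1 := hle (hF m (n - 1))
      simp only [diag12_diff13 (h.mem12 _), map_add, diag_diffEnd (h.diag12_mem _ _),
        sub_add_cancel] at h1
      have h2 := sub_mem h1 (ih (m + 1) (n - 1) (by push_cast at hm; omega))
      convert h2 using 1
      funext w
      simp only [Pi.sub_apply, add_sub_cancel_right]
  exact fun m n => key (k - m).toNat m n (by omega)

/-- For a series in `W((x₁, x₂, x₃))` all poles are at zero, and both orders of substitution give
`F(x + x₂ + x₀, x + x₂, x)`. -/
theorem hasIterateFormula_of_isLaurentThree (hF : ∀ w, IsLaurentThree (F w)) :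
    HasIterateFormula F := by
  intro m n
  rcases le_or_gt 0 m with hm | hm
  · convert zero_mem (iterSpan F) using 1
    funext w
    have e0 : diag12 m (F w) = 0 := by
      funext t r
      exact congrFun (diag_of_mem_laurentTwo ((hF w).slice12 r) hm) t
    rw [e0, map_zero]
    rfl
  · obtain ⟨i, rfl⟩ : ∃ i : ℕ, m = -i - 1 := ⟨(-m - 1).toNat, by omega⟩
    rcases le_or_gt 0 n with hn | hn
    · convert zero_mem (iterSpan F) using 1
      funext w
      exact diag_of_mem_laurentTwo ((hF w).diag12_mem i) hn
    · obtain ⟨j, rfl⟩ : ∃ j : ℕ, n = -j - 1 := ⟨(-n - 1).toNat, by omega⟩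
      have e : (fun w => diag (-j - 1) (diag12 (-i - 1) (F w))) =
          ∑ xy ∈ Finset.HasAntidiagonal.antidiagonal j, ((i + xy.1).choose i : ℤ) •
            fun w => diag (-(i + xy.1 : ℕ) - 1) (diag23 (-xy.2 - 1) (F w)) := by
        funext w t
        rw [(hF w).diag_diag12]
        simp only [Finset.sum_apply, Pi.smul_apply]
      rw [e]
      exact sum_mem fun xy _ => zsmul_mem (diag_diag23_mem_iterSpan F _ _) _

theorem IsCollapsible.of_pow {E : Module.End ℂ (ℤ → ℤ → ℤ → W)}
    (h1 : ∀ F : W → ℤ → ℤ → ℤ → W, IsCollapsible F → IsCollapsible fun w => E (F w))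
    (h2 : ∀ F : W → ℤ → ℤ → ℤ → W, IsCollapsible F →
      (HasIterateFormula fun w => E (F w)) → HasIterateFormula F) (k : ℕ)
    (h : IsCollapsible F) : (IsCollapsible fun w => (E ^ k) (F w)) ∧
      ((HasIterateFormula fun w => (E ^ k) (F w)) → HasIterateFormula F) := by
  induction k with
  | zero => exact ⟨h, id⟩
  | succ k ih =>
    simp only [pow_succ', Module.End.mul_apply]
    exact ⟨h1 _ ih.1, fun hF => ih.2 (h2 _ ih.1 hF)⟩

end IsCollapsible

theorem diag12_prodSeries₃ {a b : VertexOperator ℂ W} {k : ℕ} (h : Compat a b k)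
    (c : VertexOperator ℂ W) (n : ℤ) (w : W) :
    diag12 n (prodSeries₃ a b c w) = prodSeries (nthProd a n b) c w := by
  funext t r
  exact diag_prodSeries h n (coeff c r w) t

theorem diag23_prodSeries₃ (a : VertexOperator ℂ W) {b c : VertexOperator ℂ W} {k : ℕ}
    (h : Compat b c k) (n : ℤ) (w : W) :
    diag23 n (prodSeries₃ a b c w) = prodSeries a (nthProd b n c) w := by
  funext p t
  refine (diag_map (coeff a p) ⟨k, (compat_iff b c k).mp h w⟩ n t).trans ?_
  rw [diag_prodSeries h]
  rfl

theorem vertexOperator_ext {a b : VertexOperator ℂ W} (h : ∀ t w, coeff a t w = coeff b t w) :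
    a = b :=
  coeff_inj (funext fun t => LinearMap.ext fun w => h t w)

variable (W) in
/-- A vertex operator as the family of its coefficients. -/
def coeffFamily : VertexOperator ℂ W →ₗ[ℂ] (W → ℤ → W) where
  toFun a w t := coeff a t w
  map_add' a b := by
    funext w t
    rw [map_add]
    rfl
  map_smul' x a := by
    funext w t
    rw [map_smul]
    rfl

theorem coeffFamily_injective : Function.Injective (coeffFamily W) := fun _ _ h =>
  vertexOperator_ext fun t w => congrFun (congrFun h w) t

variable (W) in
/-- The families of series in `x₁, x₂, x₃` with finitely many negative powers of `x₁`. -/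
def truncFirst : Submodule ℂ (W → ℤ → ℤ → ℤ → W) where
  carrier := {F | ∀ w, ∃ N : ℤ, ∀ p < N, ∀ q r, F w p q r = 0}
  zero_mem' _ := ⟨0, fun _ _ _ _ => rfl⟩
  add_mem' := by
    intro F G hF hG w
    obtain ⟨N, hN⟩ := hF w
    obtain ⟨M, hM⟩ := hG w
    refine ⟨min N M, fun p hp q r => ?_⟩
    simp only [Pi.add_apply, hN p (by omega) q r, hM p (by omega) q r, add_zero]
  smul_mem' := by
    intro x F hF w
    obtain ⟨N, hN⟩ := hF w
    exact ⟨N, fun p hp q r => by simp only [Pi.smul_apply, hN p hp q r, smul_zero]⟩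

/-- Weak associativity of the products of fields: `(aₘb)ₙc` is a combination of products
`aₚ(b_q c)`.  The point is that `a(x₁) b(x₂) c(x₃) w` is taken into `W((x₁, x₂, x₃))` by a product
of powers of the differences of the variables, by moving `a(x₁)` to the right of the other fields
and `b(x₂)` to the right of `c(x₃)`. -/
theorem nthProd_nthProd_mem_span {A B C B' C' : Set (VertexOperator ℂ W)}
    {a b c : VertexOperator ℂ W} (hab : prodSeries a b ∈ reorderable A B)
    (hc : ∀ a' ∈ A, prodSeries a' c ∈ reorderable A C)
    (hbc : prodSeries b c ∈ reorderable B' C')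
    (hl : ∀ m, ∃ k, Compat (nthProd a m b) c k) (hr : ∀ q, ∃ k, Compat a (nthProd b q c) k)
    (m n : ℤ) : nthProd (nthProd a m b) n c ∈
      Submodule.span ℂ (Set.range fun pq : ℤ × ℤ => nthProd a pq.1 (nthProd b pq.2 c)) := by
  obtain ⟨k₁, hk₁⟩ := exists_compat hab
  obtain ⟨k₂, hk₂⟩ := exists_compat hbc
  have coll : IsCollapsible (prodSeries₃ a b c) := by
    refine ⟨⟨k₁, fun w r => (compat_iff a b k₁).mp hk₁ (coeff c r w)⟩, ⟨k₂, fun w p => ?_⟩,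
      fun m w => ?_, fun q w => ?_⟩
    · obtain ⟨N, hN⟩ := (compat_iff b c k₂).mp hk₂ w
      refine ⟨N, fun q r hqr => ?_⟩
      refine (congrFun (congrFun (diffEnd_pow_map (coeff a p) k₂ (prodSeries b c w)) q) r).trans ?_
      show coeff a p _ = 0
      rw [hN q r hqr, map_zero]
    · rw [diag12_prodSeries₃ hk₁]
      obtain ⟨k, hk⟩ := hl m
      exact ⟨k, (compat_iff _ _ k).mp hk w⟩
    · rw [diag23_prodSeries₃ a hk₂]
      obtain ⟨k, hk⟩ := hr q
      exact ⟨k, (compat_iff _ _ k).mp hk w⟩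
  have formula : HasIterateFormula (prodSeries₃ a b c) := by
    obtain ⟨j, k, hjk⟩ := reorder_first hab hc (truncFirst W)
      (fun F hF w => by
        obtain ⟨N, hN⟩ := hF w
        refine ⟨N, fun p hp q r => ?_⟩
        show diff13 (F w) p q r = 0
        rw [diff13_apply, hN p hp, hN (p - 1) (by omega), sub_zero])
      (fun g h b' _ c' _ a' _ w => by
        obtain ⟨N, hN⟩ := exists_coeff_eq_zero a' w
        refine ⟨N, fun p hp q r => isDiffAction12.act_eq_zero g fun p' hp' q' _ r' _ =>
          isDiffAction13.act_eq_zero h fun p'' hp'' q'' _ r'' _ => ?_⟩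
        rw [hN p'' (by omega), map_zero, map_zero])
    obtain ⟨l, hbl⟩ := hbc
    obtain ⟨coll1, f1⟩ := coll.of_pow (fun _ => IsCollapsible.mul_diff23)
      (fun _ => IsCollapsible.of_diff23) l
    obtain ⟨coll2, f2⟩ := coll1.of_pow (fun _ => IsCollapsible.mul_diff12)
      (fun _ => IsCollapsible.of_diff12) j
    obtain ⟨-, f3⟩ := coll2.of_pow (fun _ => IsCollapsible.mul_diff13)
      (fun _ => IsCollapsible.of_diff13) k
    refine f1 (f2 (f3 (hasIterateFormula_of_isLaurentThree fun w => ?_)))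
    have e : (diff13 ^ k) ((diff12 ^ j) ((diff23 ^ l) (prodSeries₃ a b c w))) =
        (diff23 ^ l) ((diff13 ^ k) ((diff12 ^ j) (prodSeries₃ a b c w))) := by
      have h1 := (commute_diff13_diff23 (W := W)).pow_pow k l
      have h2 := (commute_diff12_diff23 (W := W)).pow_pow j l
      exact LinearMap.congr_fun (h1.mul_left h2).eq (prodSeries₃ a b c w)
    obtain ⟨N₁, hN₁⟩ := hjk w
    obtain ⟨N₂, hN₂⟩ := oppSpan_bound hbl w
    obtain ⟨N₃, hN₃⟩ := exists_coeff_eq_zero c w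
    have second : ∀ p, ∀ q < N₂, ∀ r, (diff23 ^ l) (prodSeries₃ a b c w) p q r = 0 := by
      intro p q hq r
      rw [diff23_pow_apply]
      refine (congrFun (congrFun (diffEnd_pow_map (coeff a p) l (prodSeries b c w)) q) r).trans ?_
      show coeff a p _ = 0
      rw [hN₂ q hq r, map_zero]
    have third : ∀ p q, ∀ r < N₃, prodSeries₃ a b c w p q r = 0 := by
      intro p q r hlt
      rw [prodSeries₃, hN₃ r hlt, map_zero, map_zero]
    refine ⟨min N₁ (min N₂ N₃), fun p q r h => ?_⟩
    by_cases hp : p < N₁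
    · rw [e]
      exact isDiffAction23.pow_eq_zero _ _ _ _ _ fun p' hp' q' _ r' _ _ =>
        hN₁ p' (by omega) q' r'
    · refine isDiffAction13.pow_eq_zero _ _ _ _ _ fun p' hp' q' hq' r' hr' _ =>
        isDiffAction12.pow_eq_zero _ _ _ _ _ fun p'' hp'' q'' hq'' r'' hr'' _ => ?_
      by_cases hq : q < N₂
      · exact second p'' q'' (by omega) r''
      · exact isDiffAction23.pow_eq_zero _ _ _ _ _ fun p₃ _ q₃ _ r₃ hr₃ _ =>
          third p₃ q₃ r₃ (by omega)
  have h := formula m n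
  obtain ⟨k₃, hk₃⟩ := hl m
  have e1 : (fun w => diag n (diag12 m (prodSeries₃ a b c w))) =
      coeffFamily W (nthProd (nthProd a m b) n c) := by
    funext w t
    rw [diag12_prodSeries₃ hk₁, diag_prodSeries hk₃]
    rfl
  have e2 : iterSpan (prodSeries₃ a b c) ≤ (Submodule.span ℂ (Set.range fun pq : ℤ × ℤ =>
      nthProd a pq.1 (nthProd b pq.2 c))).map (coeffFamily W) := by
    refine Submodule.span_le.mpr ?_
    rintro _ ⟨⟨p, q⟩, rfl⟩
    obtain ⟨k, hk⟩ := hr q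
    refine ⟨nthProd a p (nthProd b q c), Submodule.subset_span ⟨(p, q), rfl⟩, ?_⟩
    funext w t
    dsimp only
    rw [diag23_prodSeries₃ a hk₂, diag_prodSeries hk]
    rfl
  rw [e1] at h
  obtain ⟨d, hd, hd'⟩ := e2 h
  rwa [← coeffFamily_injective hd']

/-! ### Products with the identity operator -/

theorem coeff_idOp (t : ℤ) (w : W) : coeff (idOp W) t w = if t = 0 then w else 0 := by
  have : coeff (idOp W) t w = (if t = 0 then LinearMap.id else 0 : Module.End ℂ W) w := rfl
  rw [this]
  split_ifs <;> rfl

theorem prodSeries_idOp_right_mem {A B : Set (VertexOperator ℂ W)} {a : VertexOperator ℂ W}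
    (ha : a ∈ A) (hB : idOp W ∈ B) : prodSeries a (idOp W) ∈ reorderable A B := by
  refine oppSpan_le_reorderable A B ?_
  convert act_oppProd_mem_oppSpan 1 hB ha using 1
  funext w
  rw [act_one (isIterated_oppProd _ _ w).isNil]
  funext p q
  simp only [prodSeries, oppProd, coeff_idOp]
  split_ifs
  · rfl
  · rw [map_zero]

theorem prodSeries_idOp_left_mem {A B : Set (VertexOperator ℂ W)} {b : VertexOperator ℂ W}
    (hA : idOp W ∈ A) (hb : b ∈ B) : prodSeries (idOp W) b ∈ reorderable A B := by
  refine oppSpan_le_reorderable A B ?_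
  convert act_oppProd_mem_oppSpan 1 hb hA using 1
  funext w
  rw [act_one (isIterated_oppProd _ _ w).isNil]
  funext p q
  simp only [prodSeries, oppProd, coeff_idOp]
  split_ifs
  · rfl
  · rw [map_zero]

theorem prodSeries_idOp_right_mem_laurentTwo (a : VertexOperator ℂ W) (w : W) :
    prodSeries a (idOp W) w ∈ laurentTwo W := by
  obtain ⟨N, hN⟩ := exists_coeff_eq_zero a w
  refine ⟨min N 0, fun p q h => ?_⟩
  rw [prodSeries, coeff_idOp]
  split_ifs with hq
  · exact hN p (by omega)
  · rw [map_zero]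

theorem prodSeries_idOp_left_mem_laurentTwo (b : VertexOperator ℂ W) (w : W) :
    prodSeries (idOp W) b w ∈ laurentTwo W := by
  obtain ⟨N, hN⟩ := exists_coeff_eq_zero b w
  refine ⟨min N 0, fun p q h => ?_⟩
  rw [prodSeries, coeff_idOp]
  split_ifs with hp
  · exact hN q (by omega)
  · rfl

theorem nthProd_neg_one_idOp (a : VertexOperator ℂ W) : nthProd a (-1) (idOp W) = a := by
  refine vertexOperator_ext fun t w => ?_
  have hL := prodSeries_idOp_right_mem_laurentTwo a w
  rw [← diag_prodSeries (k := 0) ((compat_iff _ _ 0).mpr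
    (prodSeries_idOp_right_mem_laurentTwo a))]
  have := diag_neg_of_mem_laurentTwo hL 0 t
  rw [show (-((0 : ℕ) : ℤ) - 1) = -1 by rfl] at this
  rw [this, finsum_eq_single _ t]
  · rw [prodSeries, coeff_idOp, if_pos (by push_cast; ring), Ring.choose_zero_right, one_smul]
  · intro p hp
    rw [prodSeries, coeff_idOp, if_neg (by push_cast; omega), map_zero, smul_zero]

theorem nthProd_idOp_left (n : ℤ) (b : VertexOperator ℂ W) :
    nthProd (idOp W) n b = if n = -1 then b else 0 := by
  refine vertexOperator_ext fun t w => ?_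
  have hL := prodSeries_idOp_left_mem_laurentTwo b w
  rw [← diag_prodSeries (k := 0) ((compat_iff _ _ 0).mpr
    (prodSeries_idOp_left_mem_laurentTwo b))]
  have hzero : coeff (0 : VertexOperator ℂ W) t w = 0 := by rw [map_zero]; rfl
  rcases le_or_gt 0 n with hn | hn
  · rw [diag_of_mem_laurentTwo hL hn, if_neg (by omega), hzero]
    rfl
  · obtain ⟨i, rfl⟩ : ∃ i : ℕ, n = -i - 1 := ⟨(-n - 1).toNat, by omega⟩
    rw [diag_neg_of_mem_laurentTwo hL, finsum_eq_single _ 0]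
    · rw [prodSeries, coeff_idOp, if_pos rfl]
      rcases Nat.eq_zero_or_pos i with rfl | hi
      · rw [Ring.choose_zero_right, one_smul, if_pos (by norm_num)]
        simp only [Nat.cast_zero, add_zero, sub_zero]
      · rw [Ring.choose_zero_pos ℤ hi, zero_smul, if_neg (by omega), hzero]
    · intro p hp
      rw [prodSeries, coeff_idOp, if_neg hp, smul_zero]

/-! ### The closed space generated by an `𝒮`-local set -/

/-- `a(x), b(x) ↦ a(x₁) b(x₂)` as a bilinear map. -/
def prodSeriesLin :
    VertexOperator ℂ W →ₗ[ℂ] VertexOperator ℂ W →ₗ[ℂ] (W → ℤ → ℤ → W) :=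
  LinearMap.mk₂ ℂ prodSeries
    (fun a a' b => by funext w p q; simp only [prodSeries, map_add, Pi.add_apply,
      LinearMap.add_apply])
    (fun x a b => by funext w p q; simp only [prodSeries, map_smul, Pi.smul_apply,
      LinearMap.smul_apply])
    (fun a b b' => by funext w p q; simp only [prodSeries, map_add, Pi.add_apply,
      LinearMap.add_apply])
    (fun x a b => by funext w p q; simp only [prodSeries, map_smul, Pi.smul_apply,
      LinearMap.smul_apply])

theorem nthProd_add_left {a a' b : VertexOperator ℂ W} {k k' : ℕ} (h : Compat a b k)
    (h' : Compat a' b k') (n : ℤ) : nthProd (a + a') n b = nthProd a n b + nthProd a' n b := by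
  have e : ∀ w, prodSeries (a + a') b w = prodSeries a b w + prodSeries a' b w := fun w =>
    congrFun (prodSeriesLin.map_add₂ a a' b) w
  have hs : Compat (a + a') b (max k k') := by
    rw [compat_iff] at h h' ⊢
    intro w
    rw [e, map_add]
    exact add_mem (diffEnd_pow_mem_laurentTwo (le_max_left _ _) (h w))
      (diffEnd_pow_mem_laurentTwo (le_max_right _ _) (h' w))
  refine vertexOperator_ext fun t w => ?_
  rw [← diag_prodSeries hs, e, map_add, map_add, Pi.add_apply, diag_prodSeries h,
    diag_prodSeries h']
  rfl

theorem nthProd_smul_left {a b : VertexOperator ℂ W} {k : ℕ} (h : Compat a b k) (x : ℂ)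
    (n : ℤ) : nthProd (x • a) n b = x • nthProd a n b := by
  have e : ∀ w, prodSeries (x • a) b w = x • prodSeries a b w := fun w =>
    congrFun (prodSeriesLin.map_smul₂ x a b) w
  have hs : Compat (x • a) b k := by
    rw [compat_iff] at h ⊢
    intro w
    rw [e, map_smul]
    exact Submodule.smul_mem _ x (h w)
  refine vertexOperator_ext fun t w => ?_
  rw [← diag_prodSeries hs, e, map_smul, map_smul, Pi.smul_apply, diag_prodSeries h]
  rfl

/-- The products `a¹_{n₁}(a²_{n₂}(⋯ aʳ_{nᵣ} 1))` of exactly `r` elements of `S`. -/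
def wordSet (S : Set (VertexOperator ℂ W)) : ℕ → Set (VertexOperator ℂ W)
  | 0 => {idOp W}
  | r + 1 => {c | ∃ a ∈ S, ∃ n : ℤ, ∃ b ∈ wordSet S r, c = nthProd a n b}

/-- Moving an element of `S` through a product of `r` elements of `S` gives products of the same
length; this makes the induction on `r` work. -/
theorem prodSeries_wordSet_mem {S : Set (VertexOperator ℂ W)}
    (hS : ∀ a ∈ S, ∀ b ∈ S, prodSeries a b ∈ reorderable S S) (r : ℕ) :
    ∀ a ∈ S, ∀ c ∈ wordSet S r, prodSeries a c ∈ reorderable S (wordSet S r) := by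
  induction r with
  | zero =>
    rintro a ha _ rfl
    exact prodSeries_idOp_right_mem ha rfl
  | succ r ih =>
    rintro a ha _ ⟨b, hb, n, c, hc, rfl⟩
    obtain ⟨m, hm⟩ := exists_compat (ih b hb c hc)
    exact prodSeries_nthProd_right_mem (K := wordSet S (r + 1)) (hS a ha b hb)
      (fun a' ha' => ih a' ha' c hc)
      (fun b' hb' c' hc' => exists_compat (ih b' hb' c' hc'))
      (fun b' hb' c' hc' n => ⟨b', hb', n, c', hc', rfl⟩) hm n

/-- `K` is the space spanned by the products `a¹_{n₁}(a²_{n₂}(⋯ aʳ_{nᵣ} 1))` of elements of an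
`𝒮`-local set `S`. -/
structure IsWordSpan (S : Set (VertexOperator ℂ W)) (K : Submodule ℂ (VertexOperator ℂ W)) :
    Prop where
  reorder : ∀ a ∈ S, ∀ b ∈ S, prodSeries a b ∈ reorderable S S
  idOp_mem : idOp W ∈ K
  nthProd_mem : ∀ a ∈ S, ∀ c ∈ K, ∀ n, nthProd a n c ∈ K
  le_span : K ≤ Submodule.span ℂ (⋃ r, wordSet S r)

section IsWordSpan

variable {S : Set (VertexOperator ℂ W)} {K : Submodule ℂ (VertexOperator ℂ W)}

theorem IsWordSpan.wordSet_subset (h : IsWordSpan S K) (r : ℕ) : wordSet S r ⊆ K := by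
  induction r with
  | zero => rintro _ rfl; exact h.idOp_mem
  | succ r ih =>
    rintro _ ⟨a, ha, n, b, hb, rfl⟩
    exact h.nthProd_mem a ha b (ih hb) n

theorem IsWordSpan.le_of_wordSet (h : IsWordSpan S K) {L : Submodule ℂ (VertexOperator ℂ W)}
    (hL : ∀ r, wordSet S r ⊆ L) : K ≤ L :=
  h.le_span.trans (Submodule.span_le.mpr (Set.iUnion_subset hL))

theorem IsWordSpan.prodSeries_mem_of_mem_set (h : IsWordSpan S K) {a c : VertexOperator ℂ W}
    (ha : a ∈ S) (hc : c ∈ K) : prodSeries a c ∈ reorderable S (K : Set _) := by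
  have key : K ≤ (reorderable S (K : Set _)).comap (prodSeriesLin a) :=
    h.le_of_wordSet fun r c hc => reorderable_mono subset_rfl (h.wordSet_subset r)
      (prodSeries_wordSet_mem h.reorder r a ha c hc)
  exact key hc

/-- Induction on the length of the left factor.  The fields to the right of it stay in `K`. -/
theorem IsWordSpan.prodSeries_mem (h : IsWordSpan S K) {b c : VertexOperator ℂ W}
    (hb : b ∈ K) (hc : c ∈ K) : prodSeries b c ∈ reorderable (K : Set _) (K : Set _) := by
  have key : K ≤ (reorderable (K : Set _) (K : Set _)).comap (prodSeriesLin.flip c) := by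
    refine h.le_of_wordSet fun r => ?_
    induction r with
    | zero =>
      rintro _ rfl
      exact prodSeries_idOp_left_mem h.idOp_mem hc
    | succ r ih =>
      rintro _ ⟨a, ha, n, b, hb, rfl⟩
      obtain ⟨m, hm⟩ := exists_compat
        (h.prodSeries_mem_of_mem_set ha (h.wordSet_subset r hb))
      exact prodSeries_nthProd_left_mem (ih hb)
        (fun c' hc' => h.prodSeries_mem_of_mem_set ha hc')
        (fun a' ha' b' hb' => exists_compat (h.prodSeries_mem_of_mem_set ha' hb'))
        (fun a' ha' b' hb' n => h.nthProd_mem a' ha' b' hb' n) hm n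
  exact key hb

/-- Induction on the length of the left factor: by weak associativity `(aₘ b)ₙ c` reduces to
products with the shorter word `b`. -/
theorem IsWordSpan.nthProd_mem_of_mem (h : IsWordSpan S K) {b c : VertexOperator ℂ W}
    (hb : b ∈ K) (hc : c ∈ K) (n : ℤ) : nthProd b n c ∈ K := by
  have hcompat : ∀ {b c}, b ∈ K → c ∈ K → ∃ k, Compat b c k := fun hb hc =>
    exists_compat (h.prodSeries_mem hb hc)
  let L : Submodule ℂ (VertexOperator ℂ W) :=
    { carrier := {b | b ∈ K ∧ ∀ c ∈ K, ∀ n, nthProd b n c ∈ K}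
      zero_mem' := by
        refine ⟨zero_mem K, fun c hc n => ?_⟩
        obtain ⟨k, hk⟩ := hcompat (zero_mem K) hc
        have := nthProd_smul_left hk 0 n
        rw [zero_smul, zero_smul] at this
        rw [this]
        exact zero_mem K
      add_mem' := by
        rintro b b' ⟨hb, hb1⟩ ⟨hb', hb1'⟩
        refine ⟨add_mem hb hb', fun c hc n => ?_⟩
        obtain ⟨k, hk⟩ := hcompat hb hc
        obtain ⟨k', hk'⟩ := hcompat hb' hc
        rw [nthProd_add_left hk hk']
        exact add_mem (hb1 c hc n) (hb1' c hc n)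
      smul_mem' := by
        rintro x b ⟨hb, hb1⟩
        refine ⟨Submodule.smul_mem K x hb, fun c hc n => ?_⟩
        obtain ⟨k, hk⟩ := hcompat hb hc
        rw [nthProd_smul_left hk]
        exact Submodule.smul_mem K x (hb1 c hc n) }
  have key : K ≤ L := by
    refine h.le_of_wordSet fun r => ?_
    induction r with
    | zero =>
      rintro _ rfl
      refine ⟨h.idOp_mem, fun c hc n => ?_⟩
      rw [nthProd_idOp_left]
      split_ifs
      · exact hc
      · exact zero_mem K
    | succ r ih =>
      rintro _ ⟨a, ha, m, b, hb, rfl⟩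
      have hbK : b ∈ K := h.wordSet_subset r hb
      have hab : ∀ m, nthProd a m b ∈ K := h.nthProd_mem a ha b hbK
      refine ⟨hab m, fun c hc n => ?_⟩
      have hbc : ∀ q, nthProd b q c ∈ K := (ih hb).2 c hc
      refine Submodule.span_le.mpr ?_ (nthProd_nthProd_mem_span
        (h.prodSeries_mem_of_mem_set ha hbK) (fun a' ha' => h.prodSeries_mem_of_mem_set ha' hc)
        (h.prodSeries_mem hbK hc) (fun m => hcompat (hab m) hc)
        (fun q => exists_compat (h.prodSeries_mem_of_mem_set ha (hbc q))) m n)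
      rintro _ ⟨⟨p, q⟩, rfl⟩
      exact h.nthProd_mem a ha _ (hbc q) p
  exact (key hb).2 c hc n

end IsWordSpan

/-! ### Expansions of powers of `x₁ - x₂` -/

section Expansion

variable {X : Type*} [AddCommGroup X]

/-- The product `(x₁ - x₂) ^ l * F(x₁, x₂)`, where `(x₁ - x₂) ^ l` is expanded in nonnegative
powers of `x₂`.  It is meaningful if the powers of `x₂` in `F` are bounded below. -/
def expand (l : ℤ) (F : ℤ → ℤ → W) : ℤ → ℤ → W :=
  fun p q => ∑ᶠ j : ℕ, ((-1) ^ j * Ring.choose l j : ℤ) • F (p - (l - j)) (q - j)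

theorem expand_apply (l : ℤ) {F : ℤ → ℤ → X} {N : ℤ} (hN : ∀ p, ∀ q < N, F p q = 0) (p q : ℤ)
    {n : ℕ} (hn : q - N < n) :
    expand l F p q =
      ∑ j ∈ Finset.range n, ((-1) ^ j * Ring.choose l j : ℤ) • F (p - (l - j)) (q - j) := by
  refine finsum_eq_sum_of_support_subset _ fun j hj => ?_
  by_contra hlt
  refine hj ?_
  dsimp only
  rw [hN _ _ (by simp only [Finset.coe_range, Set.mem_Iio] at hlt; omega), smul_zero]

theorem expand_apply_eq_zero (l : ℤ) {F : ℤ → ℤ → X} {N : ℤ} (hN : ∀ p, ∀ q < N, F p q = 0)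
    (p : ℤ) {q : ℤ} (hq : q < N) : expand l F p q = 0 :=
  expand_apply l hN p q (n := 0) (by push_cast; omega)

theorem expand_finite (l : ℤ) {F : ℤ → ℤ → X} {N : ℤ} (hN : ∀ p, ∀ q < N, F p q = 0) (p q : ℤ) :
    (Function.support fun j : ℕ =>
      ((-1) ^ j * Ring.choose l j : ℤ) • F (p - (l - j)) (q - j)).Finite := by
  refine (Set.finite_Iio (q - N + 1).toNat).subset fun j hj => ?_
  by_contra hlt
  refine hj ?_
  dsimp only
  rw [hN _ _ (by simp only [Set.mem_Iio] at hlt; omega), smul_zero]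

theorem expand_zero {F : ℤ → ℤ → X} : expand 0 F = F := by
  funext p q
  unfold expand
  rw [finsum_eq_single _ 0]
  · simp
  · intro j hj
    rw [Ring.choose_zero_pos ℤ (Nat.pos_of_ne_zero hj), mul_zero, zero_smul]

theorem expand_diffEnd (l : ℤ) {F : ℤ → ℤ → W} {N : ℤ} (hN : ∀ p, ∀ q < N, F p q = 0) :
    expand l (diffEnd F) = expand (l + 1) F := by
  have hN' : ∀ p, ∀ q < N, diffEnd F p q = 0 := fun p q hq => by
    rw [diffEnd_apply, hN _ _ hq, hN _ _ (by omega), sub_zero]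
  funext p q
  set n := (q - N + 1).toNat with hn
  rw [expand_apply l hN' p q (n := n) (by omega),
    expand_apply (l + 1) hN p q (n := n + 1) (by omega), Finset.sum_range_succ']
  have e : ∀ j ∈ Finset.range n,
      ((-1) ^ (j + 1) * Ring.choose (l + 1) (j + 1) : ℤ) •
        F (p - (l + 1 - ((j + 1 : ℕ) : ℤ))) (q - ((j + 1 : ℕ) : ℤ)) =
      ((-1) ^ (j + 1) * Ring.choose l (j + 1) : ℤ) •
        F (p - (l + 1 - ((j + 1 : ℕ) : ℤ))) (q - ((j + 1 : ℕ) : ℤ)) -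
      ((-1) ^ j * Ring.choose l j : ℤ) • F (p - (l - j)) (q - j - 1) := by
    intro j _
    rw [Ring.choose_succ_succ,
      show p - (l + 1 - ((j + 1 : ℕ) : ℤ)) = p - (l - j) by push_cast; ring,
      show q - ((j + 1 : ℕ) : ℤ) = q - j - 1 by push_cast; ring, ← sub_smul]
    congr 1
    ring
  rw [Finset.sum_congr rfl e, Finset.sum_sub_distrib, sub_add_eq_add_sub]
  have h0 : Ring.choose (l + 1) 0 = Ring.choose l 0 := by
    rw [Ring.choose_zero_right, Ring.choose_zero_right]
  have e2 := Finset.sum_range_succ' (fun j : ℕ => ((-1) ^ j * Ring.choose l j : ℤ) •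
    F (p - (l + 1 - (j : ℤ))) (q - (j : ℤ))) n
  rw [h0, ← e2, Finset.sum_range_succ,
    hN _ (q - n) (by omega), smul_zero, add_zero, ← Finset.sum_sub_distrib]
  refine Finset.sum_congr rfl fun j _ => ?_
  rw [diffEnd_apply, smul_sub, show p - (l - j) - 1 = p - (l + 1 - (j : ℤ)) by ring]

theorem diffEnd_pow_bound {F : ℤ → ℤ → W} {N : ℤ} (hN : ∀ p, ∀ q < N, F p q = 0) (k : ℕ) :
    ∀ p, ∀ q < N, (diffEnd ^ k) F p q = 0 := fun _ _ hq =>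
  diffEnd_pow_apply_eq_zero k fun _ _ q' hq' _ => hN _ _ (by omega)

theorem expand_diffEnd_pow (l : ℤ) {F : ℤ → ℤ → W} {N : ℤ} (hN : ∀ p, ∀ q < N, F p q = 0)
    (k : ℕ) : expand l ((diffEnd ^ k) F) = expand (l + k) F := by
  induction k generalizing l with
  | zero => simp
  | succ k ih =>
    rw [pow_succ', Module.End.mul_apply, expand_diffEnd l (diffEnd_pow_bound hN k), ih]
    congr 1
    push_cast
    ring

theorem expand_natCast (k : ℕ) {F : ℤ → ℤ → W} {N : ℤ} (hN : ∀ p, ∀ q < N, F p q = 0) :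
    expand k F = (diffEnd ^ k) F := by
  rw [← expand_zero (F := (diffEnd ^ k) F), expand_diffEnd_pow 0 hN, zero_add]

theorem diffEnd_expand (l : ℤ) {F : ℤ → ℤ → W} {N : ℤ} (hN : ∀ p, ∀ q < N, F p q = 0) :
    diffEnd (expand l F) = expand (l + 1) F := by
  rw [← expand_diffEnd l hN]
  funext p q
  have f1 := expand_finite l (F := fun p q => F (p - 1) q) (N := N) (fun p q hq => hN _ _ hq) p q
  have f2 := expand_finite l (F := fun p q => F p (q - 1)) (N := N)
    (fun p q hq => hN _ _ (by omega)) p q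
  rw [diffEnd_apply]
  have e1 : expand l F (p - 1) q = expand l (fun p q => F (p - 1) q) p q :=
    finsum_congr fun j => by rw [show p - 1 - (l - (j : ℤ)) = p - (l - j) - 1 by ring]
  have e2 : expand l F p (q - 1) = expand l (fun p q => F p (q - 1)) p q :=
    finsum_congr fun j => by rw [show q - 1 - (j : ℤ) = q - j - 1 by ring]
  rw [e1, e2]
  unfold expand
  rw [← finsum_sub_distrib f1 f2]
  exact finsum_congr fun j => (smul_sub _ _ _).symm

theorem diffEnd_swap (F : ℤ → ℤ → W) :
    diffEnd (Function.swap F) = -Function.swap (diffEnd F) := by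
  funext p q
  simp only [Pi.neg_apply, Function.swap, diffEnd_apply]
  abel

theorem diffEnd_pow_swap (k : ℕ) (F : ℤ → ℤ → W) :
    (diffEnd ^ k) (Function.swap F) = (-1 : ℂ) ^ k • Function.swap ((diffEnd ^ k) F) := by
  induction k with
  | zero => simp
  | succ k ih =>
    rw [pow_succ', Module.End.mul_apply, ih, map_smul, diffEnd_swap, ← Module.End.mul_apply,
      pow_succ', mul_smul, neg_one_smul]
    exact smul_neg _ _

/-- The product `(x₁ - x₂) ^ l * F(x₁, x₂)`, where `(x₁ - x₂) ^ l` is expanded in nonnegative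
powers of `x₁`.  It is meaningful if the powers of `x₁` in `F` are bounded below. -/
def expandSnd (l : ℤ) (F : ℤ → ℤ → W) : ℤ → ℤ → W :=
  (Int.negOnePow l : ℤ) • Function.swap (expand l (Function.swap F))

theorem swap_bound {F : ℤ → ℤ → X} {N : ℤ} (hN : ∀ p < N, ∀ q, F p q = 0) :
    ∀ p, ∀ q < N, Function.swap F p q = 0 := fun p q hq => hN q hq p

theorem expandSnd_apply_eq_zero (l : ℤ) {F : ℤ → ℤ → X} {N : ℤ} (hN : ∀ p < N, ∀ q, F p q = 0)
    {p : ℤ} (hp : p < N) (q : ℤ) : expandSnd l F p q = 0 := by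
  have e : expandSnd l F p q = (Int.negOnePow l : ℤ) • expand l (Function.swap F) q p := rfl
  rw [e, expand_apply_eq_zero l (swap_bound hN) q hp, smul_zero]

theorem expandSnd_zero {F : ℤ → ℤ → X} : expandSnd 0 F = F := by
  unfold expandSnd
  rw [expand_zero, Int.negOnePow_zero]
  exact one_smul _ _

theorem diffEnd_expandSnd (l : ℤ) {F : ℤ → ℤ → W} {N : ℤ} (hN : ∀ p < N, ∀ q, F p q = 0) :
    diffEnd (expandSnd l F) = expandSnd (l + 1) F := by
  unfold expandSnd
  rw [map_zsmul, diffEnd_swap, diffEnd_expand l (swap_bound hN), Int.negOnePow_succ, smul_neg,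
    Units.val_neg, neg_smul]

theorem diffEnd_pow_expandSnd (l : ℤ) {F : ℤ → ℤ → W} {N : ℤ} (hN : ∀ p < N, ∀ q, F p q = 0)
    (k : ℕ) : (diffEnd ^ k) (expandSnd l F) = expandSnd (l + k) F := by
  induction k with
  | zero => simp
  | succ k ih =>
    rw [pow_succ', Module.End.mul_apply, ih, diffEnd_expandSnd _ hN]
    congr 1
    push_cast
    ring

/-- A sequence with `X (l + 1) = (x₁ - x₂) X l` whose members have bounded below powers of `x₁` is
determined by any one of its members. -/
theorem eq_expandSnd {X : ℤ → ℤ → ℤ → W} {N : ℤ} (hN : ∀ l, ∀ p < N, ∀ q, X l p q = 0)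
    (hX : ∀ l, diffEnd (X l) = X (l + 1)) (k l : ℤ) : X l = expandSnd (l - k) (X k) := by
  have hpow : ∀ l, ∀ n : ℕ, (diffEnd ^ n) (X l) = X (l + n) := by
    intro l n
    induction n with
    | zero => simp
    | succ n ih =>
      rw [pow_succ', Module.End.mul_apply, ih, hX]
      congr 1
      push_cast
      ring
  rcases le_total k l with h | h
  · obtain ⟨n, rfl⟩ := Int.le.dest h
    rw [← hpow, add_sub_cancel_left]
    have := diffEnd_pow_expandSnd 0 (hN k) n
    rwa [expandSnd_zero, zero_add] at this
  · obtain ⟨n, rfl⟩ := Int.le.dest h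
    refine sub_eq_zero.mp (eq_zero_of_diffEnd_pow_eq_zero_left (N := N) (fun p hp => ?_) n ?_)
    · funext q
      rw [Pi.sub_apply, Pi.sub_apply, hN _ p hp, expandSnd_apply_eq_zero _ (hN _) hp, sub_zero]
      rfl
    · rw [map_sub, hpow, diffEnd_pow_expandSnd _ (hN _), sub_eq_zero]
      rw [show l - (l + (n : ℤ)) + n = 0 by ring, expandSnd_zero]

end Expansion

/-! ### The residue of the expansions -/

theorem negOnePow_natCast (n : ℕ) : ((Int.negOnePow n : ℤˣ) : ℤ) = (-1) ^ n := by
  rw [Int.negOnePow_def, zpow_natCast, Units.val_pow_eq_pow_val, Units.val_neg, Units.val_one]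

theorem choose_neg_eq (r : ℤ) (n : ℕ) :
    Ring.choose (-r) n = (-1) ^ n * Ring.choose (r + n - 1) n := by
  rw [Ring.choose_neg, Units.smul_def, negOnePow_natCast, smul_eq_mul]

theorem choose_add_eq (i j : ℕ) :
    Ring.choose ((i : ℤ) + j) i = (-1) ^ j * Ring.choose (-(i : ℤ) - 1) j := by
  have h := choose_neg_eq ((i : ℤ) + 1) j
  rw [show -((i : ℤ) + 1) = -(i : ℤ) - 1 by ring, show (i : ℤ) + 1 + j - 1 = ((i + j : ℕ) : ℤ) by
    push_cast; ring] at h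
  rw [h, ← Nat.cast_add, Ring.choose_natCast, Ring.choose_natCast, Nat.choose_symm_add,
    ← mul_assoc, ← mul_pow, neg_one_mul, neg_neg, one_pow, one_mul]

theorem choose_neg_sub_eq (i j : ℕ) :
    Ring.choose (-1 - (j : ℤ)) i = (-1) ^ i * ((-1) ^ j * Ring.choose (-(i : ℤ) - 1) j) := by
  rw [← choose_add_eq, show -1 - (j : ℤ) = -((j : ℤ) + 1) by ring, choose_neg_eq]
  congr 2
  ring

/-- The residue in `x₁` of the difference of the two expansions of `(x₁ - x₂) ^ l * G(x₁, x₂)` is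
the coefficient of `x₀ ^ (-l-1)` in `G(x₂ + x₀, x₂)`, because that difference is a derivative of
the delta function of `x₁ / x₂`. -/
theorem residue_expand_sub {G : ℤ → ℤ → W} (hG : G ∈ laurentTwo W) (l t : ℤ) :
    expand l G (-1) t - expandSnd l G (-1) t = diag l G t := by
  obtain ⟨N, hN⟩ := id hG
  have h1 : ∀ p, ∀ q < N, G p q = 0 := fun p q hq => hN p q (Or.inr hq)
  have h2 : ∀ p < N, ∀ q, G p q = 0 := fun p hp q => hN p q (Or.inl hp)
  rcases le_or_gt 0 l with hl | hl
  · lift l to ℕ using hl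
    have e := diffEnd_pow_expandSnd 0 h2 l
    rw [expandSnd_zero, zero_add] at e
    rw [diag_of_mem_laurentTwo hG (Int.natCast_nonneg l), expand_natCast l h1, ← e, sub_self]
    rfl
  obtain ⟨i, rfl⟩ : ∃ i : ℕ, l = -i - 1 := ⟨(-l - 1).toNat, by omega⟩
  set h : ℤ → W := fun p => (Ring.choose p i : ℤ) • G p (t + i - p) with hh
  have hfin : (Function.support h).Finite :=
    IsLaurentTwo.finite hG (fun p => Ring.choose p i) (t + i)
  -- The two expansions are the parts of the sum over `p` with `i ≤ p` and with `p < 0`.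
  have e1 : expand (-i - 1) G (-1) t = ∑ᶠ j : ℕ, h (i + j) := by
    refine finsum_congr fun j => ?_
    rw [hh]
    dsimp only
    rw [choose_add_eq, show (-1 : ℤ) - (-i - 1 - j) = i + j by ring,
      show t + i - (i + (j : ℤ)) = t - j by ring]
  have e2 : expandSnd (-i - 1) G (-1) t = -∑ᶠ j : ℕ, h (-1 - j) := by
    have e : expandSnd (-i - 1) G (-1) t =
        (Int.negOnePow (-i - 1) : ℤ) • expand (-i - 1) (Function.swap G) t (-1) := rfl
    have hs : (Int.negOnePow (-i - 1) : ℤ) = -(-1) ^ i := by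
      rw [Int.negOnePow_sub, Int.negOnePow_neg, Int.negOnePow_one, mul_neg_one, Units.val_neg,
        negOnePow_natCast]
    rw [e, hs, neg_smul, expand, smul_finsum' _ (expand_finite _ (swap_bound h2) _ _)]
    congr 1
    refine finsum_congr fun j => ?_
    rw [hh]
    dsimp only
    rw [choose_neg_sub_eq, smul_smul, Function.swap,
      show t + (i : ℤ) - (-1 - (j : ℤ)) = t - (-i - 1 - j) by ring]
  rw [e1, e2, sub_neg_eq_add, diag_neg_of_mem_laurentTwo hG]
  have i1 : Function.Injective fun j : ℕ => (i : ℤ) + j := fun a b hab => by simpa using hab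
  have i2 : Function.Injective fun j : ℕ => (-1 : ℤ) - j := fun a b hab => by simpa using hab
  rw [← finsum_mem_range (f := h) i1, ← finsum_mem_range (f := h) i2,
    ← finsum_mem_union' ?_ (hfin.subset Set.inter_subset_right)
      (hfin.subset Set.inter_subset_right), ← finsum_mem_univ h]
  · refine finsum_mem_inter_support_eq _ _ _ (Set.ext fun p => ?_)
    simp only [Set.mem_inter_iff, Set.mem_union, Set.mem_range, Set.mem_univ, true_and,
      Function.mem_support, and_iff_right_iff_imp]
    intro hp
    by_contra hcon
    push Not at hcon
    have hp0 : 0 ≤ p := by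
      by_contra hlt
      exact hcon.2 (-1 - p).toNat (by omega)
    have hpi : p < i := by
      by_contra hlt
      exact hcon.1 (p - i).toNat (by omega)
    lift p to ℕ using hp0
    refine hp ?_
    rw [hh]
    dsimp only
    rw [Ring.choose_natCast, Nat.choose_eq_zero_of_lt (by omega), Nat.cast_zero, zero_smul]
  · rw [Set.disjoint_left]
    rintro _ ⟨a, rfl⟩ ⟨b, hb⟩
    dsimp only at hb
    omega

/-! ### The opposite product of two fields -/

theorem oppSeries_term (l : ℤ) (f : LaurentSeries ℂ) (b a : VertexOperator ℂ W) (w : W)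
    (p q s : ℤ) : ∑ᶠ j : ℕ, (f.coeff s * ((-1) ^ j * (Ring.choose (l + s) j : ℤ))) •
        coeff b (q - (l + s) + j) (coeff a (p - j) w) =
      f.coeff s • expand (l + s) (Function.swap (oppProd b a w)) q p := by
  obtain ⟨N, hN⟩ := exists_coeff_eq_zero a w
  have hb : ∀ x, ∀ y < N, Function.swap (oppProd b a w) x y = 0 := fun x y hy => by
    rw [Function.swap, oppProd, hN y hy, map_zero]
  rw [expand, smul_finsum' _ (expand_finite _ hb _ _)]
  refine finsum_congr fun j => ?_
  rw [mul_smul, Function.swap, oppProd, show q - (l + s - (j : ℤ)) = q - (l + s) + j by ring,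
    ← Int.cast_smul_eq_zsmul ℂ]
  push_cast
  rfl

theorem oppSeries_apply (l : ℤ) (f : LaurentSeries ℂ) (b a : VertexOperator ℂ W) (w : W)
    (p q : ℤ) : oppSeries l f b a w p q =
      ∑ᶠ s : ℤ, f.coeff s • expand (l + s) (Function.swap (oppProd b a w)) q p := by
  rw [oppSeries, finsum_curry _ (oppSeries_finite l f b a w p q)]
  exact finsum_congr fun s => oppSeries_term l f b a w p q s

theorem oppSeries_apply_finite (l : ℤ) (f : LaurentSeries ℂ) (b a : VertexOperator ℂ W) (w : W)
    (p q : ℤ) : (Function.support fun s : ℤ =>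
      f.coeff s • expand (l + s) (Function.swap (oppProd b a w)) q p).Finite := by
  refine ((oppSeries_finite l f b a w p q).image Prod.fst).subset fun s hs => ?_
  rw [Function.mem_support, ← oppSeries_term] at hs
  by_contra hcon
  refine hs (finsum_eq_zero_of_forall_eq_zero fun j => ?_)
  by_contra hj
  exact hcon ⟨(s, j), hj, rfl⟩

theorem oppSeries_apply_eq_zero (l : ℤ) (f : LaurentSeries ℂ) (b : VertexOperator ℂ W)
    {a : VertexOperator ℂ W} {w : W} {N : ℤ} (hN : ∀ p < N, coeff a p w = 0) {p : ℤ} (hp : p < N)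
    (q : ℤ) : oppSeries l f b a w p q = 0 :=
  finsum_eq_zero_of_forall_eq_zero fun i => by rw [hN _ (by omega), map_zero, smul_zero]

theorem diffEnd_oppSeries (l : ℤ) (f : LaurentSeries ℂ) (b a : VertexOperator ℂ W) (w : W) :
    diffEnd (oppSeries l f b a w) = -oppSeries (l + 1) f b a w := by
  obtain ⟨N, hN⟩ := exists_coeff_eq_zero a w
  have hb : ∀ x, ∀ y < N, Function.swap (oppProd b a w) x y = 0 := fun x y hy => by
    rw [Function.swap, oppProd, hN y hy, map_zero]
  funext p q
  rw [diffEnd_apply, Pi.neg_apply, Pi.neg_apply, oppSeries_apply, oppSeries_apply,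
    oppSeries_apply, ← finsum_sub_distrib (oppSeries_apply_finite l f b a w _ _)
      (oppSeries_apply_finite l f b a w _ _), ← finsum_neg_distrib]
  refine finsum_congr fun s => ?_
  rw [show l + 1 + s = l + s + 1 by ring, ← diffEnd_expand _ hb, diffEnd_apply, ← smul_sub,
    ← smul_neg, neg_sub]

theorem diffEnd_jacobiSecond (f : LaurentSeries ℂ) (b a : VertexOperator ℂ W) (w : W) (l : ℤ) :
    diffEnd (jacobiSecond f b a w l) = jacobiSecond f b a w (l + 1) := by
  have e : ∀ l, jacobiSecond f b a w l = (Int.negOnePow l : ℤ) • oppSeries l f b a w :=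
    fun _ => rfl
  rw [e, e, map_zsmul, diffEnd_oppSeries, Int.negOnePow_succ, smul_neg, Units.val_neg, neg_smul]

theorem diffEnd_pow_eq_of_diffEnd {X : ℤ → ℤ → ℤ → W} (hX : ∀ l, diffEnd (X l) = X (l + 1))
    (l : ℤ) (n : ℕ) : (diffEnd ^ n) (X l) = X (l + n) := by
  induction n with
  | zero => simp
  | succ n ih =>
    rw [pow_succ', Module.End.mul_apply, ih, hX]
    congr 1
    push_cast
    ring

/-- If `(x₂ - x₁) ^ l * f(x₂ - x₁)` is a power series, its product with `b(x₂) a(x₁)` involves no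
expansion. -/
theorem oppSeries_eq_act {l : ℤ} {f : LaurentSeries ℂ} (hf : ∀ s, l + s < 0 → f.coeff s = 0)
    (b a : VertexOperator ℂ W) (w : W) : oppSeries l f b a w =
      act (PowerSeries.mk fun m : ℕ => (-1) ^ m * f.coeff (m - l)) (oppProd b a w) := by
  obtain ⟨N, hN⟩ := exists_coeff_eq_zero a w
  have hb : ∀ x, ∀ y < N, Function.swap (oppProd b a w) x y = 0 := fun x y hy => by
    rw [Function.swap, oppProd, hN y hy, map_zero]
  funext p q
  obtain ⟨n, hn⟩ := (isIterated_oppProd b a w).isNil p q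
  have e : ∀ m : ℕ, expand (l + ((m : ℤ) - l)) (Function.swap (oppProd b a w)) q p =
      (-1 : ℂ) ^ m • (diffEnd ^ m) (oppProd b a w) p q := fun m => by
    rw [add_sub_cancel, expand_natCast m hb, diffEnd_pow_swap]
    rfl
  rw [act_apply _ hn, oppSeries_apply, finsum_eq_sum_of_support_subset
    (s := (Finset.range n).image fun m : ℕ => (m : ℤ) - l), Finset.sum_image]
  · refine Finset.sum_congr rfl fun m _ => ?_
    rw [e, PowerSeries.coeff_mk, smul_smul, mul_comm]
  · intro x _ y _ hxy
    simpa using hxy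
  · intro s hs
    rw [Function.mem_support] at hs
    have h0 : 0 ≤ l + s := by
      by_contra hlt
      exact hs (by rw [hf s (by omega), zero_smul])
    obtain ⟨m, hm⟩ := Int.eq_ofNat_of_zero_le h0
    obtain rfl : s = (m : ℤ) - l := by omega
    refine Finset.mem_coe.mpr (Finset.mem_image_of_mem _ (Finset.mem_range.mpr ?_))
    by_contra hlt
    exact hs (by rw [e, hn m (by omega), smul_zero, smul_zero])

/-- The field pair `a, b` satisfies the relation of `𝒮`-locality with the data `fᵢ, bᵢ, aᵢ` and
the exponent `k`. -/
def HasReordering (k : ℕ) (a b : VertexOperator ℂ W) {r : ℕ} (f : Fin r → LaurentSeries ℂ)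
    (b' a' : Fin r → VertexOperator ℂ W) : Prop :=
  ∀ w, (diffEnd ^ k) (prodSeries a b w) = ∑ i, jacobiSecond (f i) (b' i) (a' i) w k

/-- A power of `x₁ - x₂` that exceeds the orders of the poles of all `fᵢ` turns them into power
series. -/
theorem IsSLocal.mem_reorderable {S : Set (VertexOperator ℂ W)} (hS : IsSLocal S) :
    ∀ a ∈ S, ∀ b ∈ S, prodSeries a b ∈ reorderable S S := by
  intro a ha b hb
  obtain ⟨r, f, b', a', hmem, k, h⟩ := hS a ha b hb
  obtain ⟨m, hm⟩ : ∃ m : ℕ, ∀ i, -(m : ℤ) ≤ (f i).order := by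
    obtain ⟨M, hM⟩ := (Set.finite_range fun i => (f i).order).bddBelow
    exact ⟨(-M).toNat, fun i => le_trans (by omega) (hM ⟨i, rfl⟩)⟩
  refine ⟨m + k, ?_⟩
  have e : (fun w => (diffEnd ^ (m + k)) (prodSeries a b w)) = ∑ i, (-1 : ℂ) ^ (m + k) •
      fun w => act (PowerSeries.mk fun n : ℕ => (-1) ^ n * (f i).coeff (n - ((m + k : ℕ) : ℤ)))
        (oppProd (b' i) (a' i) w) := by
    funext w
    have e1 : (diffEnd ^ k) (prodSeries a b w) =
        (diffEnd ^ k) (∑ i, jacobiSecond (f i) (b' i) (a' i) w 0) := by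
      rw [diffEnd_pow_apply, h w, diffEnd_pow_apply]
      congr 1
      funext p q
      rw [Finset.sum_apply, Finset.sum_apply]
      exact Finset.sum_congr rfl fun i _ => by
        rw [jacobiSecond, Int.negOnePow_zero, Units.val_one, one_smul]
    rw [pow_add, Module.End.mul_apply, e1, ← Module.End.mul_apply, ← pow_add, map_sum,
      Finset.sum_apply]
    refine Finset.sum_congr rfl fun i _ => ?_
    rw [diffEnd_pow_eq_of_diffEnd (diffEnd_jacobiSecond _ _ _ w), zero_add, Pi.smul_apply]
    have e2 : jacobiSecond (f i) (b' i) (a' i) w ((m + k : ℕ) : ℤ) =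
      (Int.negOnePow ((m + k : ℕ) : ℤ) : ℤ) • oppSeries ((m + k : ℕ) : ℤ) (f i) (b' i) (a' i) w :=
      rfl
    rw [e2, oppSeries_eq_act, negOnePow_natCast, ← Int.cast_smul_eq_zsmul ℂ]
    · push_cast
      rfl
    · intro s hs
      exact HahnSeries.coeff_eq_zero_of_lt_order (lt_of_lt_of_le (by push_cast at hs; omega) (hm i))
  rw [e]
  exact Submodule.sum_mem _ fun i _ => Submodule.smul_mem _ _
    (act_oppProd_mem_oppSpan _ (hmem i).1 (hmem i).2)

/-- The power series in `x₁ - x₂` of a reordering, divided by `(x₁ - x₂) ^ k` and written in terms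
of `x₂ - x₁`, are the Laurent series `fᵢ`. -/
theorem exists_hasReordering {A B : Set (VertexOperator ℂ W)} {a b : VertexOperator ℂ W}
    (h : prodSeries a b ∈ reorderable A B) :
    ∃ (k r : ℕ) (f : Fin r → LaurentSeries ℂ) (b' a' : Fin r → VertexOperator ℂ W),
      (∀ i, b' i ∈ B ∧ a' i ∈ A) ∧ HasReordering k a b f b' a' := by
  obtain ⟨k, hk⟩ := h
  obtain ⟨r, c, x, hx⟩ := Submodule.mem_span_set'.mp hk
  choose g b' hb' a' ha' hg using fun i => (x i).2
  let F : Fin r → ℤ → ℂ := fun i s =>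
    if 0 ≤ (k : ℤ) + s then (-1) ^ k * ((-1) ^ ((k : ℤ) + s).toNat *
      (c i * PowerSeries.coeff ((k : ℤ) + s).toNat (g i))) else 0
  have hF : ∀ i, BddBelow (Function.support (F i)) := fun i => ⟨-k, fun s hs => by
    by_contra hlt
    exact hs (if_neg (by omega))⟩
  refine ⟨k, r, fun i => HahnSeries.ofSuppBddBelow (F i) (hF i), b', a',
    fun i => ⟨hb' i, ha' i⟩, fun w => ?_⟩
  have e := congrFun hx w
  rw [← e, Finset.sum_apply]
  refine Finset.sum_congr rfl fun i _ => ?_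
  rw [Pi.smul_apply, hg i]
  have e2 : jacobiSecond (HahnSeries.ofSuppBddBelow (F i) (hF i)) (b' i) (a' i) w k =
    (Int.negOnePow k : ℤ) • oppSeries k (HahnSeries.ofSuppBddBelow (F i) (hF i)) (b' i) (a' i) w :=
    rfl
  have hnil := (isIterated_oppProd (b' i) (a' i) w).isNil
  rw [e2, oppSeries_eq_act (fun s hs => if_neg (by omega)), negOnePow_natCast,
    ← Int.cast_smul_eq_zsmul ℂ, smul_act _ _ hnil, smul_act _ _ hnil]
  refine congrFun (congrArg (fun h => ⇑(act (W := W) h)) (PowerSeries.ext fun n => ?_)) _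
  have hn : (HahnSeries.ofSuppBddBelow (F i) (hF i)).coeff ((n : ℤ) - k) =
      (-1) ^ k * ((-1) ^ n * (c i * PowerSeries.coeff n (g i))) := by
    have h1 : (HahnSeries.ofSuppBddBelow (F i) (hF i)).coeff ((n : ℤ) - k) = F i (n - k) := rfl
    rw [h1]
    simp only [F]
    rw [add_sub_cancel, if_pos (Int.natCast_nonneg n), Int.toNat_natCast]
  have hs : ∀ (n : ℕ), ((-1 : ℂ) ^ n) * (-1) ^ n = 1 := fun n => by
    rw [← mul_pow, neg_one_mul, neg_neg, one_pow]
  rw [PowerSeries.coeff_smul, PowerSeries.coeff_smul, PowerSeries.coeff_mk, hn, smul_eq_mul,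
    smul_eq_mul]
  push_cast
  linear_combination (-(c i * PowerSeries.coeff n (g i))) * ((-1) ^ k * (-1) ^ k * hs n + hs k)

/-! ### The Jacobi identity -/

theorem diag_diffEnd_pow {F : ℤ → ℤ → W} (h : F ∈ finitePole W) (n : ℤ) (k : ℕ) :
    diag n ((diffEnd ^ k) F) = diag (n + k) F := by
  induction k generalizing F with
  | zero => simp
  | succ k ih =>
    rw [pow_succ, Module.End.mul_apply, ih (diffEnd_mem_finitePole h), diag_diffEnd h,
      show n + k + 1 = n + ((k + 1 : ℕ) : ℤ) by push_cast; ring]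

section HasReordering

variable {a b : VertexOperator ℂ W} {k r : ℕ} {f : Fin r → LaurentSeries ℂ}
  {b' a' : Fin r → VertexOperator ℂ W}

theorem exists_sum_jacobiSecond_bound (f : Fin r → LaurentSeries ℂ)
    (b' a' : Fin r → VertexOperator ℂ W) (w : W) : ∃ N : ℤ, ∀ l : ℤ, ∀ p < N, ∀ q,
      (∑ i, jacobiSecond (f i) (b' i) (a' i) w l) p q = 0 := by
  choose M hM using fun i => exists_coeff_eq_zero (a' i) w
  obtain ⟨N, hN⟩ := (Set.finite_range M).bddBelow
  refine ⟨N, fun l p hp q => ?_⟩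
  rw [Finset.sum_apply, Finset.sum_apply]
  refine Finset.sum_eq_zero fun i _ => ?_
  rw [jacobiSecond, oppSeries_apply_eq_zero l (f i) (b' i) (hM i)
    (lt_of_lt_of_le hp (hN ⟨i, rfl⟩)), smul_zero]

theorem HasReordering.compat (h : HasReordering k a b f b' a') : Compat a b k := by
  rw [compat_iff]
  intro w
  obtain ⟨N, hN⟩ := exists_sum_jacobiSecond_bound f b' a' w
  obtain ⟨M, hM⟩ := exists_coeff_eq_zero b w
  refine ⟨min N M, fun p q hpq => ?_⟩
  rcases hpq with hp | hq
  · rw [h w, hN k p (by omega)]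
  · exact diffEnd_pow_bound (N := M) (fun p q hq => by rw [prodSeries, hM q hq, map_zero]) k p q
      (by omega)

theorem diffEnd_sum_jacobiSecond (f : Fin r → LaurentSeries ℂ)
    (b' a' : Fin r → VertexOperator ℂ W) (w : W) (l : ℤ) :
    diffEnd (∑ i, jacobiSecond (f i) (b' i) (a' i) w l) =
      ∑ i, jacobiSecond (f i) (b' i) (a' i) w (l + 1) := by
  rw [map_sum]
  exact Finset.sum_congr rfl fun i _ => diffEnd_jacobiSecond _ _ _ _ _

/-- The residue in `x₁` of the left hand side of the Jacobi identity: both terms are expansions of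
`(x₁ - x₂) ^ (l - k)` times the series `(x₁ - x₂) ^ k a(x₁) b(x₂) w`, which lies in
`W((x₁, x₂))`. -/
theorem HasReordering.residue (h : HasReordering k a b f b' a') (w : W) (l t : ℤ) :
    jacobiFirst a b w l (-1) t - ∑ i, jacobiSecond (f i) (b' i) (a' i) w l (-1) t =
      coeff (nthProd a l b) t w := by
  have hL := (compat_iff a b k).mp h.compat w
  obtain ⟨N, hN⟩ := exists_sum_jacobiSecond_bound f b' a' w
  obtain ⟨M, hM⟩ := exists_coeff_eq_zero b w
  have hb : ∀ p, ∀ q < M, prodSeries a b w p q = 0 := fun p q hq => by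
    rw [prodSeries, hM q hq, map_zero]
  have e1 : jacobiFirst a b w l = expand (l - k) ((diffEnd ^ k) (prodSeries a b w)) := by
    rw [expand_diffEnd_pow _ hb, sub_add_cancel]
    rfl
  have e2 := eq_expandSnd (N := N) hN (diffEnd_sum_jacobiSecond f b' a' w) k l
  rw [← h w] at e2
  have e3 : ∑ i, jacobiSecond (f i) (b' i) (a' i) w l (-1) t =
      (∑ i, jacobiSecond (f i) (b' i) (a' i) w l) (-1) t := by
    rw [Finset.sum_apply, Finset.sum_apply]
  rw [e3, e1, e2, residue_expand_sub hL, ← diag_prodSeries h.compat]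
  exact (congrFun (diag_diffEnd_pow ⟨k, hL⟩ (l - k) k) t).trans (by rw [sub_add_cancel])

end HasReordering

/-- The right hand side of the Jacobi identity, with the products `aₗ b` in place of the fields of
the modes. -/
def jacobiRight (a b : VertexOperator ℂ W) (w : W) (l : ℤ) : ℤ → ℤ → W :=
  fun p q => ∑ᶠ j : ℕ, ((-1) ^ j * Ring.choose (p + j) j : ℤ) •
    coeff (nthProd a (l + j) b) (q + (p + j) + 1) w

theorem nthProd_eq_zero {a b : VertexOperator ℂ W} {k : ℕ} (h : Compat a b k) {n : ℤ}
    (hn : k ≤ n) : nthProd a n b = 0 := by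
  refine vertexOperator_ext fun t w => ?_
  rw [coeff_nthProd h, nthCoeff, if_neg (by omega), map_zero]
  rfl

theorem jacobiRight_apply {a b : VertexOperator ℂ W} {k : ℕ} (h : Compat a b k) (w : W)
    (l p q : ℤ) {n : ℕ} (hn : k ≤ l + n) : jacobiRight a b w l p q =
      ∑ j ∈ Finset.range n, ((-1) ^ j * Ring.choose (p + j) j : ℤ) •
        coeff (nthProd a (l + j) b) (q + (p + j) + 1) w := by
  refine finsum_eq_sum_of_support_subset _ fun j hj => ?_
  by_contra hlt
  refine hj ?_
  dsimp only
  rw [nthProd_eq_zero h (by simp only [Finset.coe_range, Set.mem_Iio] at hlt; omega), map_zero]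
  exact smul_zero _

theorem jacobiRight_eq_zero {a b : VertexOperator ℂ W} {k : ℕ} (h : Compat a b k) (w : W)
    {l : ℤ} (hl : k ≤ l) : jacobiRight a b w l = 0 := by
  funext p q
  exact jacobiRight_apply h w l p q (n := 0) (by simpa using hl)

/-- By this only the term with `j = 0` of the right hand side of the Jacobi identity has a residue
in `x₁`. -/
theorem choose_neg_one_add {j : ℕ} (hj : j ≠ 0) : Ring.choose (-1 + (j : ℤ)) j = 0 := by
  obtain ⟨i, rfl⟩ := Nat.exists_eq_succ_of_ne_zero hj
  rw [show -1 + ((i.succ : ℕ) : ℤ) = (i : ℤ) by push_cast; ring, Ring.choose_natCast,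
    Nat.choose_eq_zero_of_lt i.lt_succ_self, Nat.cast_zero]

theorem jacobiRight_neg_one (a b : VertexOperator ℂ W) (w : W) (l t : ℤ) :
    jacobiRight a b w l (-1) t = coeff (nthProd a l b) t w := by
  rw [jacobiRight, finsum_eq_single _ 0]
  · rw [Ring.choose_zero_right, pow_zero, mul_one, one_smul, Nat.cast_zero, add_zero, add_zero,
      neg_add_cancel_right]
  · intro j hj
    rw [choose_neg_one_add hj, mul_zero, zero_smul]

theorem diffEnd_jacobiRight {a b : VertexOperator ℂ W} {k : ℕ} (h : Compat a b k) (w : W)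
    (l : ℤ) : diffEnd (jacobiRight a b w l) = jacobiRight a b w (l + 1) := by
  funext p q
  obtain ⟨n, hn⟩ : ∃ n : ℕ, (k : ℤ) ≤ l + n := ⟨(k - l).toNat, by omega⟩
  rw [diffEnd_apply, jacobiRight_apply h w l (p - 1) q (n := n + 1) (by push_cast; omega),
    jacobiRight_apply h w l p (q - 1) (n := n + 1) (by push_cast; omega),
    jacobiRight_apply h w (l + 1) p q (n := n) (by omega), ← Finset.sum_sub_distrib,
    Finset.sum_range_succ']
  have e0 : ((-1) ^ 0 * Ring.choose (p - 1 + ((0 : ℕ) : ℤ)) 0 : ℤ) •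
        coeff (nthProd a (l + ((0 : ℕ) : ℤ)) b) (q + (p - 1 + ((0 : ℕ) : ℤ)) + 1) w -
      ((-1) ^ 0 * Ring.choose (p + ((0 : ℕ) : ℤ)) 0 : ℤ) •
        coeff (nthProd a (l + ((0 : ℕ) : ℤ)) b) (q - 1 + (p + ((0 : ℕ) : ℤ)) + 1) w = 0 := by
    rw [Ring.choose_zero_right, Ring.choose_zero_right,
      show q + (p - 1 + ((0 : ℕ) : ℤ)) + 1 = q - 1 + (p + ((0 : ℕ) : ℤ)) + 1 by ring, sub_self]
  rw [e0, add_zero]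
  refine Finset.sum_congr rfl fun j _ => ?_
  rw [show q + (p - 1 + ((j + 1 : ℕ) : ℤ)) + 1 = q + (p + j) + 1 by push_cast; ring,
    show q - 1 + (p + ((j + 1 : ℕ) : ℤ)) + 1 = q + (p + j) + 1 by push_cast; ring,
    show l + ((j + 1 : ℕ) : ℤ) = l + 1 + j by push_cast; ring,
    show p - 1 + ((j + 1 : ℕ) : ℤ) = p + j by push_cast; ring,
    show p + ((j + 1 : ℕ) : ℤ) = p + j + 1 by push_cast; ring, ← sub_smul,
    Ring.choose_succ_succ]
  congr 1
  ring

/-- A solution of `X (l + 1) = (x₁ - x₂) X l` that vanishes for some `l` and has no residue in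
`x₁` is zero: a series killed by `x₁ - x₂` is determined by its residue. -/
theorem eq_zero_of_residue {X : ℤ → ℤ → ℤ → W} (hX : ∀ l, diffEnd (X l) = X (l + 1)) {k : ℤ}
    (hk : X k = 0) (hres : ∀ l t, X l (-1) t = 0) (l : ℤ) : X l = 0 := by
  have step : ∀ l, X (l + 1) = 0 → X l = 0 := by
    intro l hl
    have hd : ∀ p q, X l (p - 1) q = X l p (q - 1) := fun p q => by
      rw [← sub_eq_zero, ← diffEnd_apply, hX, hl]
      rfl
    have up : ∀ (n : ℕ) (q : ℤ), X l (-1 + n) q = 0 := by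
      intro n
      induction n with
      | zero => simpa using hres l
      | succ n ih =>
        intro q
        have := hd (-1 + ((n + 1 : ℕ) : ℤ)) (q + 1)
        rw [add_sub_cancel_right] at this
        rw [← this, show -1 + ((n + 1 : ℕ) : ℤ) - 1 = -1 + n by push_cast; ring, ih]
    have down : ∀ (n : ℕ) (q : ℤ), X l (-1 - n) q = 0 := by
      intro n
      induction n with
      | zero => simpa using hres l
      | succ n ih =>
        intro q
        rw [show -1 - ((n + 1 : ℕ) : ℤ) = -1 - n - 1 by push_cast; ring, hd, ih]
    funext p q
    rcases le_total (-1) p with hp | hp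
    · obtain ⟨n, rfl⟩ := Int.le.dest hp
      exact up n q
    · obtain ⟨n, hn⟩ := Int.le.dest hp
      rw [show p = -1 - n by omega]
      exact down n q
  rcases le_total l k with hl | hl
  · obtain ⟨n, hn⟩ := Int.le.dest hl
    induction n generalizing l with
    | zero => rwa [show l = k by simpa using hn]
    | succ n ih => exact step l (ih (l + 1) (by push_cast at hn; omega) (by push_cast at hn; omega))
  · obtain ⟨n, rfl⟩ := Int.le.dest hl
    rw [← diffEnd_pow_eq_of_diffEnd hX, hk, map_zero]

theorem HasReordering.jacobi {a b : VertexOperator ℂ W} {k r : ℕ} {f : Fin r → LaurentSeries ℂ}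
    {b' a' : Fin r → VertexOperator ℂ W} (h : HasReordering k a b f b' a') (w : W) (l p q : ℤ) :
    jacobiFirst a b w l p q - ∑ i, jacobiSecond (f i) (b' i) (a' i) w l p q =
      jacobiRight a b w l p q := by
  obtain ⟨M, hM⟩ := exists_coeff_eq_zero b w
  have hb : ∀ p, ∀ q < M, prodSeries a b w p q = 0 := fun p q hq => by
    rw [prodSeries, hM q hq, map_zero]
  have e1 : ∀ l, jacobiFirst a b w l = expand l (prodSeries a b w) := fun _ => rfl
  have key := eq_zero_of_residue
    (X := fun l => jacobiFirst a b w l - ∑ i, jacobiSecond (f i) (b' i) (a' i) w l -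
      jacobiRight a b w l) (k := k) ?_ ?_ ?_ l
  · have := congrFun (congrFun key p) q
    rw [Pi.sub_apply, Pi.sub_apply, Pi.sub_apply, Pi.sub_apply, Finset.sum_apply,
      Finset.sum_apply] at this
    exact sub_eq_zero.mp this
  · intro l
    rw [map_sub, map_sub, e1, diffEnd_expand l hb, diffEnd_sum_jacobiSecond,
      diffEnd_jacobiRight h.compat]
    rfl
  · rw [e1, expand_natCast k hb, h w, sub_self, jacobiRight_eq_zero h.compat w le_rfl, sub_self]
  · intro l t
    rw [Pi.sub_apply, Pi.sub_apply, Pi.sub_apply, Pi.sub_apply, Finset.sum_apply,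
      Finset.sum_apply, h.residue, jacobiRight_neg_one, sub_self]

/-! ### Creative fields -/

theorem IsCreative.zero (one : W) : IsCreative one (0 : VertexOperator ℂ W) 0 := by
  refine ⟨fun n _ => ?_, ?_⟩ <;> · rw [map_zero]; rfl

theorem IsCreative.add {one v v' : W} {a a' : VertexOperator ℂ W} (h : IsCreative one a v)
    (h' : IsCreative one a' v') : IsCreative one (a + a') (v + v') := by
  have e : ∀ n, coeff (a + a') n one = coeff a n one + coeff a' n one := fun n => by
    rw [map_add]
    rfl
  exact ⟨fun n hn => by rw [e, h.1 n hn, h'.1 n hn, add_zero], by rw [e, h.2, h'.2]⟩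

theorem IsCreative.smul {one v : W} {a : VertexOperator ℂ W} (c : ℂ) (h : IsCreative one a v) :
    IsCreative one (c • a) (c • v) := by
  have e : ∀ n, coeff (c • a) n one = c • coeff a n one := fun n => by
    rw [map_smul]
    rfl
  exact ⟨fun n hn => by rw [e, h.1 n hn, smul_zero], by rw [e, h.2]⟩

theorem isCreative_idOp (one : W) : IsCreative one (idOp W) one :=
  ⟨fun n hn => by rw [coeff_idOp, if_neg hn.ne], by rw [coeff_idOp, if_pos rfl]⟩

theorem diffEnd_pow_apply_zero {F : ℤ → ℤ → W} (hF : ∀ p, ∀ q < 0, F p q = 0) (k : ℕ) (p : ℤ) :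
    (diffEnd ^ k) F p 0 = F (p - k) 0 := by
  induction k generalizing p with
  | zero => simp
  | succ k ih =>
    rw [diffEnd_pow_succ_apply, ih, diffEnd_pow_bound hF k _ _ (by omega), sub_zero]
    congr 1
    push_cast
    ring

/-- If `a(x) b` reorders into fields `a'` that are regular at the vacuum and `b` creates `v`, then
`(x₁ - x₂) ^ k a(x₁) b(x₂) 1` is a power series in `x₁, x₂`, whence `aₙ b` creates `aₙ v`. -/
theorem isCreative_nthProd {A B : Set (VertexOperator ℂ W)} {a b : VertexOperator ℂ W}
    {one v : W} (h : prodSeries a b ∈ reorderable A B)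
    (hA : ∀ a' ∈ A, ∀ n < 0, coeff a' n one = 0) (hb : IsCreative one b v) (n : ℤ) :
    IsCreative one (nthProd a n b) (VertexOperator.ncoeff a n v) := by
  obtain ⟨k, r, f, b', a', hmem, hr⟩ := exists_hasReordering h
  have hF : ∀ p, ∀ q < 0, prodSeries a b one p q = 0 := fun p q hq => by
    rw [prodSeries, hb.1 q hq, map_zero]
  have h1 : ∀ p < 0, ∀ q, (diffEnd ^ k) (prodSeries a b one) p q = 0 := fun p hp q => by
    rw [hr one, Finset.sum_apply, Finset.sum_apply]
    exact Finset.sum_eq_zero fun i _ => by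
      rw [jacobiSecond, oppSeries_apply_eq_zero k (f i) (b' i) (hA _ (hmem i).2) hp, smul_zero]
  have h2 := diffEnd_pow_bound hF k
  have h3 : ∀ p, (diffEnd ^ k) (prodSeries a b one) p 0 = coeff a (p - k) v := fun p => by
    rw [diffEnd_pow_apply_zero hF, prodSeries, hb.2]
  have e : ∀ t, coeff (nthProd a n b) t one = diagRes k n (prodSeries a b one) t := fun t => by
    rw [coeff_nthProd hr.compat, nthCoeff_eq_diagRes]
  unfold diagRes at e
  generalize (diffEnd ^ k) (prodSeries a b one) = G at *
  rw [VertexOperator.ncoeff_apply]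
  by_cases hn : n < k
  · obtain ⟨i, hi⟩ : ∃ i : ℕ, (k : ℤ) - n - 1 = i := ⟨((k : ℤ) - n - 1).toNat, by omega⟩
    simp only [if_pos hn, hi, Int.toNat_natCast] at e
    have hz : ∀ t ≤ 0, ∀ p : ℤ, p ≠ i ∨ t < 0 →
        (Ring.choose p i : ℤ) • G p (t + i - p) = 0 := by
      intro t ht p hp
      rcases lt_or_ge p 0 with hp0 | hp0
      · rw [h1 p hp0, smul_zero]
      rcases lt_or_ge p i with hpi | hpi
      · lift p to ℕ using hp0
        rw [Ring.choose_natCast, Nat.choose_eq_zero_of_lt (by omega), Nat.cast_zero, zero_smul]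
      · rw [h2 p _ (by omega), smul_zero]
    refine ⟨fun t ht => ?_, ?_⟩
    · rw [e]
      exact finsum_eq_zero_of_forall_eq_zero fun p => hz t ht.le p (Or.inr ht)
    · rw [e, finsum_eq_single _ (i : ℤ) fun p hp => hz 0 le_rfl p (Or.inl hp), Ring.choose_natCast,
        Nat.choose_self, Nat.cast_one, one_smul, show (0 : ℤ) + i - i = 0 by ring, h3,
        show (i : ℤ) - k = -n - 1 by omega]
  · simp only [if_neg hn] at e
    refine ⟨fun t _ => e t, ?_⟩
    have := h3 (k - n - 1)
    rw [h1 _ (by omega), show (k : ℤ) - n - 1 - k = -n - 1 by ring] at this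
    rw [e, ← this]

/-! ### Weak quantum vertex algebras -/

theorem jacobiThird_eq_jacobiRight {Y : W →ₗ[ℂ] VertexOperator ℂ W} {u v : W}
    (h : ∀ n, Y (VertexOperator.ncoeff (Y u) n v) = nthProd (Y u) n (Y v)) (w : W) (l p q : ℤ) :
    jacobiThird Y u v w l p q = jacobiRight (Y u) (Y v) w l p q := by
  refine finsum_congr fun j => ?_
  rw [← h, VertexOperator.ncoeff_apply, show -(l + (j : ℤ)) - 1 = -l - 1 - j by ring]

/-- In a weak quantum vertex algebra the field of `uₙ v` is the `n`-th product of the fields of `u`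
and `v`. -/
theorem IsWeakQVA.map_ncoeff {Y : W →ₗ[ℂ] VertexOperator ℂ W} {one : W} (h : IsWeakQVA Y one)
    (u v : W) (n : ℤ) : Y (VertexOperator.ncoeff (Y u) n v) = nthProd (Y u) n (Y v) := by
  obtain ⟨r, v', u', f, hJ⟩ := h.jacobi u v
  obtain ⟨N, hN⟩ := exists_coeff_eq_zero (Y u) v
  obtain ⟨k, hk⟩ : ∃ k : ℕ, -(k : ℤ) - 1 < N := ⟨(-N).toNat, by omega⟩
  -- The third term has no contribution to the coefficients of `x₀ ^ (-k-1)`.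
  have h3 : ∀ w p q, jacobiThird Y u v w k p q = 0 := fun w p q =>
    finsum_eq_zero_of_forall_eq_zero fun j => by
      rw [hN _ (by omega), map_zero, map_zero]
      exact smul_zero _
  have hr : HasReordering k (Y u) (Y v) f (fun i => Y (v' i)) fun i => Y (u' i) := by
    intro w
    obtain ⟨M, hM⟩ := exists_coeff_eq_zero (Y v) w
    rw [← expand_natCast (N := M) k fun p q hq => by rw [prodSeries, hM q hq, map_zero]]
    funext p q
    rw [Finset.sum_apply, Finset.sum_apply]
    exact sub_eq_zero.mp ((hJ w k p q).trans (h3 w p q))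
  refine vertexOperator_ext fun t w => ?_
  rw [← hr.residue w n t, hJ w n (-1) t, jacobiThird, finsum_eq_single _ 0]
  · rw [Ring.choose_zero_right, pow_zero, mul_one, one_smul, Nat.cast_zero, add_zero, sub_zero,
      neg_add_cancel_right, VertexOperator.ncoeff_apply]
  · intro j hj
    rw [choose_neg_one_add hj, mul_zero, zero_smul]

/-- A map compatible with all the `n`-th products on a space spanned by words satisfies the axioms
of a weak quantum vertex algebra as soon as its values are creative. -/
theorem IsWordSpan.isWeakQVA {S : Set (VertexOperator ℂ W)} {Y : W →ₗ[ℂ] VertexOperator ℂ W}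
    {one : W} (h : IsWordSpan S (LinearMap.range Y)) (hone : Y one = idOp W)
    (hY : ∀ v, IsCreative one (Y v) v) : IsWeakQVA Y one where
  vacuum := hone
  creation := hY
  jacobi u v := by
    have hK := fun v => LinearMap.mem_range_self Y v
    -- A field in the range of `Y` is determined by the vector that it creates.
    have hmul : ∀ n, Y (VertexOperator.ncoeff (Y u) n v) = nthProd (Y u) n (Y v) := by
      intro n
      obtain ⟨x, hx⟩ := h.nthProd_mem_of_mem (hK u) (hK v) n
      have hc := isCreative_nthProd (h.prodSeries_mem (hK u) (hK v))
        (by rintro _ ⟨y, rfl⟩; exact (hY y).1) (hY v) n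
      rw [← hc.2, ← hx, (hY x).2]
    obtain ⟨k, r, f, b', a', hmem, hr⟩ := exists_hasReordering (h.prodSeries_mem (hK u) (hK v))
    choose v' hv' using fun i => (hmem i).1
    choose u' hu' using fun i => (hmem i).2
    refine ⟨r, v', u', f, fun w l p q => ?_⟩
    simp only [hv', hu']
    rw [hr.jacobi, jacobiThird_eq_jacobiRight hmul]

end QVA

end

open QVA in
theorem theorem2p6 {V : Type*} [AddCommGroup V] [Module ℂ V] (U : Set V) (one : V)
    (Y₀ : U → VertexOperator ℂ V)
    (hcreation : ∀ u : U, QVA.IsCreative one (Y₀ u) (u : V))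
    (hlocal : QVA.IsSLocal (Set.range Y₀))
    (hspan : Submodule.span ℂ (Set.range fun L : List (U × ℤ) =>
      L.foldr (fun un v => VertexOperator.ncoeff (Y₀ un.1) un.2 v) one) = ⊤)
    (f : V →ₗ[ℂ] QVA.generated (Set.range Y₀))
    (hf_one : (f one : VertexOperator ℂ V) = QVA.idOp V)
    (hf : ∀ (u : U) (n : ℤ) (v : V),
      (f (VertexOperator.ncoeff (Y₀ u) n v) : VertexOperator ℂ V) =
        QVA.nthProd (Y₀ u) n (f v : VertexOperator ℂ V)) :
    ∃! Y : V →ₗ[ℂ] VertexOperator ℂ V,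
      (∀ u : U, Y (u : V) = Y₀ u) ∧ QVA.IsWeakQVA Y one := by
  -- Induction on a vector along the spanning set of words.
  have words : ∀ {P : V → Prop}, P 0 → (∀ v w, P v → P w → P (v + w)) →
      (∀ (c : ℂ) v, P v → P (c • v)) → (∀ L : List (U × ℤ),
        P (L.foldr (fun un v => VertexOperator.ncoeff (Y₀ un.1) un.2 v) one)) → ∀ v, P v := by
    intro P h0 hadd hsmul hw v
    have hv : v ∈ Submodule.span ℂ (Set.range fun L : List (U × ℤ) =>
      L.foldr (fun un v => VertexOperator.ncoeff (Y₀ un.1) un.2 v) one) := hspan ▸ Submodule.mem_top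
    induction hv using Submodule.span_induction with
    | mem _ h => obtain ⟨L, rfl⟩ := h; exact hw L
    | zero => exact h0
    | add v w _ _ hv hw => exact hadd v w hv hw
    | smul c v _ hv => exact hsmul c v hv
  let Y : V →ₗ[ℂ] VertexOperator ℂ V := (QVA.generated (Set.range Y₀)).subtype ∘ₗ f
  have hY_one : Y one = QVA.idOp V := hf_one
  have hY : ∀ (u : U) (n : ℤ) (v : V),
      Y (VertexOperator.ncoeff (Y₀ u) n v) = QVA.nthProd (Y₀ u) n (Y v) := hf
  have hext : ∀ u : U, Y (u : V) = Y₀ u := fun u => by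
    have := hY u (-1) one
    rwa [hY_one, nthProd_neg_one_idOp, VertexOperator.ncoeff_apply, neg_neg, sub_self,
      (hcreation u).2] at this
  have hS : IsWordSpan (Set.range Y₀) (LinearMap.range Y) :=
    { reorder := hlocal.mem_reorderable
      idOp_mem := ⟨one, hY_one⟩
      nthProd_mem := by
        rintro _ ⟨u, rfl⟩ _ ⟨v, rfl⟩ n
        exact ⟨_, hY u n v⟩
      le_span := by
        rintro _ ⟨v, rfl⟩
        refine words (P := fun v => Y v ∈ _) ?_ ?_ ?_ ?_ v
        · rw [map_zero]; exact zero_mem _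
        · intro v w hv hw
          rw [map_add]; exact add_mem hv hw
        · intro c v hv
          rw [map_smul]; exact Submodule.smul_mem _ _ hv
        · intro L
          refine Submodule.subset_span (Set.mem_iUnion.mpr ⟨L.length, ?_⟩)
          induction L with
          | nil => exact hY_one
          | cons un L ih => exact ⟨_, ⟨un.1, rfl⟩, un.2, _, ih, hY _ _ _⟩ }
  have hcreative : ∀ v, IsCreative one (Y v) v := by
    refine words ?_ ?_ ?_ ?_
    · rw [map_zero]; exact IsCreative.zero one
    · intro v w hv hw
      rw [map_add]; exact hv.add hw
    · intro c v hv
      rw [map_smul]; exact hv.smul c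
    · intro L
      induction L with
      | nil => exact hY_one ▸ isCreative_idOp one
      | cons un L ih =>
        rw [List.foldr_cons, hY]
        exact isCreative_nthProd (hS.prodSeries_mem_of_mem_set ⟨un.1, rfl⟩ ⟨_, rfl⟩)
          (by rintro _ ⟨u, rfl⟩; exact (hcreation u).1) ih un.2
  refine ⟨Y, ⟨hext, hS.isWeakQVA hY_one hcreative⟩, ?_⟩
  rintro Y' ⟨hext', hQ⟩
  refine LinearMap.ext (words ?_ ?_ ?_ ?_)
  · rw [map_zero, map_zero]
  · intro v w hv hw
    rw [map_add, map_add, hv, hw]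
  · intro c v hv
    rw [map_smul, map_smul, hv]
  · intro L
    induction L with
    | nil => exact hQ.vacuum.trans hY_one.symm
    | cons un L ih =>
      rw [List.foldr_cons, hY, ← ih, ← hext' un.1, hQ.map_ncoeff]
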